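/- **Setting.** Let $T\in(0,\infty]$ and let $\mathscr T=[0,T]$ if $T<\infty$, $\mathscr T=[0,\infty)$ if $T=\infty$. Fix a filtered probability space $(\Omega,\mathcal F,(\mathcal F_t)_{t\in\mathscr T},P)$ and a discount rate $\delta\ge 0$, with $\delta>0$ if $T=\infty$. Let $\mathscr L^2_\delta$ be the set of progressively measurable, finite-dimensional processes $X$ with $E[\int_0^T e^{-\delta t}\|X_t\|^2dt]<\infty$. There are $d$ risky assets with volatility matrix $\sigma\in\mathbb R^{d\times d}$ such that $\Sigma=\sigma\sigma^\top$ is nonsingular, and $\Lambda\in\mathbb R^{d\times d}$ is the diagonal matrix of trading costs $\lambda^1,\dots,\lambda^d>0$. There are $N\ge1$ agents with risk aversions $\gamma^1,\dots,\gamma^N>0$, $\gamma^N=\max_n\gamma^n$, and endowment exposures $\zeta^n\in\mathscr L^2_\delta$ with values in $\mathbb R^d$. Noise traders hold $\psi_t=\int_0^t\dot\psi_s\,ds$, where $d\dot\psi_t=\mu^\psi_t\,dt+dM^\psi_t$, $\psi,\dot\psi,\mu^\psi\in\mathscr L^2_\delta$ are $\mathbb R^d$-valued and $M^\psi$ is an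 $\mathbb R^d$-valued local martingale. For an expected return process $\mu\in\mathscr L^2_\delta$, Agent $n$ chooses a trading rate $\dot\varphi$ with $\dot\varphi\in\mathscr L^2_\delta$ and $\varphi=\int_0^\cdot\dot\varphi_s\,ds\in\mathscr L^2_\delta$ to maximize $$J^n(\dot\varphi)=E\Big[\int_0^Te^{-\delta t}\Big(\varphi_t^\top\mu_t-\tfrac{\gamma^n}{2}(\varphi_t+\zeta^n_t)^\top\Sigma(\varphi_t+\zeta^n_t)-\dot\varphi_t^\top\Lambda\dot\varphi_t\Big)dt\Big]+c^n,$$ where $c^n\in\mathbb R$ is the contribution of the unhedgeable part of the endowment, which does not depend on $\dot\varphi$. A process $\mu\in\mathscr L^2_\delta$ is a *frictional equilibrium return* if there are individually optimal strategies $\varphi^1,\dots,\varphi^N$ for $\mu$ that clear the market: $\varphi^1_t+\dots+\varphi^N_t+\psi_t=0$ for all $t\in\mathscr T$, almost surely. **Theorem.** 1. The linear FBSDE $$d\varphi^\Lambda_t=\dot\varphi^\Lambda_t\,dt,\quad \varphi^\Lambda_0=0,\qquad d\dot\varphi^\Lambda_t=dM_t+(B\varphi^\Lambda_t+\delta\dot\varphi^\Lambda_t-A\zeta_t+\chi_t)\,dt,$$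 with terminal condition $\dot\varphi^\Lambda_T=0$ if $T<\infty$, has a solution with $\varphi^\Lambda,\dot\varphi^\Lambda\in\mathscr L^2_\delta$ and $M$ an $\mathbb R^{d(N-1)}$-valued martingale with finite second moments, and $(\varphi^\Lambda,\dot\varphi^\Lambda)=(\varphi^{\Lambda,1},\dots,\varphi^{\Lambda,N-1},\dot\varphi^{\Lambda,1},\dots,\dot\varphi^{\Lambda,N-1})$ is unique. Here $\zeta=(\zeta^1,\dots,\zeta^N)$; $B$ has the blocks $\big(\frac{\gamma^N-\gamma^m}{N}+\gamma^n1_{\{n=m\}}\big)\frac{\Lambda^{-1}\Sigma}{2}$, $1\le n,m\le N-1$; $A$ has the blocks $\big(\frac{\gamma^m}{N}-\gamma^n1_{\{n=m\}}\big)\frac{\Lambda^{-1}\Sigma}{2}$, $1\le n\le N-1$, $1\le m\le N$; and each of the $N-1$ blocks of $\chi_t$ is $\frac1N\big(\frac{\gamma^N\Lambda^{-1}\Sigma}{2}\psi_t+\delta\dot\psi_t-\mu^\psi_t\big)$. 2. Set $\varphi^{\Lambda,N}=-\sum_{n=1}^{N-1}\varphi^{\Lambda,n}-\psi$ and $$\mu^\Lambda_t=\sum_{n=1}^{N-1}\frac{(\gamma^n-\gamma^N)\Sigma}{N}\varphi^{\Lambda,n}_t+\sum_{n=1}^N\frac{\gamma^n\Sigma}{N}\zeta^n_t-\frac{\gamma^N\Sigma}{N}\psi_t+\frac{2\Lambda}{N}(\mu^\psi_t-\delta\dot\psi_t).$$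 Every frictional equilibrium return equals $\mu^\Lambda$ ($dt\otimes P$-almost everywhere), and the corresponding market-clearing optimal strategies are $\varphi^{\Lambda,1},\dots,\varphi^{\Lambda,N}$ (up to indistinguishability). 3. If, moreover, $M^\psi$ is a martingale and, in case $T<\infty$, $\dot\psi_T=0$ almost surely, then $\mu^\Lambda$ is a frictional equilibrium return, so the frictional equilibrium return exists and is unique, and for every $n=1,\dots,N$ the strategy $\varphi^{\Lambda,n}$ is the unique individually optimal strategy of Agent $n$ given $\mu^\Lambda$. -/

import Mathlib

open MeasureTheory ProbabilityTheory Filter Topology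
open scoped ENNReal Matrix

/-- The time set of the model with horizon `T ∈ (0, ∞]`: it is `[0, T]` if `T < ∞` and `[0, ∞)` if
`T = ∞`. -/
def timeSet (T : ℝ≥0∞) : Set ℝ := {t | 0 ≤ t ∧ ENNReal.ofReal t ≤ T}

/-- The time set as a type. -/
abbrev Time (T : ℝ≥0∞) : Type := ↥(timeSet T)

instance timeSet_ordConnected (T : ℝ≥0∞) : (timeSet T).OrdConnected :=
  ⟨fun _ hx _ hy _ hz => ⟨hx.1.trans hz.1, (ENNReal.ofReal_le_ofReal hz.2).trans hy.2⟩⟩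

instance timeOrderBot (T : ℝ≥0∞) : OrderBot (Time T) where
  bot := ⟨0, le_refl 0, by simp⟩
  bot_le t := t.2.1

/-- Lebesgue measure on the time set. -/
noncomputable def timeMeasure (T : ℝ≥0∞) : Measure (Time T) :=
  (volume : Measure ℝ).comap (fun t : Time T => (t : ℝ))

/-- The space `L²_δ`: progressively measurable processes `X` with
`E[∫₀ᵀ e^{-δ t} ‖X_t‖² dt] < ∞`. -/
def MemL2 {Ω : Type*} {mΩ : MeasurableSpace Ω} (P : Measure Ω) {T : ℝ≥0∞}
    (F : Filtration (Time T) mΩ) (δ : ℝ) {V : Type*} [NormedAddCommGroup V]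
    (X : Time T → Ω → V) : Prop :=
  IsStronglyProgressive F X ∧
    ∫⁻ ω, ∫⁻ t, ENNReal.ofReal (Real.exp (-δ * t) * ‖X t ω‖ ^ 2) ∂(timeMeasure T) ∂P < ∞

/-- The position `∫₀ᵗ u_s ds` held at time `t` by trading at rate `u` from a zero initial
position. -/
noncomputable def position {Ω : Type*} {T : ℝ≥0∞} {V : Type*} [NormedAddCommGroup V]
    [NormedSpace ℝ V] (u : Time T → Ω → V) (t : Time T) (ω : Ω) : V :=
  ∫ s in Set.Iic t, u s ω ∂(timeMeasure T)

/-- Right-continuous paths with left limits. -/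
def IsCadlagPath {T : ℝ≥0∞} {V : Type*} [TopologicalSpace V] (x : Time T → V) : Prop :=
  ∀ t, ContinuousWithinAt x (Set.Ioi t) t ∧ ∃ l, Tendsto x (𝓝[<] t) (𝓝 l)

/-- Local martingales: along some localizing sequence of stopping times, the stopped processes are
martingales with right-continuous paths that have left limits. -/
def IsLocalMartingale {Ω : Type*} {mΩ : MeasurableSpace Ω} (P : Measure Ω) {T : ℝ≥0∞}
    (F : Filtration (Time T) mΩ) {V : Type*} [NormedAddCommGroup V] [NormedSpace ℝ V]
    [CompleteSpace V] (M : Time T → Ω → V) : Prop :=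
  Locally (fun X => Martingale X F P ∧ ∀ᵐ ω ∂P, IsCadlagPath (fun t => X t ω)) F M P

/-- The exogenous data of the economy with `N = K + 1` agents and `d` risky assets, with its
standing assumptions. Agents are indexed by `Fin (K + 1)`; Agent `N` is `Fin.last K`, and the
Agents `1, …, N - 1` are `Fin.castSucc m` for `m : Fin K`. -/
structure Market {Ω : Type*} {mΩ : MeasurableSpace Ω} (P : Measure Ω) {T : ℝ≥0∞}
    (F : Filtration (Time T) mΩ) (K d : ℕ) where
  /-- The time horizon is positive. -/
  horizon_pos : 0 < T
  /-- The discount rate. -/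
  δ : ℝ
  δ_nonneg : 0 ≤ δ
  δ_pos : T = ∞ → 0 < δ
  /-- The volatility matrix of the risky assets. -/
  σ : Matrix (Fin d) (Fin d) ℝ
  cov_nonsingular : IsUnit (σ * σᵀ).det
  /-- The quadratic transaction costs of the single assets. -/
  lam : Fin d → ℝ
  lam_pos : ∀ i, 0 < lam i
  /-- The risk aversions; the one of Agent `N` is the largest. -/
  γ : Fin (K + 1) → ℝ
  γ_pos : ∀ n, 0 < γ n
  γ_le_last : ∀ n, γ n ≤ γ (Fin.last K)
  /-- The exposures of the endowments to asset price shocks. -/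
  ζ : Fin (K + 1) → Time T → Ω → (Fin d → ℝ)
  ζ_mem : ∀ n, MemL2 P F δ (ζ n)
  /-- The summand of Agent `n`'s goal functional that does not depend on the trading strategy,
  namely the expected discounted value of the finite variation part of the endowment, penalized
  for the quadratic variation of the unhedgeable shocks. It may be any real number. -/
  c : Fin (K + 1) → ℝ
  /-- The position of the noise traders. -/
  ψ : Time T → Ω → (Fin d → ℝ)
  /-- The trading rate of the noise traders. -/
  ψrate : Time T → Ω → (Fin d → ℝ)
  /-- The drift of the trading rate of the noise traders. -/
  μψ : Time T → Ω → (Fin d → ℝ)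
  /-- The local martingale part of the trading rate of the noise traders. -/
  Mψ : Time T → Ω → (Fin d → ℝ)
  ψ_mem : MemL2 P F δ ψ
  ψrate_mem : MemL2 P F δ ψrate
  μψ_mem : MemL2 P F δ μψ
  Mψ_localMartingale : IsLocalMartingale P F Mψ
  ψ_eq : ∀ᵐ ω ∂P, ∀ t, ψ t ω = position ψrate t ω
  ψrate_eq : ∀ t, ∀ᵐ ω ∂P,
    ψrate t ω = ψrate ⊥ ω + position μψ t ω + (Mψ t ω - Mψ ⊥ ω)

namespace Market

variable {Ω : Type*} {mΩ : MeasurableSpace Ω} {P : Measure Ω} {T : ℝ≥0∞}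
  {F : Filtration (Time T) mΩ} {K d : ℕ} (E : Market P F K d)

/-- The infinitesimal covariance matrix `Σ = σ σᵀ`. -/
def cov : Matrix (Fin d) (Fin d) ℝ := E.σ * E.σᵀ

/-- The diagonal matrix `Λ` of the transaction costs. -/
def cost : Matrix (Fin d) (Fin d) ℝ := Matrix.diagonal E.lam

/-- The risk aversion of Agent `N`. -/
def γN : ℝ := E.γ (Fin.last K)

/-- Admissible trading rates: the rate and the corresponding position belong to `L²_δ`. -/
def Admissible (u : Time T → Ω → (Fin d → ℝ)) : Prop :=
  MemL2 P F E.δ u ∧ MemL2 P F E.δ (position u)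

/-- The goal functional of Agent `n` for the expected return process `μ`, as a function of the
trading rate `u`. -/
noncomputable def goal (n : Fin (K + 1)) (μ u : Time T → Ω → (Fin d → ℝ)) : ℝ :=
  (∫ ω, ∫ t, Real.exp (-E.δ * t) *
      (position u t ω ⬝ᵥ μ t ω
        - E.γ n / 2 * ((position u t ω + E.ζ n t ω) ⬝ᵥ (E.cov *ᵥ (position u t ω + E.ζ n t ω)))
        - u t ω ⬝ᵥ (E.cost *ᵥ u t ω)) ∂(timeMeasure T) ∂P)
    + E.c n

/-- The rate `u` is individually optimal for Agent `n` given the expected return process `μ`. -/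
def IsOptimal (n : Fin (K + 1)) (μ u : Time T → Ω → (Fin d → ℝ)) : Prop :=
  E.Admissible u ∧ ∀ v, E.Admissible v → E.goal n μ v ≤ E.goal n μ u

/-- The expected return process `μ` is a frictional equilibrium return, with `u n` the trading rate
of Agent `n`: each agent trades optimally, and the market clears at all times. -/
def IsEquilibrium (μ : Time T → Ω → (Fin d → ℝ))
    (u : Fin (K + 1) → Time T → Ω → (Fin d → ℝ)) : Prop :=
  MemL2 P F E.δ μ ∧ (∀ n, E.IsOptimal n μ (u n)) ∧
    ∀ᵐ ω ∂P, ∀ t, ∑ n, position (u n) t ω + E.ψ t ω = 0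

/-- The matrix `Λ⁻¹ Σ / 2`. -/
noncomputable def halfRatio : Matrix (Fin d) (Fin d) ℝ := (1 / 2 : ℝ) • (E.cost⁻¹ * E.cov)

/-- The matrix `B`, with blocks
`((γ^N - γ^m) / N + γ^n 1_{n = m}) Λ⁻¹ Σ / 2` for `n, m = 1, …, N - 1`. -/
noncomputable def B : Matrix (Fin K × Fin d) (Fin K × Fin d) ℝ :=
  Matrix.of fun p q =>
    ((E.γN - E.γ q.1.castSucc) / ((K : ℝ) + 1) + if p.1 = q.1 then E.γ p.1.castSucc else 0)
      * E.halfRatio p.2 q.2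

/-- The matrix `A`, with blocks `(γ^m / N - γ^n 1_{n = m}) Λ⁻¹ Σ / 2` for
`n = 1, …, N - 1` and `m = 1, …, N`. -/
noncomputable def A : Matrix (Fin K × Fin d) (Fin (K + 1) × Fin d) ℝ :=
  Matrix.of fun p q =>
    (E.γ q.1 / ((K : ℝ) + 1) - if p.1.castSucc = q.1 then E.γ p.1.castSucc else 0)
      * E.halfRatio p.2 q.2

/-- The stacked process `ζ = (ζ^1, …, ζ^N)`. -/
def stackedζ (t : Time T) (ω : Ω) : Fin (K + 1) × Fin d → ℝ := fun q => E.ζ q.1 t ω q.2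

/-- The process `χ`, all of whose `N - 1` blocks are
`(γ^N Λ⁻¹ Σ / 2 ψ + δ ψ' - μ^ψ) / N`, where `ψ'` is the rate of the noise traders. -/
noncomputable def χ (t : Time T) (ω : Ω) : Fin K × Fin d → ℝ := fun p =>
  (1 / ((K : ℝ) + 1)) *
    (E.γN • (E.halfRatio *ᵥ E.ψ t ω) + E.δ • E.ψrate t ω - E.μψ t ω) p.2

/-- Solutions `(φ, φrate, M)` of the linear forward-backward stochastic differential equation
`dφ = φrate dt`, `φ_0 = 0`,
`dφrate = dM + (B φ + δ φrate - A ζ + χ) dt`, with `φrate_T = 0` if `T < ∞`, where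
`φ, φrate ∈ L²_δ` and `M` is a martingale with finite second moments. -/
structure IsFBSDESolution (φ φrate M : Time T → Ω → (Fin K × Fin d → ℝ)) : Prop where
  mem : MemL2 P F E.δ φ
  rate_mem : MemL2 P F E.δ φrate
  martingale : Martingale M F P
  sq_integrable : ∀ t, MemLp (M t) 2 P
  forward : ∀ᵐ ω ∂P, ∀ t, φ t ω = position φrate t ω
  backward : ∀ t, ∀ᵐ ω ∂P, φrate t ω = φrate ⊥ ω + (M t ω - M ⊥ ω) +
    position (fun s ω => E.B *ᵥ φ s ω + E.δ • φrate s ω - E.A *ᵥ E.stackedζ s ω + E.χ s ω) t ω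
  terminal : ∀ t : Time T, ENNReal.ofReal t = T → φrate t =ᵐ[P] 0

/-- The positions of the Agents `1, …, N`: the blocks of `φ` for `n = 1, …, N - 1`, and
`-∑_{n < N} φ^n - ψ` for `n = N`. -/
noncomputable def agentPosition (φ : Time T → Ω → (Fin K × Fin d → ℝ)) (n : Fin (K + 1))
    (t : Time T) (ω : Ω) : Fin d → ℝ :=
  Fin.lastCases (motive := fun _ => Fin d → ℝ)
    (-(∑ m : Fin K, fun i => φ t ω (m, i)) - E.ψ t ω) (fun m i => φ t ω (m, i)) n

/-- The trading rates of the Agents `1, …, N`: the blocks of `φrate` for `n = 1, …, N - 1`, and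
minus their sum minus the rate of the noise traders for `n = N`. -/
noncomputable def agentRate (φrate : Time T → Ω → (Fin K × Fin d → ℝ)) (n : Fin (K + 1))
    (t : Time T) (ω : Ω) : Fin d → ℝ :=
  Fin.lastCases (motive := fun _ => Fin d → ℝ)
    (-(∑ m : Fin K, fun i => φrate t ω (m, i)) - E.ψrate t ω) (fun m i => φrate t ω (m, i)) n

/-- The process
`∑_{n < N} (γ^n - γ^N) Σ / N φ^n + ∑_{n ≤ N} γ^n Σ / N ζ^n - γ^N Σ / N ψ + 2 Λ / N (μ^ψ - δ ψ')`,
where `ψ'` is the rate of the noise traders. -/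
noncomputable def equilibriumReturn (φ : Time T → Ω → (Fin K × Fin d → ℝ)) (t : Time T) (ω : Ω) :
    Fin d → ℝ :=
  (∑ n : Fin K, ((E.γ n.castSucc - E.γN) / ((K : ℝ) + 1)) • (E.cov *ᵥ fun i => φ t ω (n, i)))
    + (∑ n : Fin (K + 1), (E.γ n / ((K : ℝ) + 1)) • (E.cov *ᵥ E.ζ n t ω))
    - (E.γN / ((K : ℝ) + 1)) • (E.cov *ᵥ E.ψ t ω)
    + (2 / ((K : ℝ) + 1)) • (E.cost *ᵥ (E.μψ t ω - E.δ • E.ψrate t ω))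

end Market

/-! ### Lebesgue measure on the time set. -/

section TimeSet

variable {T : ℝ≥0∞}

/-! Everything is read off one bounded operator. Let `H` be the Hilbert space of progressive real
processes with inner product `E ∫ e^{-δ t} X_t Y_t dt`, and let `V` be integration in time from
zero. The Schur test for the kernel `e^{-δ (t - s) / 2}`, `s ≤ t`, shows that `V` is bounded on `H`.
By Fubini and conditioning, `V* g` has the version `y_t = E[∫_t^T e^{-δ (s - t)} g_s ds | F_t]`
(`IsBackward.toSpace_eq`), and this process is the solution in `L²_δ` of `dy = (δ y - g) dt + dM`
with `y_T = 0` if `T < ∞` (`IsBackward.martingale`, `isBackward_of_martingale`). Linear backward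
equations are thus statements about `V*`.

The goal of an agent is a quadratic functional of the rate `u`, strictly concave because of the
trading costs, and `u` is optimal exactly if `2 λ_i u_i = V* (μ - γ Σ (V u + ζ))_i`
(`Market.isOptimal_iff_adjoint`).

In the same language the forward-backward system reads `u + B V* V u = V* (A ζ - χ)`. The matrix `B`
need not be symmetric, but it is accretive for a suitable weighted inner product
(`Market.exists_weight`; here it matters that Agent `N` is the most risk averse). The operator on
the left is therefore coercive, and Lax-Milgram gives existence and uniqueness
(`existsUnique_add_sum_adjoint`).

For an arbitrary equilibrium, the sum of the first-order conditions and market clearing present the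
noise traders' rate as `V* g`, where `g` is a multiple of the summed marginal benefits. Its drift is
then `δ ψ' - g`, and it is also `μ^ψ`. Since `M^ψ` is only a local martingale, comparing the two
drifts requires localization and the fact that a finite variation martingale is constant
(`drift_eq_of_toSpace_eq`). The result is linear in the return and can be solved for it; the
first-order conditions of the Agents `1, …, N - 1` then become the forward-backward system.
Conversely, if `M^ψ` is a martingale and the rate vanishes at `T < ∞`, then the noise traders' rate
is itself a value of `V*`, and the first-order condition of Agent `N` follows from the others by
summation. -/

theorem measurableSet_timeSet (T : ℝ≥0∞) : MeasurableSet (timeSet T) := by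
  have h : timeSet T = Set.Ici 0 ∩ ENNReal.ofReal ⁻¹' Set.Iic T := rfl
  rw [h]
  exact measurableSet_Ici.inter (ENNReal.measurable_ofReal measurableSet_Iic)

theorem measurableEmbedding_time (T : ℝ≥0∞) :
    MeasurableEmbedding (fun t : Time T => (t : ℝ)) :=
  .subtype_coe (measurableSet_timeSet T)

theorem map_timeMeasure (T : ℝ≥0∞) :
    (timeMeasure T).map (fun t : Time T => (t : ℝ)) = volume.restrict (timeSet T) :=
  map_comap_subtype_coe (measurableSet_timeSet T) volume

theorem lintegral_timeMeasure (f : ℝ → ℝ≥0∞) :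
    ∫⁻ t : Time T, f t ∂(timeMeasure T) = ∫⁻ x in timeSet T, f x := by
  rw [← map_timeMeasure, (measurableEmbedding_time T).lintegral_map]

theorem Time.coe_nonneg (t : Time T) : 0 ≤ (t : ℝ) := t.2.1

theorem Time.mem_of_le (t : Time T) {x : ℝ} (h0 : 0 ≤ x) (h : x ≤ t) : x ∈ timeSet T :=
  ⟨h0, (ENNReal.ofReal_le_ofReal h).trans t.2.2⟩

theorem Time.sub_mem {s t : Time T} (h : s ≤ t) : (t : ℝ) - s ∈ timeSet T :=
  t.mem_of_le (sub_nonneg.2 h) (sub_le_self _ s.coe_nonneg)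

theorem timeMeasure_Iic (t : Time T) : timeMeasure T (Set.Iic t) = ENNReal.ofReal t := by
  rw [timeMeasure, (measurableEmbedding_time T).comap_apply]
  have : (fun t : Time T => (t : ℝ)) '' Set.Iic t = Set.Icc 0 (t : ℝ) := by
    ext x
    constructor
    · rintro ⟨s, hs, rfl⟩
      exact ⟨s.coe_nonneg, hs⟩
    · rintro ⟨h0, h1⟩
      exact ⟨⟨x, t.mem_of_le h0 h1⟩, h1, rfl⟩
  rw [this, Real.volume_Icc, sub_zero]

theorem timeMeasure_Ioc (s t : Time T) :
    timeMeasure T (Set.Ioc s t) = ENNReal.ofReal ((t : ℝ) - s) := by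
  rw [timeMeasure, (measurableEmbedding_time T).comap_apply]
  have : (fun t : Time T => (t : ℝ)) '' Set.Ioc s t = Set.Ioc (s : ℝ) (t : ℝ) := by
    ext x
    constructor
    · rintro ⟨r, hr, rfl⟩
      exact ⟨hr.1, hr.2⟩
    · rintro ⟨h0, h1⟩
      exact ⟨⟨x, t.mem_of_le (s.coe_nonneg.trans h0.le) h1⟩, ⟨h0, h1⟩, rfl⟩
  rw [this, Real.volume_Ioc]

instance : NullSingletonClass (timeMeasure T) where
  measure_singleton t := by
    rw [timeMeasure, (measurableEmbedding_time T).comap_apply]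
    simp

/-- The point of the time set that is closest to `x`. -/
noncomputable def Time.trunc (T : ℝ≥0∞) (x : ℝ) : Time T :=
  ⟨if T = ∞ then max 0 x else max 0 (min x T.toReal), by
    split_ifs with h
    · exact ⟨le_max_left _ _, by simp [h]⟩
    · refine ⟨le_max_left _ _, ENNReal.ofReal_le_of_le_toReal ?_⟩
      exact max_le ENNReal.toReal_nonneg (min_le_right _ _)⟩

theorem Time.trunc_coe_of_mem {x : ℝ} (h : x ∈ timeSet T) : (Time.trunc T x : ℝ) = x := by
  unfold Time.trunc
  dsimp only
  split_ifs with hT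
  · exact max_eq_right h.1
  · rw [min_eq_left ((ENNReal.ofReal_le_iff_le_toReal hT).1 h.2), max_eq_right h.1]

@[simp]
theorem Time.trunc_coe (t : Time T) : Time.trunc T t = t :=
  Subtype.ext (Time.trunc_coe_of_mem t.2)

theorem Time.trunc_mono : Monotone (Time.trunc T) := by
  intro x y h
  rw [← Subtype.coe_le_coe]
  unfold Time.trunc
  dsimp only
  split_ifs
  · exact max_le_max le_rfl h
  · exact max_le_max le_rfl (min_le_min h le_rfl)

/-- The times that exhaust the time set. -/
noncomputable def Time.exhaust (T : ℝ≥0∞) (n : ℕ) : Time T := Time.trunc T n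

theorem Time.exists_le_exhaust (t : Time T) : ∃ n, t ≤ Time.exhaust T n := by
  obtain ⟨n, hn⟩ := exists_nat_ge (t : ℝ)
  refine ⟨n, ?_⟩
  have := Time.trunc_mono (T := T) hn
  rwa [Time.trunc_coe] at this

theorem Time.iUnion_Iic_exhaust : ⋃ n, Set.Iic (Time.exhaust T n) = Set.univ := by
  ext t
  simpa using t.exists_le_exhaust

instance : SigmaFinite (timeMeasure T) := by
  refine ⟨⟨⟨fun n => Set.Iic (Time.exhaust T n), fun _ => trivial, fun n => ?_,
    Time.iUnion_Iic_exhaust⟩⟩⟩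
  rw [timeMeasure_Iic]
  exact ENNReal.ofReal_lt_top

instance (t : Time T) : IsFiniteMeasure ((timeMeasure T).restrict (Set.Iic t)) :=
  ⟨by rw [Measure.restrict_apply_univ, timeMeasure_Iic]; exact ENNReal.ofReal_lt_top⟩

end TimeSet

/-! ### The Schur test and the exponential kernel. -/

section Kernel

variable {T : ℝ≥0∞}

/-- The Schur test for a nonnegative kernel all of whose marginals are bounded by `C`. -/
theorem lintegral_sq_lintegral_kernel_le {α β : Type*} [MeasurableSpace α] [MeasurableSpace β]
    {μ : Measure α} {ν : Measure β} [SFinite μ] [SFinite ν] {k : α → β → ℝ≥0∞}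
    (hk : Measurable (Function.uncurry k)) {C : ℝ≥0∞} (h₁ : ∀ b, ∫⁻ a, k a b ∂μ ≤ C)
    (h₂ : ∀ a, ∫⁻ b, k a b ∂ν ≤ C) {f : α → ℝ≥0∞} (hf : Measurable f) :
    ∫⁻ b, (∫⁻ a, k a b * f a ∂μ) ^ 2 ∂ν ≤ C ^ 2 * ∫⁻ a, f a ^ 2 ∂μ := by
  have key : ∀ b, (∫⁻ a, k a b * f a ∂μ) ^ 2 ≤ C * ∫⁻ a, k a b * f a ^ 2 ∂μ := by
    intro b
    have hkb : Measurable fun a => k a b := hk.comp measurable_prodMk_right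
    -- Cauchy-Schwarz for the splitting `k f = k^{1/2} · (k^{1/2} f)`. One marginal bound is spent
    -- here, the other one after Tonelli.
    have h := ENNReal.lintegral_mul_le_Lp_mul_Lq μ Real.HolderConjugate.two_two
      (f := fun a => (k a b) ^ (1 / 2 : ℝ)) (g := fun a => (k a b) ^ (1 / 2 : ℝ) * f a)
      (by fun_prop) (by fun_prop)
    have e1 : ∀ a, ((k a b) ^ (1 / 2 : ℝ)) ^ (2 : ℝ) = k a b := fun a => by
      rw [← ENNReal.rpow_mul]; norm_num
    have e2 : ∀ a, ((fun a => (k a b) ^ (1 / 2 : ℝ)) * fun a => (k a b) ^ (1 / 2 : ℝ) * f a) a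
        = k a b * f a := fun a => by
      simp only [Pi.mul_apply]
      rw [← mul_assoc, ← sq, ← ENNReal.rpow_two, e1]
    simp only [e2, ENNReal.mul_rpow_of_nonneg _ _ zero_le_two, e1] at h
    calc (∫⁻ a, k a b * f a ∂μ) ^ 2
        ≤ ((∫⁻ a, k a b ∂μ) ^ (1 / 2 : ℝ) * (∫⁻ a, k a b * f a ^ (2 : ℝ) ∂μ) ^ (1 / 2 : ℝ)) ^ 2 := by
          gcongr
      _ = (∫⁻ a, k a b ∂μ) * ∫⁻ a, k a b * f a ^ 2 ∂μ := by
          rw [mul_pow, ← ENNReal.rpow_two, ← ENNReal.rpow_two, ← ENNReal.rpow_mul,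
            ← ENNReal.rpow_mul]
          norm_num
      _ ≤ _ := by gcongr; exact h₁ b
  have hm : Measurable (Function.uncurry fun a b => k a b * f a ^ 2) :=
    hk.mul ((hf.comp measurable_fst).pow_const 2)
  calc ∫⁻ b, (∫⁻ a, k a b * f a ∂μ) ^ 2 ∂ν
      ≤ ∫⁻ b, C * ∫⁻ a, k a b * f a ^ 2 ∂μ ∂ν := lintegral_mono key
    _ = C * ∫⁻ b, ∫⁻ a, k a b * f a ^ 2 ∂μ ∂ν := by
        rw [lintegral_const_mul]
        exact hm.lintegral_prod_left'
    _ = C * ∫⁻ a, ∫⁻ b, k a b * f a ^ 2 ∂ν ∂μ := by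
        rw [lintegral_lintegral_swap hm.aemeasurable]
    _ = C * ∫⁻ a, (∫⁻ b, k a b ∂ν) * f a ^ 2 ∂μ := by
        congr 1
        refine lintegral_congr fun a => ?_
        exact lintegral_mul_const _ (hk.comp measurable_prodMk_left)
    _ ≤ C * ∫⁻ a, C * f a ^ 2 ∂μ := by gcongr with a; exact h₂ a
    _ = _ := by rw [lintegral_const_mul _ (hf.pow_const 2), sq, mul_assoc]

/-- The exponential weight on the time set. -/
noncomputable def expWeight (T : ℝ≥0∞) (δ : ℝ) (x : ℝ) : ℝ≥0∞ :=
  (timeSet T).indicator (fun x => ENNReal.ofReal (Real.exp (-δ / 2 * x))) x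

/-- The bound for the norm of the integration operator. -/
noncomputable def expBound (T : ℝ≥0∞) (δ : ℝ) : ℝ≥0∞ := ∫⁻ x, expWeight T δ x

theorem measurable_expWeight (δ : ℝ) : Measurable (expWeight T δ) :=
  (by fun_prop : Measurable fun x => ENNReal.ofReal (Real.exp (-δ / 2 * x))).indicator
    (measurableSet_timeSet T)

/-- For `T = ∞` the exponential is integrable because `δ > 0`; for `T < ∞` the weight is at most one
on a bounded set. -/
theorem expBound_lt_top {δ : ℝ} (hδ : 0 ≤ δ) (hT : T = ∞ → 0 < δ) : expBound T δ < ∞ := by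
  unfold expBound expWeight
  rw [lintegral_indicator (measurableSet_timeSet T)]
  by_cases h : T = ∞
  · have h2 : timeSet T = Set.Ici 0 := by ext x; simp [timeSet, h]
    have := (integrableOn_exp_mul_Ioi (a := -δ / 2) (by have := hT h; linarith) 0)
    rw [h2, setLIntegral_congr Ioi_ae_eq_Ici.symm]
    exact this.lintegral_lt_top
  · have h2 : timeSet T ⊆ Set.Icc 0 T.toReal := fun x hx =>
      ⟨hx.1, (ENNReal.ofReal_le_iff_le_toReal h).1 hx.2⟩
    calc ∫⁻ x in timeSet T, ENNReal.ofReal (Real.exp (-δ / 2 * x))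
        ≤ ∫⁻ x in timeSet T, 1 := by
          refine setLIntegral_mono measurable_const fun x hx => ?_
          rw [ENNReal.ofReal_le_one, Real.exp_le_one_iff]
          have := hx.1
          nlinarith
      _ ≤ volume (Set.Icc 0 T.toReal) := by
          rw [setLIntegral_one]; exact measure_mono h2
      _ < ∞ := by rw [Real.volume_Icc]; exact ENNReal.ofReal_lt_top

/-- Passing to the whole line only enlarges the integral, and translation invariance removes `t`.
The indicator in `expWeight` already encodes `s ≤ t`. -/
theorem lintegral_expWeight_sub_le (δ : ℝ) (t : ℝ) :
    ∫⁻ s : Time T, expWeight T δ (t - s) ∂(timeMeasure T) ≤ expBound T δ := by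
  rw [lintegral_timeMeasure (fun s => expWeight T δ (t - s))]
  calc _ ≤ ∫⁻ s, expWeight T δ (t - s) := setLIntegral_le_lintegral _ _
    _ = _ := lintegral_sub_left_eq_self _ _

theorem lintegral_expWeight_sub_le' (δ : ℝ) (s : ℝ) :
    ∫⁻ t : Time T, expWeight T δ (t - s) ∂(timeMeasure T) ≤ expBound T δ := by
  rw [lintegral_timeMeasure (fun t => expWeight T δ (t - s))]
  calc _ ≤ ∫⁻ t, expWeight T δ (t - s) := setLIntegral_le_lintegral _ _
    _ = _ := lintegral_sub_right_eq_self _ _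

theorem expWeight_sub {δ : ℝ} {s t : Time T} (h : s ≤ t) :
    expWeight T δ ((t : ℝ) - s) = ENNReal.ofReal (Real.exp (-δ / 2 * (t - s))) :=
  Set.indicator_of_mem (Time.sub_mem h) _

end Kernel

/-- Conditions on the horizon and the discount rate under which integration in time is bounded. -/
class Discount (T : ℝ≥0∞) (δ : ℝ) : Prop where
  horizon_pos : 0 < T
  nonneg : 0 ≤ δ
  pos : T = ∞ → 0 < δ

/-! ### Progressive measurability through a single σ-algebra. -/

section Progressive

variable {Ω : Type*} {mΩ : MeasurableSpace Ω} {P : Measure Ω} {T : ℝ≥0∞}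
  {F : Filtration (Time T) mΩ}

/-- The σ-algebra on `Ω` is arbitrary, so that the lemma applies with `F i` as well as with the full
σ-algebra; `R` selects the past or the future of a time. -/
theorem stronglyMeasurable_integral_section {S Ω V : Type*} [MeasurableSpace S] [MeasurableSpace Ω]
    [NormedAddCommGroup V] [NormedSpace ℝ V] (ν : Measure S) [SFinite ν] {X : S → Ω → V}
    (hX : StronglyMeasurable fun p : S × Ω => X p.1 p.2) {R : Set (S × S)} (hR : MeasurableSet R) :
    StronglyMeasurable fun p : S × Ω =>
      ∫ s, {s | (s, p.1) ∈ R}.indicator (fun s => X s p.2) s ∂ν := by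
  have h1 : StronglyMeasurable fun q : (S × Ω) × S => X q.2 q.1.2 :=
    hX.comp_measurable (g := fun q : (S × Ω) × S => (q.2, q.1.2)) (by fun_prop)
  have h2 : MeasurableSet {q : (S × Ω) × S | (q.2, q.1.1) ∈ R} :=
    (by fun_prop : Measurable fun q : (S × Ω) × S => (q.2, q.1.1)) hR
  exact (h1.indicator h2).integral_prod_right'

/-- Up to time `i` the position depends on the rate on `[0, i]` only, so it is a parametrized
integral over `Set.Iic i` of a function that is jointly measurable for `F i`. -/
theorem isStronglyProgressive_position {V : Type*} [NormedAddCommGroup V]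
    [NormedSpace ℝ V] {u : Time T → Ω → V} (hu : IsStronglyProgressive F u) :
    IsStronglyProgressive F (position u) := by
  intro i
  have hR : MeasurableSet {q : Set.Iic i × Set.Iic i | q.1 ≤ q.2} :=
    measurableSet_le measurable_fst measurable_snd
  have hsf : SFinite ((timeMeasure T).comap (Subtype.val : Set.Iic i → Time T)) := by
    have : IsFiniteMeasure ((timeMeasure T).comap (Subtype.val : Set.Iic i → Time T)) := by
      refine ⟨?_⟩
      rw [(MeasurableEmbedding.subtype_coe measurableSet_Iic).comap_apply]
      rw [Set.image_univ, Subtype.range_coe, timeMeasure_Iic]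
      exact ENNReal.ofReal_lt_top
    infer_instance
  have h := @stronglyMeasurable_integral_section (Set.Iic i) Ω V _ (F i) _ _
    ((timeMeasure T).comap Subtype.val) hsf (fun s ω => u s ω) (hu i) _ hR
  have e : (fun p : Set.Iic i × Ω => position u p.1 p.2) = fun p => ∫ s : Set.Iic i,
      {s | (s, p.1) ∈ {q : Set.Iic i × Set.Iic i | q.1 ≤ q.2}}.indicator
        (fun s : Set.Iic i => u s p.2) s ∂((timeMeasure T).comap Subtype.val) := by
    funext p
    have e : ∀ s : Set.Iic i, {s | (s, p.1) ∈ {q : Set.Iic i × Set.Iic i | q.1 ≤ q.2}}.indicator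
        (fun s : Set.Iic i => u s p.2) s
        = (Set.Iic (p.1 : Time T)).indicator (fun s => u s p.2) (s : Time T) := by
      intro s
      by_cases hs : s ≤ p.1
      · rw [Set.indicator_of_mem (by exact hs), Set.indicator_of_mem (by exact hs)]
      · rw [Set.indicator_of_notMem (by exact hs), Set.indicator_of_notMem (by exact hs)]
    simp_rw [e]
    rw [integral_subtype_comap measurableSet_Iic
      (fun s => (Set.Iic (p.1 : Time T)).indicator (fun s => u s p.2) s),
      setIntegral_indicator measurableSet_Iic,
      Set.inter_eq_right.2 (Set.Iic_subset_Iic.2 p.1.2), position]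
  rw [e]
  exact h

/-- The progressive σ-algebra. -/
@[reducible]
def progSigma (F : Filtration (Time T) mΩ) : MeasurableSpace (Time T × Ω) :=
  ⨅ i, (@Prod.instMeasurableSpace (Set.Iic i) Ω _ (F i)).map
    (fun p : Set.Iic i × Ω => ((p.1 : Time T), p.2))

theorem measurable_progSigma_iff {β : Type*} [MeasurableSpace β] {X : Time T → Ω → β} :
    Measurable[progSigma F] (Function.uncurry X) ↔ IsProgressive F X := by
  constructor
  · intro h i s hs
    exact (MeasurableSpace.measurableSet_iInf.1 (h hs)) i
  · intro h s hs
    exact MeasurableSpace.measurableSet_iInf.2 fun i => h i hs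

/-- A progressive set is the countable union of its traces on `[0, n] × Ω`, and each of them is
jointly measurable. -/
theorem progSigma_le (F : Filtration (Time T) mΩ) :
    progSigma F ≤ (inferInstance : MeasurableSpace (Time T × Ω)) := by
  intro S hS
  have h1 : ∀ i, @MeasurableSet _ (@Prod.instMeasurableSpace (Set.Iic i) Ω _ (F i))
      ((fun p : Set.Iic i × Ω => ((p.1 : Time T), p.2)) ⁻¹' S) :=
    fun i => MeasurableSpace.measurableSet_iInf.1 hS i
  have h2 : ∀ i, MeasurableSet ((fun p : Set.Iic i × Ω => ((p.1 : Time T), p.2)) ⁻¹' S) :=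
    fun i => (sup_le_sup le_rfl (MeasurableSpace.comap_mono (F.le i)) :
      @Prod.instMeasurableSpace (Set.Iic i) Ω _ (F i) ≤ _) _ (h1 i)
  have h3 : ∀ i : Time T, MeasurableEmbedding (fun p : Set.Iic i × Ω => ((p.1 : Time T), p.2)) := fun i => by
    have h : MeasurableEmbedding (Prod.map (Subtype.val : Set.Iic i → Time T) (id : Ω → Ω)) :=
      (MeasurableEmbedding.subtype_coe measurableSet_Iic).prodMap .id
    exact h
  have h4 : S = ⋃ n, (fun p : Set.Iic (Time.exhaust T n) × Ω => ((p.1 : Time T), p.2)) ''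
      ((fun p : Set.Iic (Time.exhaust T n) × Ω => ((p.1 : Time T), p.2)) ⁻¹' S) := by
    ext ⟨t, ω⟩
    simp only [Set.mem_iUnion, Set.mem_image, Set.mem_preimage, Prod.mk.injEq]
    constructor
    · intro h
      obtain ⟨n, hn⟩ := t.exists_le_exhaust
      exact ⟨n, (⟨t, hn⟩, ω), h, rfl, rfl⟩
    · rintro ⟨n, p, hp, rfl, rfl⟩
      exact hp
  rw [h4]
  exact MeasurableSet.iUnion fun n => (h3 _).measurableSet_image.2 (h2 _)

variable {X Y : Time T → Ω → ℝ}

theorem MeasureTheory.IsStronglyProgressive.measurable_progSigma (hX : IsStronglyProgressive F X) :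
    Measurable[progSigma F] (Function.uncurry X) :=
  measurable_progSigma_iff.2 hX.isProgressive

theorem MeasureTheory.IsStronglyProgressive.measurable_uncurry (hX : IsStronglyProgressive F X) :
    Measurable (Function.uncurry X) :=
  hX.measurable_progSigma.mono (progSigma_le F) le_rfl

theorem isStronglyProgressive_time (F : Filtration (Time T) mΩ) {f : ℝ → ℝ} (hf : Measurable f) :
    IsStronglyProgressive F (fun (t : Time T) (_ : Ω) => f t) := by
  intro i
  let := F i
  have : Measurable fun p : Set.Iic i × Ω => f p.1 := by fun_prop
  exact this.stronglyMeasurable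

theorem MeasureTheory.IsStronglyProgressive.const_mul (hX : IsStronglyProgressive F X) (a : ℝ) :
    IsStronglyProgressive F (fun t ω => a * X t ω) :=
  (isStronglyProgressive_const F a).mul hX

theorem isStronglyProgressive_pi_iff {ι : Type*} [Fintype ι] {X : Time T → Ω → ι → ℝ} :
    IsStronglyProgressive F X ↔ ∀ i, IsStronglyProgressive F (fun t ω => X t ω i) := by
  constructor
  · intro h i t
    exact (continuous_apply i).comp_stronglyMeasurable (h t)
  · intro h t
    have := fun i => (h i t).measurable
    exact (@measurable_pi_lambda _ _ _ (@Prod.instMeasurableSpace (Set.Iic t) Ω _ (F t)) _ _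
      this).stronglyMeasurable

/-- The process `e^{-δ t / 2} X_t` as a function on the product space. -/
noncomputable def discounted (δ : ℝ) (X : Time T → Ω → ℝ) (z : Time T × Ω) : ℝ :=
  Real.exp (-δ / 2 * z.1) * X z.1 z.2

theorem MeasureTheory.IsStronglyProgressive.measurable_discounted (hX : IsStronglyProgressive F X)
    (δ : ℝ) : Measurable[progSigma F] (discounted δ X) :=
  ((isStronglyProgressive_time F (f := fun x => Real.exp (-δ / 2 * x)) (by fun_prop)).mul
    hX).measurable_progSigma

theorem enorm_discounted_sq (δ : ℝ) (X : Time T → Ω → ℝ) (z : Time T × Ω) :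
    ‖discounted δ X z‖ₑ ^ 2 = ENNReal.ofReal (Real.exp (-δ * z.1) * ‖X z.1 z.2‖ ^ 2) := by
  rw [← ofReal_norm, ← ENNReal.ofReal_pow (norm_nonneg _), discounted, norm_mul, mul_pow,
    Real.norm_eq_abs, abs_of_pos (Real.exp_pos _), ← Real.exp_nat_mul]
  have : ((2 : ℕ) : ℝ) * (-δ / 2 * z.1) = -δ * z.1 := by push_cast; ring
  rw [this]

/-- Moving the square root of the discount factor into the process makes `L²_δ` an unweighted `L²`
space over the product measure, to which the general theory of `Lp` spaces applies. -/
theorem memL2_iff [SFinite P] {δ : ℝ} :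
    MemL2 P F δ X ↔
      IsStronglyProgressive F X ∧ MemLp (discounted δ X) 2 ((timeMeasure T).prod P) := by
  unfold MemL2
  refine and_congr_right fun hX => ?_
  have hm : Measurable (discounted δ X) :=
    (hX.measurable_discounted δ).mono (progSigma_le F) le_rfl
  have e : ∫⁻ ω, ∫⁻ t, ENNReal.ofReal (Real.exp (-δ * t) * ‖X t ω‖ ^ 2) ∂(timeMeasure T) ∂P
      = ∫⁻ z, ‖discounted δ X z‖ₑ ^ 2 ∂((timeMeasure T).prod P) := by
    rw [lintegral_prod_symm _ (hm.enorm.pow_const 2).aemeasurable]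
    simp_rw [enorm_discounted_sq]
  rw [e]
  unfold MemLp
  rw [eLpNorm_lt_top_iff_lintegral_rpow_enorm_lt_top two_ne_zero ENNReal.ofNat_ne_top]
  simp [hm.aestronglyMeasurable]

end Progressive

/-! ### Closure properties of `L²_δ` and the bound for integration in time. -/

section MemL2

theorem MemL2.measurable {Ω : Type*} {mΩ : MeasurableSpace Ω} {P : Measure Ω} {T : ℝ≥0∞}
    {F : Filtration (Time T) mΩ} {δ : ℝ} {X : Time T → Ω → ℝ} (hX : MemL2 P F δ X) :
    Measurable (Function.uncurry X) :=
  hX.1.measurable_uncurry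

variable {Ω : Type*} {mΩ : MeasurableSpace Ω} {P : Measure Ω} [IsProbabilityMeasure P] {T : ℝ≥0∞}
  {F : Filtration (Time T) mΩ} {δ : ℝ} {X Y : Time T → Ω → ℝ}

theorem MemL2.memLp (hX : MemL2 P F δ X) :
    MemLp (discounted δ X) 2 ((timeMeasure T).prod P) := (memL2_iff.1 hX).2


theorem MemL2.congr (hX : MemL2 P F δ X) (hY : IsStronglyProgressive F Y)
    (h : ∀ᵐ z ∂((timeMeasure T).prod P), X z.1 z.2 = Y z.1 z.2) : MemL2 P F δ Y :=
  memL2_iff.2 ⟨hY, hX.memLp.ae_eq (h.mono fun z hz => by simp only [discounted, hz])⟩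

theorem MemL2.add (hX : MemL2 P F δ X) (hY : MemL2 P F δ Y) :
    MemL2 P F δ (fun t ω => X t ω + Y t ω) := by
  refine memL2_iff.2 ⟨hX.1.add hY.1, (hX.memLp.add hY.memLp).ae_eq (ae_of_all _ fun z => ?_)⟩
  simp only [discounted, Pi.add_apply, mul_add]

theorem MemL2.const_mul (hX : MemL2 P F δ X) (a : ℝ) : MemL2 P F δ (fun t ω => a * X t ω) := by
  refine memL2_iff.2 ⟨hX.1.const_mul a, (hX.memLp.const_mul a).ae_eq (ae_of_all _ fun z => ?_)⟩
  simp only [discounted]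
  ring

theorem MemL2.neg (hX : MemL2 P F δ X) : MemL2 P F δ (fun t ω => - X t ω) := by
  simpa using hX.const_mul (-1)

theorem MemL2.sub (hX : MemL2 P F δ X) (hY : MemL2 P F δ Y) :
    MemL2 P F δ (fun t ω => X t ω - Y t ω) := by
  simpa [sub_eq_add_neg] using hX.add hY.neg

theorem memL2_zero : MemL2 P F δ (fun _ _ => (0 : ℝ)) := by
  refine memL2_iff.2 ⟨isStronglyProgressive_const F 0, ?_⟩
  have : discounted (T := T) (Ω := Ω) δ (fun _ _ => (0 : ℝ)) = fun _ => 0 := by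
    funext z; simp [discounted]
  rw [this]
  exact MemLp.zero'

theorem MemL2.sum {ι : Type*} (s : Finset ι) {X : ι → Time T → Ω → ℝ}
    (hX : ∀ i ∈ s, MemL2 P F δ (X i)) : MemL2 P F δ (fun t ω => ∑ i ∈ s, X i t ω) := by
  classical
  induction s using Finset.induction_on with
  | empty => simpa using memL2_zero
  | insert a s ha ih =>
    simp only [Finset.sum_insert ha]
    exact (hX a (by simp)).add (ih fun i hi => hX i (by simp [hi]))

/-- Reduces vector-valued processes to their coordinates, so that the analysis is needed only for
real-valued ones. The square of the sup norm is dominated by the sum of the squares of the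
coordinates. -/
theorem memL2_pi_iff {ι : Type*} [Fintype ι] {X : Time T → Ω → ι → ℝ} :
    MemL2 P F δ X ↔ ∀ i, MemL2 P F δ (fun t ω => X t ω i) := by
  constructor
  · intro h i
    refine ⟨isStronglyProgressive_pi_iff.1 h.1 i, lt_of_le_of_lt ?_ h.2⟩
    gcongr
    exact norm_le_pi_norm _ i
  · intro h
    refine ⟨isStronglyProgressive_pi_iff.2 fun i => (h i).1, ?_⟩
    have hm : ∀ i, Measurable fun z : Time T × Ω =>
        ENNReal.ofReal (Real.exp (-δ * z.1) * ‖X z.1 z.2 i‖ ^ 2) := fun i => by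
      have := (h i).measurable
      simp only [Function.uncurry_def] at this
      fun_prop
    calc ∫⁻ ω, ∫⁻ t, ENNReal.ofReal (Real.exp (-δ * t) * ‖X t ω‖ ^ 2) ∂(timeMeasure T) ∂P
        ≤ ∫⁻ ω, ∫⁻ t, ∑ i, ENNReal.ofReal (Real.exp (-δ * t) * ‖X t ω i‖ ^ 2)
            ∂(timeMeasure T) ∂P := by
          gcongr with ω t
          rw [← ENNReal.ofReal_sum_of_nonneg fun i _ => by positivity, ← Finset.mul_sum]
          gcongr
          have h0 : 0 ≤ ∑ i, ‖X t ω i‖ ^ 2 := Finset.sum_nonneg fun i _ => by positivity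
          have : ‖X t ω‖ ≤ √(∑ i, ‖X t ω i‖ ^ 2) := by
            refine (pi_norm_le_iff_of_nonneg (Real.sqrt_nonneg _)).2 fun i => ?_
            refine Real.le_sqrt_of_sq_le ?_
            exact Finset.single_le_sum (f := fun i => ‖X t ω i‖ ^ 2) (fun i _ => by positivity)
              (Finset.mem_univ i)
          calc ‖X t ω‖ ^ 2 ≤ (√(∑ i, ‖X t ω i‖ ^ 2)) ^ 2 := by gcongr
            _ = _ := Real.sq_sqrt h0
      _ = ∑ i, ∫⁻ ω, ∫⁻ t, ENNReal.ofReal (Real.exp (-δ * t) * ‖X t ω i‖ ^ 2)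
            ∂(timeMeasure T) ∂P := by
          rw [← lintegral_finsetSum]
          · refine lintegral_congr fun ω => ?_
            exact lintegral_finsetSum _ fun i _ => (hm i).comp measurable_prodMk_right
          · intro i _
            exact Measurable.lintegral_prod_left' (hm i)
      _ < ∞ := ENNReal.sum_lt_top.2 fun i _ => (h i).2

/-- The pathwise form of the bound for the integration operator. -/
theorem enorm_discounted_position_le (X : Time T → Ω → ℝ) (t : Time T) (ω : Ω) :
    ‖discounted δ (position X) (t, ω)‖ₑ ≤
      ∫⁻ s : Time T, expWeight T δ (t - s) * ‖discounted δ X (s, ω)‖ₑ ∂(timeMeasure T) := by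
  have h1 : ‖position X t ω‖ₑ ≤ ∫⁻ s in Set.Iic t, ‖X s ω‖ₑ ∂(timeMeasure T) :=
    enorm_integral_le_lintegral_enorm _
  calc ‖discounted δ (position X) (t, ω)‖ₑ
      = ENNReal.ofReal (Real.exp (-δ / 2 * t)) * ‖position X t ω‖ₑ := by
        rw [discounted, enorm_mul, Real.enorm_of_nonneg (Real.exp_pos _).le]
    _ ≤ ENNReal.ofReal (Real.exp (-δ / 2 * t)) * ∫⁻ s in Set.Iic t, ‖X s ω‖ₑ ∂(timeMeasure T) := by
        gcongr
    -- The factor `e^{-δ t / 2}` splits as `e^{-δ (t - s) / 2} e^{-δ s / 2}`: one part is the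
    -- kernel, the other discounts the integrand.
    _ = ∫⁻ s in Set.Iic t, expWeight T δ (t - s) * ‖discounted δ X (s, ω)‖ₑ ∂(timeMeasure T) := by
        rw [← lintegral_const_mul' _ _ ENNReal.ofReal_ne_top]
        refine setLIntegral_congr_fun measurableSet_Iic fun s hs => ?_
        simp only [discounted]
        rw [expWeight_sub (by exact hs), enorm_mul, Real.enorm_of_nonneg (Real.exp_pos _).le,
          ← mul_assoc, ← ENNReal.ofReal_mul (Real.exp_pos _).le, ← Real.exp_add]
        ring_nf
    _ ≤ _ := setLIntegral_le_lintegral _ _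

theorem measurable_expWeight_sub (T : ℝ≥0∞) (δ : ℝ) :
    Measurable (Function.uncurry fun s t : Time T => expWeight T δ (t - s)) :=
  (measurable_expWeight δ).comp (by fun_prop)

variable [hδ : Discount T δ]

/-- Restriction of the product measure to a bounded time interval. -/
theorem MemL2.memLp_restrict (hX : MemL2 P F δ X) (b : Time T) :
    MemLp (Function.uncurry X) 2 (((timeMeasure T).restrict (Set.Iic b)).prod P) := by
  have h1 : MemLp (discounted δ X) 2 (((timeMeasure T).restrict (Set.Iic b)).prod P) :=
    hX.memLp.mono_measure (Measure.prod_mono Measure.restrict_le_self le_rfl)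
  -- On `[0, b]` the discounting can be undone at the price of the constant `e^{δ b / 2}`.
  refine (h1.const_mul (Real.exp (δ / 2 * b))).mono hX.measurable.aestronglyMeasurable ?_
  have hS : ∀ᵐ z ∂(((timeMeasure T).restrict (Set.Iic b)).prod P), z.1 ≤ b := by
    rw [Measure.ae_prod_iff_ae_ae (measurableSet_le measurable_fst measurable_const)]
    filter_upwards [ae_restrict_mem measurableSet_Iic] with t ht
    exact ae_of_all _ fun _ => ht
  filter_upwards [hS] with z hz
  rw [discounted, ← mul_assoc, ← Real.exp_add, norm_mul, Real.norm_eq_abs (Real.exp _), Real.abs_exp]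
  refine le_mul_of_one_le_left (norm_nonneg _) ?_
  rw [Real.one_le_exp_iff]
  have h2 : ((z.1 : Time T) : ℝ) ≤ b := hz
  have := hδ.nonneg
  nlinarith

theorem MemL2.integrable_restrict (hX : MemL2 P F δ X) (b : Time T) :
    Integrable (Function.uncurry X) (((timeMeasure T).restrict (Set.Iic b)).prod P) :=
  (hX.memLp_restrict b).integrable one_le_two

theorem MemL2.ae_integrableOn (hX : MemL2 P F δ X) :
    ∀ᵐ ω ∂P, ∀ t, IntegrableOn (fun s => X s ω) (Set.Iic t) (timeMeasure T) := by
  have : ∀ᵐ ω ∂P, ∀ n, IntegrableOn (fun s => X s ω) (Set.Iic (Time.exhaust T n))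
      (timeMeasure T) :=
    ae_all_iff.2 fun n => (hX.integrable_restrict _).prod_left_ae
  filter_upwards [this] with ω hω t
  obtain ⟨n, hn⟩ := t.exists_le_exhaust
  exact (hω n).mono_set (Set.Iic_subset_Iic.2 hn)

theorem lintegral_discounted_position_le (hX : MemL2 P F δ X) :
    ∫⁻ z, ‖discounted δ (position X) z‖ₑ ^ 2 ∂((timeMeasure T).prod P) ≤
      expBound T δ ^ 2 * ∫⁻ z, ‖discounted δ X z‖ₑ ^ 2 ∂((timeMeasure T).prod P) := by
  have hm : Measurable (discounted δ X) :=
    (hX.1.measurable_discounted δ).mono (progSigma_le F) le_rfl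
  have hm' : Measurable (discounted δ (position X)) :=
    ((isStronglyProgressive_position hX.1).measurable_discounted δ).mono (progSigma_le F) le_rfl
  rw [lintegral_prod_symm _ (hm.enorm.pow_const 2).aemeasurable,
    lintegral_prod_symm _ (hm'.enorm.pow_const 2).aemeasurable,
    ← lintegral_const_mul _ (hm.enorm.pow_const 2).lintegral_prod_left']
  refine lintegral_mono fun ω => ?_
  calc ∫⁻ t, ‖discounted δ (position X) (t, ω)‖ₑ ^ 2 ∂(timeMeasure T)
      ≤ ∫⁻ t : Time T, (∫⁻ s : Time T, expWeight T δ (t - s) * ‖discounted δ X (s, ω)‖ₑ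
          ∂(timeMeasure T)) ^ 2 ∂(timeMeasure T) := by
        gcongr with t; exact enorm_discounted_position_le X t ω
    _ ≤ _ := lintegral_sq_lintegral_kernel_le (measurable_expWeight_sub T δ)
        (fun t => lintegral_expWeight_sub_le δ t) (fun s => lintegral_expWeight_sub_le' δ s)
        (f := fun s => ‖discounted δ X (s, ω)‖ₑ) (hm.comp measurable_prodMk_right).enorm

theorem memLp_two_of_lintegral {α : Type*} [MeasurableSpace α] {μ : Measure α} {f : α → ℝ}
    (hf : AEStronglyMeasurable f μ) (h : ∫⁻ z, ‖f z‖ₑ ^ 2 ∂μ < ∞) : MemLp f 2 μ := by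
  refine ⟨hf, ?_⟩
  rw [eLpNorm_lt_top_iff_lintegral_rpow_enorm_lt_top two_ne_zero ENNReal.ofNat_ne_top]
  simpa using h

theorem MeasureTheory.MemLp.lintegral_sq_lt_top {α : Type*} [MeasurableSpace α] {μ : Measure α}
    {f : α → ℝ} (h : MemLp f 2 μ) : ∫⁻ z, ‖f z‖ₑ ^ 2 ∂μ < ∞ := by
  have := h.2
  rw [eLpNorm_lt_top_iff_lintegral_rpow_enorm_lt_top two_ne_zero ENNReal.ofNat_ne_top] at this
  simpa using this

theorem MemL2.integral (hX : MemL2 P F δ X) : MemL2 P F δ (position X) := by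
  have hp := isStronglyProgressive_position hX.1
  refine memL2_iff.2 ⟨hp, memLp_two_of_lintegral
    ((hp.measurable_discounted δ).mono (progSigma_le F) le_rfl).aestronglyMeasurable ?_⟩
  refine (lintegral_discounted_position_le hX).trans_lt ?_
  exact ENNReal.mul_lt_top (ENNReal.pow_lt_top (expBound_lt_top hδ.nonneg hδ.pos))
    hX.memLp.lintegral_sq_lt_top

theorem ae_ae_of_ae_time_prod {p : Time T → Ω → Prop}
    (h : ∀ᵐ z ∂((timeMeasure T).prod P), p z.1 z.2) :
    ∀ᵐ ω ∂P, ∀ᵐ t ∂(timeMeasure T), p t ω := by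
  have := Measure.measurePreserving_swap (μ := P) (ν := timeMeasure T)
  exact Measure.ae_ae_of_ae_prod (this.quasiMeasurePreserving.ae h)


theorem position_congr {V : Type*} [NormedAddCommGroup V] [NormedSpace ℝ V] {X Y : Time T → Ω → V}
    (h : ∀ᵐ z ∂((timeMeasure T).prod P), X z.1 z.2 = Y z.1 z.2) :
    ∀ᵐ ω ∂P, ∀ t, position X t ω = position Y t ω := by
  filter_upwards [ae_ae_of_ae_time_prod (p := fun t ω => X t ω = Y t ω) h] with ω hω t
  exact integral_congr_ae (ae_restrict_of_ae hω)

theorem MemL2.position_add (hX : MemL2 P F δ X) (hY : MemL2 P F δ Y) :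
    ∀ᵐ ω ∂P, ∀ t, position (fun t ω => X t ω + Y t ω) t ω =
      position X t ω + position Y t ω := by
  filter_upwards [hX.ae_integrableOn, hY.ae_integrableOn] with ω h1 h2 t
  exact integral_add (h1 t) (h2 t)

theorem position_const_mul (a : ℝ) (X : Time T → Ω → ℝ) (t : Time T) (ω : Ω) :
    position (fun t ω => a * X t ω) t ω = a * position X t ω :=
  integral_const_mul _ _

/-- The vector-valued integral takes the default value zero as soon as one coordinate is not
integrable, so it can be evaluated coordinatewise only on the almost sure event that all coordinates
are integrable on every `[0, t]`. -/
theorem ae_position_apply {ι : Type*} [Fintype ι] {X : Time T → Ω → ι → ℝ}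
    (hX : MemL2 P F δ X) :
    ∀ᵐ ω ∂P, ∀ t i, position X t ω i = position (fun t ω => X t ω i) t ω := by
  have := ae_all_iff.2 fun i => (memL2_pi_iff.1 hX i).ae_integrableOn
  filter_upwards [this] with ω hω t i
  exact eval_integral (fun i => hω i t) i

end MemL2

/-! ### The Hilbert space of processes and the integration operator. -/

section ProcessSpace

variable {Ω : Type*} {mΩ : MeasurableSpace Ω} {P : Measure Ω} [IsProbabilityMeasure P] {T : ℝ≥0∞}
  {F : Filtration (Time T) mΩ} {δ : ℝ} {X Y : Time T → Ω → ℝ}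

/-- The Hilbert space of classes of square-integrable progressive real-valued processes. -/
abbrev ProcessSpace (P : Measure Ω) (F : Filtration (Time T) mΩ) : Type _ :=
  lpMeas ℝ ℝ (progSigma F) 2 ((timeMeasure T).prod P)

instance (F : Filtration (Time T) mΩ) :
    Fact (progSigma F ≤ (inferInstance : MeasurableSpace (Time T × Ω))) := ⟨progSigma_le F⟩

/-- The class of a process, after discounting. -/
noncomputable def MemL2.toSpace (hX : MemL2 P F δ X) : ProcessSpace P F :=
  ⟨hX.memLp.toLp, mem_lpMeas_iff_aestronglyMeasurable.2
    ⟨discounted δ X, (hX.1.measurable_discounted δ).stronglyMeasurable, hX.memLp.coeFn_toLp⟩⟩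

theorem MemL2.toSpace_ae (hX : MemL2 P F δ X) :
    ((hX.toSpace : Lp ℝ 2 ((timeMeasure T).prod P)) : Time T × Ω → ℝ)
      =ᵐ[(timeMeasure T).prod P] discounted δ X :=
  hX.memLp.coeFn_toLp

theorem discounted_eq_iff {z : Time T × Ω} :
    discounted δ X z = discounted δ Y z ↔ X z.1 z.2 = Y z.1 z.2 :=
  mul_right_inj' (Real.exp_pos _).ne'

theorem MemL2.toSpace_eq_iff (hX : MemL2 P F δ X) (hY : MemL2 P F δ Y) :
    hX.toSpace = hY.toSpace ↔ ∀ᵐ z ∂((timeMeasure T).prod P), X z.1 z.2 = Y z.1 z.2 := by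
  rw [Subtype.ext_iff]
  simp only [MemL2.toSpace]
  rw [MemLp.toLp_eq_toLp_iff]
  exact eventually_congr (ae_of_all _ fun z => discounted_eq_iff)

/-- A class in the space has a representative that is measurable for the progressive σ-algebra;
undoing the discounting of this representative gives the process. Hence optimization over processes
and over the Hilbert space agree. -/
theorem exists_toSpace_eq (δ : ℝ) (f : ProcessSpace P F) :
    ∃ (X : Time T → Ω → ℝ) (hX : MemL2 P F δ X), hX.toSpace = f := by
  obtain ⟨g, hg, hfg⟩ := mem_lpMeas_iff_aestronglyMeasurable.1 f.2
  have hgp : IsStronglyProgressive F (fun t ω => g (t, ω)) :=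
    (measurable_progSigma_iff.1 (by exact hg.measurable)).isStronglyProgressive
  have hp : IsStronglyProgressive F (fun (t : Time T) ω => Real.exp (δ / 2 * t) * g (t, ω)) :=
    (isStronglyProgressive_time F (f := fun x => Real.exp (δ / 2 * x)) (by fun_prop)).mul hgp
  have hd : discounted δ (fun (t : Time T) ω => Real.exp (δ / 2 * t) * g (t, ω)) = g := by
    funext z
    rw [discounted, ← mul_assoc, ← Real.exp_add]
    ring_nf
    simp
  have hX : MemL2 P F δ (fun (t : Time T) ω => Real.exp (δ / 2 * t) * g (t, ω)) := by
    refine memL2_iff.2 ⟨hp, ?_⟩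
    rw [hd]
    exact (Lp.memLp (f : Lp ℝ 2 ((timeMeasure T).prod P))).ae_eq hfg
  refine ⟨_, hX, Subtype.ext (Lp.ext ?_)⟩
  refine hX.toSpace_ae.trans ?_
  rw [hd]
  exact hfg.symm

theorem discounted_mul_discounted (z : Time T × Ω) :
    discounted δ X z * discounted δ Y z = Real.exp (-δ * z.1) * (X z.1 z.2 * Y z.1 z.2) := by
  have : Real.exp (-δ * z.1) = Real.exp (-δ / 2 * z.1) * Real.exp (-δ / 2 * z.1) := by
    rw [← Real.exp_add]; ring_nf
  rw [this, discounted, discounted]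
  ring

theorem MemL2.integrable_mul (hX : MemL2 P F δ X) (hY : MemL2 P F δ Y) :
    Integrable (fun z : Time T × Ω => Real.exp (-δ * z.1) * (X z.1 z.2 * Y z.1 z.2))
      ((timeMeasure T).prod P) := by
  have := hX.memLp.integrable_mul hY.memLp
  refine this.congr (ae_of_all _ fun z => ?_)
  exact discounted_mul_discounted z

theorem MemL2.inner_toSpace (hX : MemL2 P F δ X) (hY : MemL2 P F δ Y) :
    inner ℝ hX.toSpace hY.toSpace =
      ∫ z : Time T × Ω, Real.exp (-δ * z.1) * (X z.1 z.2 * Y z.1 z.2)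
        ∂((timeMeasure T).prod P) := by
  rw [Submodule.coe_inner, L2.inner_def]
  refine integral_congr_ae ?_
  filter_upwards [hX.toSpace_ae, hY.toSpace_ae] with z h1 h2
  rw [h1, h2, ← discounted_mul_discounted]
  simp [mul_comm]

theorem MemL2.inner_toSpace' (hX : MemL2 P F δ X) (hY : MemL2 P F δ Y) :
    inner ℝ hX.toSpace hY.toSpace =
      ∫ ω, ∫ t, Real.exp (-δ * t) * (X t ω * Y t ω) ∂(timeMeasure T) ∂P := by
  rw [hX.inner_toSpace hY, integral_prod_symm _ (hX.integrable_mul hY)]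

theorem MemL2.norm_toSpace (hX : MemL2 P F δ X) :
    ‖hX.toSpace‖ = (eLpNorm (discounted δ X) 2 ((timeMeasure T).prod P)).toReal := by
  rw [Submodule.coe_norm]
  exact Lp.norm_toLp _ hX.memLp

theorem MemL2.toSpace_add (hX : MemL2 P F δ X) (hY : MemL2 P F δ Y) :
    (hX.add hY).toSpace = hX.toSpace + hY.toSpace := by
  refine Subtype.ext (Lp.ext ?_)
  rw [Submodule.coe_add]
  filter_upwards [(hX.add hY).toSpace_ae, hX.toSpace_ae, hY.toSpace_ae,
    Lp.coeFn_add (hX.toSpace : Lp ℝ 2 ((timeMeasure T).prod P)) hY.toSpace] with z h1 h2 h3 h4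
  rw [h1, h4, Pi.add_apply, h2, h3, discounted, discounted, discounted, mul_add]

theorem MemL2.toSpace_const_mul (hX : MemL2 P F δ X) (a : ℝ) :
    (hX.const_mul a).toSpace = a • hX.toSpace := by
  refine Subtype.ext (Lp.ext ?_)
  rw [Submodule.coe_smul]
  filter_upwards [(hX.const_mul a).toSpace_ae, hX.toSpace_ae,
    Lp.coeFn_smul a (hX.toSpace : Lp ℝ 2 ((timeMeasure T).prod P))] with z h1 h2 h4
  rw [h1, h4, Pi.smul_apply, h2, discounted, discounted, smul_eq_mul]
  ring

theorem MemL2.toSpace_congr (hX : MemL2 P F δ X) (hY : MemL2 P F δ Y)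
    (h : ∀ t ω, X t ω = Y t ω) : hX.toSpace = hY.toSpace :=
  (hX.toSpace_eq_iff hY).2 (ae_of_all _ fun z => h z.1 z.2)

theorem MemL2.toSpace_sub (hX : MemL2 P F δ X) (hY : MemL2 P F δ Y) :
    (hX.sub hY).toSpace = hX.toSpace - hY.toSpace := by
  rw [MemL2.toSpace_congr (hX.sub hY) (hX.add (hY.const_mul (-1))) (fun t ω => by ring),
    hX.toSpace_add (hY.const_mul (-1)), hY.toSpace_const_mul, sub_eq_add_neg, neg_one_smul]

theorem MemL2.toSpace_neg (hX : MemL2 P F δ X) : hX.neg.toSpace = -hX.toSpace := by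
  rw [MemL2.toSpace_congr hX.neg (hX.const_mul (-1)) (fun t ω => by ring),
    MemL2.toSpace_const_mul, neg_one_smul]

theorem toSpace_zero : (memL2_zero : MemL2 P F δ fun _ _ => (0 : ℝ)).toSpace = 0 := by
  rw [MemL2.toSpace_congr memL2_zero ((memL2_zero (P := P) (F := F) (δ := δ)).const_mul 0)
    (fun t ω => by ring), memL2_zero.toSpace_const_mul, zero_smul]

theorem MemL2.toSpace_sum {ι : Type*} (s : Finset ι) {X : ι → Time T → Ω → ℝ}
    (hX : ∀ i, MemL2 P F δ (X i)) :
    (MemL2.sum s fun i _ => hX i).toSpace = ∑ i ∈ s, (hX i).toSpace := by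
  classical
  induction s using Finset.induction_on with
  | empty =>
    rw [Finset.sum_empty, ← toSpace_zero (P := P) (F := F) (δ := δ)]
    exact MemL2.toSpace_congr _ _ fun t ω => by simp
  | insert a s ha ih =>
    rw [Finset.sum_insert ha, ← ih, ← MemL2.toSpace_add]
    exact MemL2.toSpace_congr _ _ fun t ω => by simp [Finset.sum_insert ha]

variable [hδ : Discount T δ]

theorem MemL2.norm_toSpace_position_le (hX : MemL2 P F δ X) :
    ‖hX.integral.toSpace‖ ≤ (expBound T δ).toReal * ‖hX.toSpace‖ := by
  rw [MemL2.norm_toSpace, MemL2.norm_toSpace, ← ENNReal.toReal_mul]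
  refine ENNReal.toReal_mono (ENNReal.mul_ne_top (expBound_lt_top hδ.nonneg hδ.pos).ne
    hX.memLp.2.ne) ?_
  have h := lintegral_discounted_position_le hX
  rw [eLpNorm_eq_lintegral_rpow_enorm_toReal two_ne_zero ENNReal.ofNat_ne_top,
    eLpNorm_eq_lintegral_rpow_enorm_toReal two_ne_zero ENNReal.ofNat_ne_top]
  simp only [ENNReal.toReal_ofNat, ENNReal.rpow_ofNat]
  calc _ ≤ (expBound T δ ^ 2 * ∫⁻ z, ‖discounted δ X z‖ₑ ^ 2 ∂((timeMeasure T).prod P))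
        ^ (1 / 2 : ℝ) := by gcongr
    _ = _ := by
      rw [ENNReal.mul_rpow_of_nonneg _ _ (by norm_num), ← ENNReal.rpow_two, ← ENNReal.rpow_mul]
      norm_num

/-- A process in the class `f`. -/
noncomputable def representative (δ : ℝ) (f : ProcessSpace P F) : Time T → Ω → ℝ :=
  (exists_toSpace_eq δ f).choose

theorem memL2_representative (δ : ℝ) (f : ProcessSpace P F) :
    MemL2 P F δ (representative δ f) := (exists_toSpace_eq δ f).choose_spec.choose

theorem toSpace_representative (δ : ℝ) (f : ProcessSpace P F) :
    (memL2_representative δ f).toSpace = f := (exists_toSpace_eq δ f).choose_spec.choose_spec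

theorem MemL2.toSpace_position_congr (hX : MemL2 P F δ X) (hY : MemL2 P F δ Y)
    (h : hX.toSpace = hY.toSpace) : hX.integral.toSpace = hY.integral.toSpace := by
  rw [MemL2.toSpace_eq_iff] at h ⊢
  have hm : MeasurableSet {z : Time T × Ω | position X z.1 z.2 = position Y z.1 z.2} :=
    measurableSet_eq_fun hX.integral.measurable hY.integral.measurable
  rw [Measure.ae_prod_iff_ae_ae hm, Measure.ae_ae_comm hm]
  filter_upwards [position_congr h] with ω hω
  exact ae_of_all _ hω

variable (P F δ) in
/-- Integration in time as an operator on the space of processes. -/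
noncomputable def integrationOp : ProcessSpace P F →L[ℝ] ProcessSpace P F :=
  LinearMap.mkContinuous
    { toFun := fun f => (memL2_representative δ f).integral.toSpace
      map_add' := fun f g => by
        have hf := memL2_representative δ f
        have hg := memL2_representative δ g
        -- The representative chosen for `f + g` need not be the sum of the chosen representatives,
        -- but both belong to the same class, and integration only sees the class.
        rw [← MemL2.toSpace_add, MemL2.toSpace_position_congr (memL2_representative δ (f + g))
          (hf.add hg) (by rw [hf.toSpace_add hg]; simp only [toSpace_representative]),
          MemL2.toSpace_eq_iff]
        have hm : MeasurableSet {z : Time T × Ω |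
            position (fun t ω => representative δ f t ω + representative δ g t ω) z.1 z.2 =
            position (representative δ f) z.1 z.2 + position (representative δ g) z.1 z.2} :=
          measurableSet_eq_fun (hf.add hg).integral.measurable
            (hf.integral.add hg.integral).measurable
        rw [Measure.ae_prod_iff_ae_ae hm, Measure.ae_ae_comm hm]
        filter_upwards [hf.position_add hg] with ω hω
        exact ae_of_all _ hω
      map_smul' := fun a f => by
        have hf := memL2_representative δ f
        rw [RingHom.id_apply, ← MemL2.toSpace_const_mul,
          MemL2.toSpace_position_congr (memL2_representative δ (a • f)) (hf.const_mul a)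
          (by rw [hf.toSpace_const_mul]; simp only [toSpace_representative])]
        exact MemL2.toSpace_congr _ _ fun t ω => position_const_mul a _ t ω }
    (expBound T δ).toReal
    (fun f => by
      have := (memL2_representative δ f).norm_toSpace_position_le
      rwa [toSpace_representative] at this)

theorem MemL2.integrationOp_toSpace (hX : MemL2 P F δ X) :
    integrationOp P F δ hX.toSpace = hX.integral.toSpace :=
  MemL2.toSpace_position_congr _ _ (toSpace_representative δ _)

end ProcessSpace

/-! ### Square-integrable conditional expectations. -/

section CondExp

/-- Jensen's inequality for the square of an integral over a finite measure. -/
theorem sq_enorm_integral_le {α : Type*} [MeasurableSpace α] {μ : Measure α} {f : α → ℝ}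
    (hf : AEMeasurable f μ) : ‖∫ x, f x ∂μ‖ₑ ^ 2 ≤ μ Set.univ * ∫⁻ x, ‖f x‖ₑ ^ 2 ∂μ := by
  have h := ENNReal.lintegral_mul_le_Lp_mul_Lq μ Real.HolderConjugate.two_two
    (aemeasurable_const (b := (1 : ℝ≥0∞))) hf.enorm
  simp only [Pi.mul_apply, one_mul, ENNReal.one_rpow, lintegral_const] at h
  calc ‖∫ x, f x ∂μ‖ₑ ^ 2
      ≤ (μ Set.univ ^ (1 / 2 : ℝ) * (∫⁻ x, ‖f x‖ₑ ^ (2 : ℝ) ∂μ) ^ (1 / 2 : ℝ)) ^ 2 := by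
        gcongr
        exact (enorm_integral_le_lintegral_enorm _).trans h
    _ = _ := by
        rw [mul_pow, ← ENNReal.rpow_two, ← ENNReal.rpow_two, ← ENNReal.rpow_mul,
          ← ENNReal.rpow_mul]
        norm_num

variable {Ω : Type*} {m mΩ : MeasurableSpace Ω} {P : Measure Ω}

theorem lintegral_sq_condExp_le {g : Ω → ℝ} :
    ∫⁻ ω, ‖(P[g | m]) ω‖ₑ ^ 2 ∂P ≤ ∫⁻ ω, ‖g ω‖ₑ ^ 2 ∂P := by
  have h := eLpNorm_condExp_le_eLpNorm (μ := P) (m := m) g one_le_two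
  rw [eLpNorm_eq_lintegral_rpow_enorm_toReal two_ne_zero ENNReal.ofNat_ne_top,
    eLpNorm_eq_lintegral_rpow_enorm_toReal two_ne_zero ENNReal.ofNat_ne_top] at h
  simp only [ENNReal.toReal_ofNat, ENNReal.rpow_ofNat] at h
  rwa [ENNReal.rpow_le_rpow_iff (by norm_num)] at h

theorem tendstoInMeasure_of_tendsto_integral_sq {f : ℕ → Ω → ℝ} {g : Ω → ℝ}
    (hf : ∀ n, MemLp (f n) 2 P) (hg : MemLp g 2 P)
    (h : Tendsto (fun n => ∫ ω, (g ω - f n ω) ^ 2 ∂P) atTop (𝓝 0)) :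
    TendstoInMeasure P f atTop g := by
  refine tendstoInMeasure_of_tendsto_eLpNorm two_ne_zero (fun n => (hf n).1) hg.1 ?_
  have e : ∀ n, eLpNorm (f n - g) 2 P
      = (ENNReal.ofReal (∫ ω, (g ω - f n ω) ^ 2 ∂P)) ^ (1 / 2 : ℝ) := by
    intro n
    have i : Integrable (fun ω => (g ω - f n ω) ^ 2) P := (hg.sub (hf n)).integrable_sq
    rw [ofReal_integral_eq_lintegral_ofReal i
      (ae_of_all _ fun _ => sq_nonneg _),
      eLpNorm_eq_lintegral_rpow_enorm_toReal two_ne_zero ENNReal.ofNat_ne_top]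
    simp only [ENNReal.toReal_ofNat, ENNReal.rpow_ofNat]
    congr 1
    refine lintegral_congr fun ω => ?_
    rw [Pi.sub_apply, ← ofReal_norm, ← ENNReal.ofReal_pow (norm_nonneg _), Real.norm_eq_abs, sq_abs]
    congr 1
    ring
  simp_rw [e]
  have h2 := ((ENNReal.continuous_rpow_const (y := 1 / 2)).tendsto _).comp
    (ENNReal.tendsto_ofReal h)
  simpa [Function.comp_def] using h2

variable [IsProbabilityMeasure P]

theorem integral_mul_condExp (hm : m ≤ mΩ) {Y g : Ω → ℝ} (hY : AEStronglyMeasurable[m] Y P)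
    (hYg : Integrable (fun ω => Y ω * g ω) P) (hg : Integrable g P) :
    ∫ ω, Y ω * (P[g | m]) ω ∂P = ∫ ω, Y ω * g ω ∂P := by
  rw [← integral_condExp hm (f := fun ω => Y ω * g ω)]
  exact integral_congr_ae (condExp_mul_of_aestronglyMeasurable_left hY hYg hg).symm

/-- Pythagoras for the orthogonal projection onto the `m`-measurable functions. Along a martingale
it expresses `L²` distances by differences of second moments. -/
theorem integral_sq_sub_condExp (hm : m ≤ mΩ) {g : Ω → ℝ} (hg : MemLp g 2 P) :
    ∫ ω, (g ω - (P[g | m]) ω) ^ 2 ∂P = ∫ ω, g ω ^ 2 ∂P - ∫ ω, (P[g | m]) ω ^ 2 ∂P := by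
  have hc : MemLp (P[g | m]) 2 P := hg.condExp one_le_two
  have h := integral_mul_condExp hm stronglyMeasurable_condExp.aestronglyMeasurable
    (hc.integrable_mul hg) (hg.integrable one_le_two)
  have e : ∀ ω, (g ω - (P[g | m]) ω) ^ 2
      = g ω ^ 2 + (P[g | m]) ω ^ 2 - 2 * ((P[g | m]) ω * g ω) := fun ω => by ring
  have i3 : Integrable (fun ω => 2 * ((P[g | m]) ω * g ω)) P :=
    (hc.integrable_mul hg).const_mul 2
  have i12 : Integrable (fun ω => g ω ^ 2 + (P[g | m]) ω ^ 2) P :=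
    hg.integrable_sq.add hc.integrable_sq
  simp_rw [e]
  rw [integral_sub i12 i3,
    integral_add hg.integrable_sq hc.integrable_sq, integral_const_mul, ← h]
  simp_rw [← sq]
  ring

end CondExp

/-! ### A progressive version of a martingale, without the usual conditions. -/

section ProgressiveVersion

variable {Ω : Type*} {mΩ : MeasurableSpace Ω} {P : Measure Ω} [IsProbabilityMeasure P] {T : ℝ≥0∞}
  {F : Filtration (Time T) mΩ}

/-- The points of the dyadic grid of mesh `2 ^ (-n)`. -/
noncomputable def Time.dyadic (T : ℝ≥0∞) (n k : ℕ) : Time T := Time.trunc T (k / 2 ^ n)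

/-- The last point of the dyadic grid of mesh `2 ^ (-n)` before `t`. -/
noncomputable def Time.floor (n : ℕ) (t : Time T) : Time T :=
  Time.dyadic T n ⌊2 ^ n * (t : ℝ)⌋₊

theorem Time.coe_floor (n : ℕ) (t : Time T) :
    (Time.floor n t : ℝ) = ⌊2 ^ n * (t : ℝ)⌋₊ / 2 ^ n := by
  refine Time.trunc_coe_of_mem (t.mem_of_le (by positivity) ?_)
  rw [div_le_iff₀ (by positivity), mul_comm (t : ℝ)]
  exact Nat.floor_le (mul_nonneg (by positivity) t.coe_nonneg)

theorem Time.floor_le (n : ℕ) (t : Time T) : Time.floor n t ≤ t := by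
  rw [← Subtype.coe_le_coe, Time.coe_floor, div_le_iff₀ (by positivity), mul_comm (t : ℝ)]
  exact Nat.floor_le (mul_nonneg (by positivity) t.coe_nonneg)

theorem Time.monotone_floor (t : Time T) : Monotone fun n => Time.floor n t := by
  refine monotone_nat_of_le_succ fun n => ?_
  rw [← Subtype.coe_le_coe, Time.coe_floor, Time.coe_floor, div_le_div_iff₀ (by positivity)
    (by positivity), pow_succ, ← mul_assoc, mul_comm _ (2 : ℝ), ← mul_assoc]
  gcongr
  have h : ((2 * ⌊2 ^ n * (t : ℝ)⌋₊ : ℕ) : ℝ) ≤ (⌊2 ^ n * (t : ℝ) * 2⌋₊ : ℕ) := by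
    refine Nat.cast_le.2 (Nat.le_floor ?_)
    have := Nat.floor_le (a := 2 ^ n * (t : ℝ)) (mul_nonneg (by positivity) t.coe_nonneg)
    push_cast
    linarith
  push_cast at h
  rwa [mul_right_comm] at h

theorem Time.tendsto_floor (t : Time T) : Tendsto (fun n => Time.floor n t) atTop (𝓝 t) := by
  rw [tendsto_subtype_rng]
  simp_rw [Time.coe_floor]
  have h1 : ∀ n : ℕ, (t : ℝ) - (1 / 2) ^ n ≤ ⌊2 ^ n * (t : ℝ)⌋₊ / 2 ^ n := fun n => by
    rw [le_div_iff₀ (by positivity), sub_mul, ← mul_pow]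
    have := (Nat.lt_floor_add_one (2 ^ n * (t : ℝ))).le
    norm_num
    linarith
  have h2 : ∀ n : ℕ, (⌊2 ^ n * (t : ℝ)⌋₊ : ℝ) / 2 ^ n ≤ t := fun n => by
    rw [div_le_iff₀ (by positivity), mul_comm (t : ℝ)]
    exact Nat.floor_le (mul_nonneg (by positivity) t.coe_nonneg)
  refine tendsto_of_tendsto_of_tendsto_of_le_of_le ?_ tendsto_const_nhds h1 h2
  simpa using (tendsto_const_nhds (x := (t : ℝ))).sub
    (tendsto_pow_atTop_nhds_zero_of_lt_one (r := (1 / 2 : ℝ)) (by norm_num) (by norm_num))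

/-- A process that is constant on dyadic intervals, with the value given by the left endpoint, is
progressive. -/
theorem isStronglyProgressive_comp_floor {X : Time T → Ω → ℝ} (hX : StronglyAdapted F X) (n : ℕ) :
    IsStronglyProgressive F fun t ω => X (Time.floor n t) ω := by
  intro i
  let := F i
  have h1 : Measurable fun q : Ω × ℕ =>
      if Time.dyadic T n q.2 ≤ i then X (Time.dyadic T n q.2) q.1 else 0 := by
    refine measurable_from_prod_countable_left fun k => ?_
    dsimp only
    split_ifs with h
    · exact ((hX _).mono (F.mono h)).measurable
    · exact measurable_const
  have h2 : Measurable fun p : Set.Iic i × Ω => (p.2, ⌊2 ^ n * ((p.1 : Time T) : ℝ)⌋₊) := by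
    refine measurable_snd.prodMk (Nat.measurable_floor.comp ?_)
    fun_prop
  have h3 : (fun p : Set.Iic i × Ω => X (Time.floor n p.1) p.2)
      = (fun q : Ω × ℕ =>
        if Time.dyadic T n q.2 ≤ i then X (Time.dyadic T n q.2) q.1 else 0) ∘
        fun p : Set.Iic i × Ω => (p.2, ⌊2 ^ n * ((p.1 : Time T) : ℝ)⌋₊) := by
    funext p
    have : Time.floor n (p.1 : Time T) ≤ i := (Time.floor_le n _).trans p.1.2
    exact (if_pos this).symm
  rw [h3]
  exact (h1.comp h2).stronglyMeasurable

/-- Modifying a progressive process at countably many times by an adapted process keeps it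
progressive. -/
theorem isStronglyProgressive_ite_countable {X Y : Time T → Ω → ℝ} {D : Set (Time T)}
    [DecidablePred (· ∈ D)] (hD : D.Countable) (hX : StronglyAdapted F X)
    (hY : IsStronglyProgressive F Y) :
    IsStronglyProgressive F fun t ω => if t ∈ D then X t ω else Y t ω := by
  intro i
  let := F i
  have hS : MeasurableSet {p : Set.Iic i × Ω | (p.1 : Time T) ∈ D} :=
    (by fun_prop : Measurable fun p : Set.Iic i × Ω => (p.1 : Time T)) hD.measurableSet
  refine Measurable.stronglyMeasurable fun s hs => ?_
  have e : (fun p : Set.Iic i × Ω => if (p.1 : Time T) ∈ D then X p.1 p.2 else Y p.1 p.2) ⁻¹' s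
      = (⋃ d ∈ {d ∈ D | d ≤ i}, {p : Set.Iic i × Ω | (p.1 : Time T) = d} ∩
          (fun p : Set.Iic i × Ω => X d p.2) ⁻¹' s) ∪
        ({p : Set.Iic i × Ω | (p.1 : Time T) ∈ D}ᶜ ∩
          (fun p : Set.Iic i × Ω => Y p.1 p.2) ⁻¹' s) := by
    ext p
    have hp := p.1.2
    simp only [Set.mem_preimage, Set.mem_union, Set.mem_iUnion, Set.mem_inter_iff,
      Set.mem_compl_iff, Set.mem_ofPred_eq, exists_prop]
    by_cases h : (p.1 : Time T) ∈ D
    · rw [if_pos h]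
      refine ⟨fun h1 => Or.inl ⟨p.1, ⟨h, hp⟩, rfl, h1⟩, ?_⟩
      rintro (⟨d, -, h1, h2⟩ | ⟨h1, -⟩)
      · rwa [h1]
      · exact absurd h h1
    · rw [if_neg h]
      refine ⟨fun h1 => Or.inr ⟨h, h1⟩, ?_⟩
      rintro (⟨d, h3, h1, h2⟩ | ⟨-, h1⟩)
      · exact absurd (h1 ▸ h3.1) h
      · exact h1
  rw [e]
  refine (MeasurableSet.biUnion (hD.mono fun d hd => hd.1) fun d hd => ?_).union
    (hS.compl.inter ((hY i).measurable hs))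
  refine MeasurableSet.inter ?_ ((((hX d).mono (F.mono hd.2)).measurable.comp measurable_snd) hs)
  exact (by fun_prop : Measurable fun p : Set.Iic i × Ω => (p.1 : Time T))
    (measurableSet_singleton d)

/-- The martingale of conditional expectations of a square-integrable random variable has a
progressive version, for an arbitrary filtration. -/
theorem exists_isStronglyProgressive_condExp (F : Filtration (Time T) mΩ) {H : Ω → ℝ}
    (hH : MemLp H 2 P) :
    ∃ Z : Time T → Ω → ℝ, IsStronglyProgressive F Z ∧ ∀ t, Z t =ᵐ[P] P[H | F t] := by
  classical
  set N : Time T → Ω → ℝ := fun t => P[H | F t] with hN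
  have hNa : StronglyAdapted F N := fun t => stronglyMeasurable_condExp
  have hN2 : ∀ t, MemLp (N t) 2 P := fun t => hH.condExp one_le_two
  have htower : ∀ {s t}, s ≤ t → P[N t | F s] =ᵐ[P] N s := fun {s t} h =>
    condExp_condExp_of_le (F.mono h) (F.le t)
  set φ : Time T → ℝ := fun t => ∫ ω, N t ω ^ 2 ∂P with hφ
  have hdist : ∀ {s t}, s ≤ t → ∫ ω, (N t ω - N s ω) ^ 2 ∂P = φ t - φ s := by
    intro s t h
    have h1 := integral_sq_sub_condExp (F.le s) (hN2 t)
    rw [hφ, ← integral_congr_ae ((htower h).mono fun ω hω => by simp only [hω] :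
      (fun ω => (N t ω - (P[N t | F s]) ω) ^ 2) =ᵐ[P] fun ω => (N t ω - N s ω) ^ 2), h1,
      integral_congr_ae ((htower h).mono fun ω hω => by simp only [hω] :
      (fun ω => ((P[N t | F s]) ω) ^ 2) =ᵐ[P] fun ω => (N s ω) ^ 2)]
  have hmono : Monotone φ := fun s t h => by
    have : 0 ≤ ∫ ω, (N t ω - N s ω) ^ 2 ∂P := integral_nonneg fun _ => sq_nonneg _
    rw [hdist h] at this
    linarith
  -- Second moments of a martingale increase, so `φ` jumps only at countably many times. At the
  -- other times `N` is continuous in `L²`, by `hdist`.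
  set D : Set (Time T) := {t | ¬ContinuousAt φ t} with hDdef
  have hD : D.Countable := hmono.countable_not_continuousAt
  -- Approximation from the left on dyadic grids keeps adaptedness, and the upper limit of
  -- progressive processes is progressive whether or not the sequence converges.
  set Y : Time T → Ω → ℝ := fun t ω => limsup (fun n => N (Time.floor n t) ω) atTop with hY
  have hYp : IsStronglyProgressive F Y := by
    intro i
    let := F i
    exact (Measurable.limsup fun n =>
      (isStronglyProgressive_comp_floor hNa n i).measurable).stronglyMeasurable
  refine ⟨fun t ω => if t ∈ D then N t ω else Y t ω,
    isStronglyProgressive_ite_countable hD hNa hYp, fun t => ?_⟩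
  by_cases ht : t ∈ D
  · simp only [if_pos ht]
    rfl
  simp only [if_neg ht]
  have hcont : ContinuousAt φ t := not_not.1 ht
  have h1 : TendstoInMeasure P (fun n => N (Time.floor n t)) atTop (N t) := by
    refine tendstoInMeasure_of_tendsto_integral_sq (fun n => hN2 _) (hN2 t) ?_
    simp_rw [fun n => hdist (Time.floor_le n t)]
    simpa using (tendsto_const_nhds (x := φ t)).sub (hcont.tendsto.comp (Time.tendsto_floor t))
  -- The dyadic floors of `t` increase, so Lévy's upward theorem gives almost sure convergence along
  -- the grid. The limit is identified as `N t` through the convergence in measure `h1`.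
  let G : Filtration ℕ mΩ := ⟨fun n => F (Time.floor n t),
    fun m n h => F.mono (Time.monotone_floor t h), fun n => F.le _⟩
  have h2 : ∀ᵐ ω ∂P, Tendsto (fun n => N (Time.floor n t) ω) atTop
      (𝓝 ((P[H | ⨆ n, (G n : MeasurableSpace Ω)]) ω)) := tendsto_ae_condExp (ℱ := G) H
  have h3 := tendstoInMeasure_ae_unique
    (tendstoInMeasure_of_tendsto_ae (fun n => (hN2 (Time.floor n t)).1) h2) h1
  filter_upwards [h2, h3] with ω h4 h5
  exact h4.limsup_eq.trans h5

end ProgressiveVersion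

/-! ### The backward process as the adjoint of integration in time. -/

section Backward

variable {Ω : Type*} {mΩ : MeasurableSpace Ω} {P : Measure Ω} [IsProbabilityMeasure P] {T : ℝ≥0∞}
  {F : Filtration (Time T) mΩ} {δ : ℝ} {X Y y g : Time T → Ω → ℝ}

/-- The discounted integral `∫_{(t, T]} e^{-δ s} g_s ds` over the remaining time. -/
noncomputable def remaining (δ : ℝ) (g : Time T → Ω → ℝ) (t : Time T) (ω : Ω) : ℝ :=
  ∫ s in Set.Ioi t, Real.exp (-δ * s) * g s ω ∂(timeMeasure T)

/-- The process `y` satisfies `y_t = E[∫_t^T e^{-δ (s - t)} g_s ds | F_t]` for all `t`. -/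
def IsBackward (P : Measure Ω) (F : Filtration (Time T) mΩ) (δ : ℝ) (y g : Time T → Ω → ℝ) :
    Prop :=
  ∀ t, y t =ᵐ[P] fun ω => Real.exp (δ * t) * (P[remaining δ g t | F t]) ω

theorem remaining_congr
    (h : ∀ᵐ z ∂((timeMeasure T).prod P), X z.1 z.2 = Y z.1 z.2) :
    ∀ᵐ ω ∂P, ∀ t, remaining δ X t ω = remaining δ Y t ω := by
  filter_upwards [ae_ae_of_ae_time_prod (p := fun t ω => X t ω = Y t ω) h] with ω hω t
  exact integral_congr_ae (ae_restrict_of_ae (hω.mono fun s hs => by simp only [hs]))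

theorem IsBackward.congr (hy : IsBackward P F δ y X)
    (h : ∀ᵐ z ∂((timeMeasure T).prod P), X z.1 z.2 = Y z.1 z.2) : IsBackward P F δ y Y := by
  intro t
  have h1 : remaining δ X t =ᵐ[P] remaining δ Y t :=
    (remaining_congr (δ := δ) h).mono fun ω hω => hω t
  filter_upwards [hy t, condExp_congr_ae (m := F t) h1] with ω h2 h3
  rw [h2, h3]

/-- Mirror image of the bound for the position: `e^{δ t / 2} e^{-δ s} = e^{-δ (s - t) / 2} e^{-δ s /
2}` for `s > t`, so the same kernel appears with the roles of the variables exchanged. -/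
theorem enorm_remaining_le (δ : ℝ) (g : Time T → Ω → ℝ) (t : Time T) (ω : Ω) :
    ENNReal.ofReal (Real.exp (δ / 2 * t)) * ‖remaining δ g t ω‖ₑ ≤
      ∫⁻ s : Time T, expWeight T δ (s - t) * ‖discounted δ g (s, ω)‖ₑ ∂(timeMeasure T) := by
  have h1 : ‖remaining δ g t ω‖ₑ ≤
      ∫⁻ s in Set.Ioi t, ‖Real.exp (-δ * s) * g s ω‖ₑ ∂(timeMeasure T) :=
    enorm_integral_le_lintegral_enorm _
  calc _ ≤ ENNReal.ofReal (Real.exp (δ / 2 * t)) *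
        ∫⁻ s in Set.Ioi t, ‖Real.exp (-δ * s) * g s ω‖ₑ ∂(timeMeasure T) := by gcongr
    _ = ∫⁻ s in Set.Ioi t, expWeight T δ (s - t) * ‖discounted δ g (s, ω)‖ₑ ∂(timeMeasure T) := by
        rw [← lintegral_const_mul' _ _ ENNReal.ofReal_ne_top]
        refine setLIntegral_congr_fun measurableSet_Ioi fun s hs => ?_
        simp only [discounted]
        rw [expWeight_sub (le_of_lt (by exact hs)), enorm_mul, enorm_mul,
          Real.enorm_of_nonneg (Real.exp_pos _).le, Real.enorm_of_nonneg (Real.exp_pos _).le,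
          ← mul_assoc, ← mul_assoc, ← ENNReal.ofReal_mul (Real.exp_pos _).le,
          ← ENNReal.ofReal_mul (Real.exp_pos _).le, ← Real.exp_add, ← Real.exp_add]
        ring_nf
    _ ≤ _ := setLIntegral_le_lintegral _ _

theorem measurable_discounted_section (hg : MemL2 P F δ g) (ω : Ω) :
    Measurable fun s => ‖discounted δ g (s, ω)‖ₑ :=
  (((hg.1.measurable_discounted δ).mono (progSigma_le F) le_rfl).comp
    measurable_prodMk_right).enorm

theorem measurable_remaining (hg : MemL2 P F δ g) :
    Measurable (Function.uncurry (remaining δ g)) := by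
  have hm : StronglyMeasurable (fun z : Time T × Ω => Real.exp (-δ * z.1) * g z.1 z.2) := by
    have := hg.measurable
    simp only [Function.uncurry_def] at this
    exact (by fun_prop : Measurable _).stronglyMeasurable
  have hR : MeasurableSet {q : Time T × Time T | q.2 < q.1} :=
    measurableSet_lt measurable_snd measurable_fst
  have h := stronglyMeasurable_integral_section (timeMeasure T)
    (X := fun (s : Time T) ω => Real.exp (-δ * s) * g s ω) hm hR
  convert h.measurable using 1
  funext z
  exact (integral_indicator measurableSet_Ioi).symm

variable [hδ : Discount T δ]

theorem expWeight_le_one (x : ℝ) : expWeight T δ x ≤ 1 := by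
  unfold expWeight
  refine Set.indicator_apply_le' (fun hx => ?_) fun _ => zero_le
  rw [ENNReal.ofReal_le_one, Real.exp_le_one_iff]
  have := hx.1
  have := hδ.nonneg
  nlinarith

theorem MemL2.discount (hg : MemL2 P F δ g) :
    MemL2 P F δ (fun t ω => Real.exp (-δ * t) * g t ω) := by
  have hp : IsStronglyProgressive F (fun (t : Time T) ω => Real.exp (-δ * t) * g t ω) :=
    (isStronglyProgressive_time F (f := fun x => Real.exp (-δ * x)) (by fun_prop)).mul hg.1
  refine memL2_iff.2 ⟨hp, hg.memLp.mono
    ((hp.measurable_discounted δ).mono (progSigma_le F) le_rfl).aestronglyMeasurable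
    (ae_of_all _ fun z => ?_)⟩
  rw [discounted, discounted, norm_mul, norm_mul, norm_mul]
  refine mul_le_mul_of_nonneg_left ?_ (norm_nonneg _)
  refine mul_le_of_le_one_left (norm_nonneg _) ?_
  rw [Real.norm_eq_abs, Real.abs_exp, Real.exp_le_one_iff]
  have := hδ.nonneg
  have := z.1.coe_nonneg
  nlinarith

/-- Over the whole time set, a process in `L²_δ` is integrable with respect to the discounted
measure. -/
theorem MemL2.integrable_discount (hg : MemL2 P F δ g) :
    Integrable (fun z : Time T × Ω => Real.exp (-δ * z.1) * g z.1 z.2)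
      ((timeMeasure T).prod P) := by
  -- The discounted measure is finite, that is, constants belong to `L²_δ`; the claim is then the
  -- integrability of a product of two elements.
  have h1 : MemL2 P F δ (fun _ _ => (1 : ℝ)) := by
    refine memL2_iff.2 ⟨isStronglyProgressive_const F 1, memLp_two_of_lintegral ?_ ?_⟩
    · exact (((isStronglyProgressive_const F (1 : ℝ)).measurable_discounted δ).mono
        (progSigma_le F) le_rfl).aestronglyMeasurable
    · have hm : Measurable fun z : Time T × Ω =>
          ‖discounted δ (fun (_ : Time T) (_ : Ω) => (1 : ℝ)) z‖ₑ ^ 2 := by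
        unfold discounted
        fun_prop
      rw [lintegral_prod _ hm.aemeasurable]
      calc _ ≤ ∫⁻ t : Time T, expWeight T δ (t - (0 : ℝ)) ∂(timeMeasure T) := by
            refine lintegral_mono fun t => ?_
            simp only [discounted, mul_one]
            rw [lintegral_const, measure_univ, mul_one, sub_zero, expWeight,
              Set.indicator_of_mem t.2,
              Real.enorm_of_nonneg (Real.exp_pos _).le, sq]
            refine mul_le_of_le_one_left zero_le ?_
            have := expWeight_le_one (T := T) (δ := δ) t
            rwa [expWeight, Set.indicator_of_mem t.2] at this
        _ ≤ expBound T δ := lintegral_expWeight_sub_le' δ 0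
        _ < ∞ := expBound_lt_top hδ.nonneg hδ.pos
  simpa using h1.integrable_mul hg

theorem MemL2.ae_integrable_discount (hg : MemL2 P F δ g) :
    ∀ᵐ ω ∂P, Integrable (fun s : Time T => Real.exp (-δ * s) * g s ω) (timeMeasure T) :=
  hg.integrable_discount.prod_left_ae

theorem MemL2.ae_remaining (hg : MemL2 P F δ g) :
    ∀ᵐ ω ∂P, ∀ t, ∫ s : Time T, Real.exp (-δ * s) * g s ω ∂(timeMeasure T) =
      position (fun s ω => Real.exp (-δ * s) * g s ω) t ω + remaining δ g t ω := by
  filter_upwards [hg.ae_integrable_discount] with ω hω t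
  rw [position, remaining, ← Set.compl_Iic, integral_add_compl measurableSet_Iic hω]

theorem lintegral_sq_remaining_le (hg : MemL2 P F δ g) :
    ∫⁻ t : Time T, ∫⁻ ω, (ENNReal.ofReal (Real.exp (δ / 2 * t)) * ‖remaining δ g t ω‖ₑ) ^ 2 ∂P
      ∂(timeMeasure T) ≤
      expBound T δ ^ 2 * ∫⁻ z, ‖discounted δ g z‖ₑ ^ 2 ∂((timeMeasure T).prod P) := by
  have hm : Measurable (discounted δ g) :=
    (hg.1.measurable_discounted δ).mono (progSigma_le F) le_rfl
  have hr : Measurable (Function.uncurry fun (t : Time T) ω =>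
      (ENNReal.ofReal (Real.exp (δ / 2 * t)) * ‖remaining δ g t ω‖ₑ) ^ 2) := by
    have := measurable_remaining hg
    simp only [Function.uncurry_def] at this ⊢
    fun_prop
  rw [lintegral_lintegral_swap hr.aemeasurable,
    lintegral_prod_symm _ (hm.enorm.pow_const 2).aemeasurable,
    ← lintegral_const_mul _ (hm.enorm.pow_const 2).lintegral_prod_left']
  refine lintegral_mono fun ω => ?_
  calc _ ≤ ∫⁻ t : Time T, (∫⁻ s : Time T, expWeight T δ (s - t) * ‖discounted δ g (s, ω)‖ₑ
          ∂(timeMeasure T)) ^ 2 ∂(timeMeasure T) := by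
        gcongr with t; exact enorm_remaining_le δ g t ω
    _ ≤ _ := lintegral_sq_lintegral_kernel_le
        (k := fun s t : Time T => expWeight T δ (s - t))
        ((measurable_expWeight δ).comp (by fun_prop))
        (fun t => lintegral_expWeight_sub_le' δ t) (fun s => lintegral_expWeight_sub_le δ s)
        (measurable_discounted_section hg ω)

/-- The expected discounted remaining integral is square-integrable at every time. -/
theorem MemL2.memLp_remaining (hg : MemL2 P F δ g) (t : Time T) : MemLp (remaining δ g t) 2 P := by
  refine memLp_two_of_lintegral
    ((measurable_remaining hg).comp measurable_prodMk_left).aestronglyMeasurable ?_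
  have hm : Measurable (discounted δ g) :=
    (hg.1.measurable_discounted δ).mono (progSigma_le F) le_rfl
  have hw : Measurable fun s : Time T => expWeight T δ (s - t) :=
    (measurable_expWeight δ).comp (by fun_prop)
  calc ∫⁻ ω, ‖remaining δ g t ω‖ₑ ^ 2 ∂P
      ≤ ∫⁻ ω, expBound T δ * ∫⁻ s, ‖discounted δ g (s, ω)‖ₑ ^ 2 ∂(timeMeasure T) ∂P := by
        refine lintegral_mono fun ω => ?_
        have h0 : ‖remaining δ g t ω‖ₑ ≤
            ∫⁻ s : Time T, expWeight T δ (s - t) * ‖discounted δ g (s, ω)‖ₑ ∂(timeMeasure T) := by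
          refine le_trans ?_ (enorm_remaining_le δ g t ω)
          refine le_mul_of_one_le_left zero_le ?_
          rw [ENNReal.one_le_ofReal, Real.one_le_exp_iff]
          exact mul_nonneg (by have := hδ.nonneg; linarith) t.coe_nonneg
        -- Cauchy-Schwarz against the weight; its square is at most the weight itself, which has
        -- total mass at most `expBound T δ`.
        have h := ENNReal.lintegral_mul_le_Lp_mul_Lq (timeMeasure T) Real.HolderConjugate.two_two
          hw.aemeasurable (measurable_discounted_section hg ω).aemeasurable
        simp only [ENNReal.rpow_ofNat, Pi.mul_apply] at h
        calc _ ≤ ((∫⁻ s : Time T, expWeight T δ (s - t) ^ 2 ∂(timeMeasure T)) ^ (1 / 2 : ℝ) *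
              (∫⁻ s, ‖discounted δ g (s, ω)‖ₑ ^ 2 ∂(timeMeasure T)) ^ (1 / 2 : ℝ)) ^ 2 := by
              gcongr
              exact h0.trans h
          _ = (∫⁻ s : Time T, expWeight T δ (s - t) ^ 2 ∂(timeMeasure T)) *
              ∫⁻ s, ‖discounted δ g (s, ω)‖ₑ ^ 2 ∂(timeMeasure T) := by
              rw [mul_pow, ← ENNReal.rpow_two, ← ENNReal.rpow_two, ← ENNReal.rpow_mul,
                ← ENNReal.rpow_mul]
              norm_num
          _ ≤ _ := by
              gcongr
              refine le_trans (lintegral_mono fun s => ?_) (lintegral_expWeight_sub_le' δ t)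
              rw [sq]
              exact mul_le_of_le_one_left zero_le (expWeight_le_one _)
    _ = expBound T δ * ∫⁻ z, ‖discounted δ g z‖ₑ ^ 2 ∂((timeMeasure T).prod P) := by
        rw [lintegral_const_mul _ (hm.enorm.pow_const 2).lintegral_prod_left',
          lintegral_prod_symm _ (hm.enorm.pow_const 2).aemeasurable]
    _ < ∞ := ENNReal.mul_lt_top (expBound_lt_top hδ.nonneg hδ.pos) hg.memLp.lintegral_sq_lt_top

theorem MemL2.memLp_position (hg : MemL2 P F δ g) (t : Time T) : MemLp (position g t) 2 P := by
  have hp := (isStronglyProgressive_position hg.1).measurable_uncurry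
  refine memLp_two_of_lintegral (hp.comp measurable_prodMk_left).aestronglyMeasurable ?_
  have hm : Measurable fun z : Time T × Ω => ‖g z.1 z.2‖ₑ ^ 2 := (hg.measurable.enorm).pow_const 2
  calc ∫⁻ ω, ‖position g t ω‖ₑ ^ 2 ∂P
      ≤ ∫⁻ ω, ENNReal.ofReal t * ∫⁻ s in Set.Iic t, ‖g s ω‖ₑ ^ 2 ∂(timeMeasure T) ∂P := by
        refine lintegral_mono fun ω => ?_
        have h := sq_enorm_integral_le (μ := (timeMeasure T).restrict (Set.Iic t))
          (f := fun s => g s ω) (hg.measurable.comp measurable_prodMk_right).aemeasurable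
        rwa [Measure.restrict_apply_univ, timeMeasure_Iic] at h
    _ = ENNReal.ofReal t *
        ∫⁻ z, ‖g z.1 z.2‖ₑ ^ 2 ∂(((timeMeasure T).restrict (Set.Iic t)).prod P) := by
        rw [lintegral_const_mul _ hm.lintegral_prod_left', lintegral_prod_symm _ hm.aemeasurable]
    _ < ∞ := ENNReal.mul_lt_top ENNReal.ofReal_lt_top (hg.memLp_restrict t).lintegral_sq_lt_top

/-- The backward process for `g` exists. -/
theorem MemL2.exists_isBackward (hg : MemL2 P F δ g) :
    ∃ y, MemL2 P F δ y ∧ IsBackward P F δ y g := by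
  have hi := hg.discount
  -- The remaining integral is the total integral minus the past one `I`, which is adapted. So only
  -- the conditional expectations of one fixed random variable need a progressive version.
  set I := position (fun (s : Time T) ω => Real.exp (-δ * s) * g s ω) with hI
  have hH : MemLp (fun ω => ∫ s : Time T, Real.exp (-δ * s) * g s ω ∂(timeMeasure T)) 2 P := by
    refine ((hi.memLp_position ⊥).add (hg.memLp_remaining ⊥)).ae_eq ?_
    filter_upwards [hg.ae_remaining] with ω hω
    exact (hω ⊥).symm
  obtain ⟨Z, hZ, hZc⟩ := exists_isStronglyProgressive_condExp F hH
  have hIp : IsStronglyProgressive F I := hi.integral.1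
  have hyp : IsStronglyProgressive F fun (t : Time T) ω => Real.exp (δ * t) * (Z t ω - I t ω) :=
    (isStronglyProgressive_time F (f := fun x => Real.exp (δ * x)) (by fun_prop)).mul
      (hZ.sub hIp)
  have hb : IsBackward P F δ (fun (t : Time T) ω => Real.exp (δ * t) * (Z t ω - I t ω)) g := by
    intro t
    have e : (fun ω => ∫ s : Time T, Real.exp (-δ * s) * g s ω ∂(timeMeasure T)) =ᵐ[P]
        I t + remaining δ g t := by
      filter_upwards [hg.ae_remaining] with ω hω
      exact hω t
    have iI : Integrable (I t) P := (hi.memLp_position t).integrable one_le_two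
    have iR := (hg.memLp_remaining t).integrable one_le_two
    filter_upwards [hZc t, condExp_congr_ae (m := F t) e, condExp_add iI iR (F t)]
      with ω h1 h2 h3
    rw [h1, h2, h3, condExp_of_stronglyMeasurable (F.le t) (hIp.stronglyAdapted t) iI]
    simp
  refine ⟨_, memL2_iff.2 ⟨hyp, memLp_two_of_lintegral
    ((hyp.measurable_discounted δ).mono (progSigma_le F) le_rfl).aestronglyMeasurable ?_⟩, hb⟩
  have hm := (hyp.measurable_discounted δ).mono (progSigma_le F) le_rfl
  rw [lintegral_prod _ (hm.enorm.pow_const 2).aemeasurable]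
  -- At each fixed time conditional expectation contracts `L²`, so the Schur bound for the remaining
  -- integral passes to the backward process.
  refine lt_of_le_of_lt ?_ ((lintegral_sq_remaining_le hg).trans_lt (ENNReal.mul_lt_top
    (ENNReal.pow_lt_top (expBound_lt_top hδ.nonneg hδ.pos)) hg.memLp.lintegral_sq_lt_top))
  refine lintegral_mono fun t => ?_
  have e : ∀ᵐ ω ∂P, ‖discounted δ (fun (t : Time T) ω => Real.exp (δ * t) * (Z t ω - I t ω))
      (t, ω)‖ₑ ^ 2 = ENNReal.ofReal (Real.exp (δ / 2 * t)) ^ 2 *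
        ‖(P[remaining δ g t | F t]) ω‖ₑ ^ 2 := by
    filter_upwards [hb t] with ω hω
    rw [discounted]
    simp only
    rw [hω, ← mul_assoc, ← Real.exp_add, enorm_mul, Real.enorm_of_nonneg (Real.exp_pos _).le,
      mul_pow]
    ring_nf
  simp_rw [mul_pow]
  rw [lintegral_congr_ae e, lintegral_const_mul' _ _ (by simp), lintegral_const_mul' _ _ (by simp)]
  exact mul_le_mul' le_rfl lintegral_sq_condExp_le

theorem MemL2.abs (hX : MemL2 P F δ X) : MemL2 P F δ (fun t ω => |X t ω|) := by
  refine memL2_iff.2 ⟨hX.1.norm, hX.memLp.norm.ae_eq (ae_of_all _ fun z => ?_)⟩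
  simp only [discounted]
  rw [norm_mul, Real.norm_eq_abs, Real.abs_exp, Real.norm_eq_abs]

theorem MemL2.memLp_exp_remaining (hg : MemL2 P F δ g) :
    MemLp (fun z : Time T × Ω => Real.exp (δ / 2 * z.1) * remaining δ g z.1 z.2) 2
      ((timeMeasure T).prod P) := by
  have hm : Measurable fun z : Time T × Ω => Real.exp (δ / 2 * z.1) * remaining δ g z.1 z.2 := by
    have := measurable_remaining hg
    simp only [Function.uncurry_def] at this
    fun_prop
  refine memLp_two_of_lintegral hm.aestronglyMeasurable ?_
  rw [lintegral_prod _ (hm.enorm.pow_const 2).aemeasurable]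
  refine lt_of_eq_of_lt (lintegral_congr fun t => lintegral_congr fun ω => ?_)
    ((lintegral_sq_remaining_le hg).trans_lt (ENNReal.mul_lt_top
      (ENNReal.pow_lt_top (expBound_lt_top hδ.nonneg hδ.pos)) hg.memLp.lintegral_sq_lt_top))
  rw [enorm_mul, Real.enorm_of_nonneg (Real.exp_pos _).le]

theorem MemL2.integrable_mul_remaining (hX : MemL2 P F δ X) (hg : MemL2 P F δ g) :
    Integrable (fun z : Time T × Ω => X z.1 z.2 * remaining δ g z.1 z.2)
      ((timeMeasure T).prod P) := by
  refine (hX.memLp.integrable_mul hg.memLp_exp_remaining).congr (ae_of_all _ fun z => ?_)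
  simp only [Pi.mul_apply, discounted]
  have : Real.exp (-δ / 2 * z.1) * Real.exp (δ / 2 * z.1) = 1 := by
    rw [← Real.exp_add]; ring_nf; exact Real.exp_zero
  linear_combination (X z.1 z.2 * remaining δ g z.1 z.2) * this

/-- Pathwise integration by parts. -/
theorem MemL2.ae_integral_position_mul (hX : MemL2 P F δ X) (hg : MemL2 P F δ g) :
    ∀ᵐ ω ∂P, ∫ t : Time T, Real.exp (-δ * t) * (position X t ω * g t ω) ∂(timeMeasure T) =
      ∫ s, X s ω * remaining δ g s ω ∂(timeMeasure T) := by
  -- The argument is Fubini on the triangle `s ≤ t`; absolute integrability on it is the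
  -- integrability of `position |X| · |g|`.
  have hXa := hX.abs
  filter_upwards [(hXa.integral.integrable_mul hg.abs).prod_left_ae, hX.ae_integrableOn]
    with ω h1 h2
  have mX : Measurable fun s => X s ω := hX.measurable.comp measurable_prodMk_right
  have mg : Measurable fun s => g s ω := hg.measurable.comp measurable_prodMk_right
  set f : Time T → Time T → ℝ := fun t s =>
    (Set.Iic t).indicator (fun s => Real.exp (-δ * t) * g t ω * X s ω) s with hf
  have hS : MeasurableSet {q : Time T × Time T | q.2 ≤ q.1} :=
    measurableSet_le measurable_snd measurable_fst
  have mf : Measurable (Function.uncurry f) := by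
    have : Measurable fun q : Time T × Time T => Real.exp (-δ * q.1) * g q.1 ω * X q.2 ω := by
      fun_prop
    exact this.indicator hS
  have hfi : Integrable (Function.uncurry f) ((timeMeasure T).prod (timeMeasure T)) := by
    rw [integrable_prod_iff mf.aestronglyMeasurable]
    constructor
    · refine ae_of_all _ fun t => ?_
      have h : IntegrableOn (fun s => Real.exp (-δ * t) * g t ω * X s ω) (Set.Iic t)
        (timeMeasure T) := (h2 t).const_mul _
      exact (integrable_indicator_iff measurableSet_Iic).2 h
    · refine h1.congr (ae_of_all _ fun t => ?_)
      have e : ∀ s, ‖Function.uncurry f (t, s)‖ =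
          (Set.Iic t).indicator (fun s => |Real.exp (-δ * t) * g t ω| * |X s ω|) s := by
        intro s
        simp only [Function.uncurry_apply_pair, hf]
        rw [norm_indicator_eq_indicator_norm]
        simp only [norm_mul, Real.norm_eq_abs, abs_mul]
      simp_rw [e]
      rw [integral_indicator measurableSet_Iic, integral_const_mul, abs_mul, Real.abs_exp, position]
      ring
  have h3 := integral_integral_swap hfi
  have e1 : ∀ t : Time T, ∫ s, f t s ∂(timeMeasure T)
      = Real.exp (-δ * t) * (position X t ω * g t ω) := fun t => by
    rw [hf]
    simp only
    rw [integral_indicator measurableSet_Iic, integral_const_mul, position]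
    ring
  have e2 : ∀ s : Time T, ∫ t, f t s ∂(timeMeasure T) = X s ω * remaining δ g s ω := fun s => by
    have : ∀ t, f t s =
        (Set.Ici s).indicator (fun t => X s ω * (Real.exp (-δ * t) * g t ω)) t := fun t => by
      rw [hf]
      simp only [Set.indicator_apply, Set.mem_Iic, Set.mem_Ici]
      congr 1
      ring
    simp_rw [this]
    rw [integral_indicator measurableSet_Ici, integral_Ici_eq_integral_Ioi, integral_const_mul,
      remaining]
  simp_rw [e1, e2] at h3
  exact h3

theorem ae_memLp_section {f : Time T × Ω → ℝ} (h : MemLp f 2 ((timeMeasure T).prod P)) :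
    ∀ᵐ t ∂(timeMeasure T), MemLp (fun ω => f (t, ω)) 2 P := by
  have h1 := h.1.prodMk_left
  have h2 := (h.integrable_sq).prod_right_ae
  filter_upwards [h1, h2] with t h3 h4
  exact (memLp_two_iff_integrable_sq h3).2 h4

theorem MemL2.ae_memLp (hX : MemL2 P F δ X) : ∀ᵐ t ∂(timeMeasure T), MemLp (X t) 2 P := by
  filter_upwards [ae_memLp_section hX.memLp] with t ht
  refine (ht.const_mul (Real.exp (δ / 2 * t))).ae_eq (ae_of_all _ fun ω => ?_)
  simp only [discounted]
  rw [← mul_assoc, ← Real.exp_add]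
  ring_nf
  simp

/-- The backward process represents the adjoint of integration in time. -/
theorem IsBackward.toSpace_eq (hb : IsBackward P F δ y g) (hy : MemL2 P F δ y)
    (hg : MemL2 P F δ g) : hy.toSpace = (integrationOp P F δ).adjoint hg.toSpace := by
  refine ext_inner_left ℝ fun w => ?_
  obtain ⟨X, hX, rfl⟩ := exists_toSpace_eq δ w
  have hswap := integral_integral_swap (f := fun t ω => X t ω * remaining δ g t ω)
    (hX.integrable_mul_remaining hg)
  rw [ContinuousLinearMap.adjoint_inner_right, hX.integrationOp_toSpace, hX.inner_toSpace hy,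
    hX.integral.inner_toSpace' hg, integral_prod _ (hX.integrable_mul hy),
    integral_congr_ae (hX.ae_integral_position_mul hg),
    ← hswap]
  refine integral_congr_ae ?_
  filter_upwards [hX.ae_memLp] with t hXt
  have hR := hg.memLp_remaining t
  -- Because `X t` is `F t`-measurable, the remaining integral may be replaced by its conditional
  -- expectation, which is the backward process up to `e^{δ t}`.
  rw [← integral_mul_condExp (F.le t) (hX.1.stronglyAdapted t).aestronglyMeasurable
    (hXt.integrable_mul hR) (hR.integrable one_le_two)]
  refine integral_congr_ae ?_
  filter_upwards [hb t] with ω hω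
  rw [hω]
  have : Real.exp (-δ * t) * Real.exp (δ * t) = 1 := by
    rw [← Real.exp_add]; ring_nf; exact Real.exp_zero
  linear_combination (X t ω * (P[remaining δ g t | F t]) ω) * this

end Backward

/-! ### A product rule on the time set. -/

section Deterministic

variable {T : ℝ≥0∞}

theorem setIntegral_Ioc_timeMeasure {s t : Time T} (h : s ≤ t) (f : ℝ → ℝ) :
    ∫ r in Set.Ioc s t, f r ∂(timeMeasure T) = ∫ x in (s : ℝ)..t, f x := by
  have h1 := (measurableEmbedding_time T).setIntegral_map (μ := timeMeasure T) f
    (Set.Ioc (s : ℝ) t)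
  rw [map_timeMeasure, Measure.restrict_restrict measurableSet_Ioc,
    Set.inter_eq_left.2 fun x hx => t.mem_of_le (s.coe_nonneg.trans hx.1.le) hx.2] at h1
  rw [intervalIntegral.integral_of_le (by exact h), h1]
  rfl

theorem setIntegral_Ioc_exp {s t : Time T} (h : s ≤ t) (a : ℝ) :
    ∫ r in Set.Ioc s t, a * Real.exp (a * r) ∂(timeMeasure T)
      = Real.exp (a * t) - Real.exp (a * s) := by
  rw [setIntegral_Ioc_timeMeasure h (fun r => a * Real.exp (a * r))]
  refine intervalIntegral.integral_eq_sub_of_hasDerivAt (f := fun x => Real.exp (a * x))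
    (fun x _ => ?_) (Continuous.intervalIntegrable (by fun_prop) _ _)
  have := ((hasDerivAt_id x).const_mul a).exp
  simpa [mul_comm] using this

theorem setIntegral_Iic_sub {s t : Time T} (h : s ≤ t) {f : Time T → ℝ}
    (hf : IntegrableOn f (Set.Iic t) (timeMeasure T)) :
    ∫ r in Set.Iic t, f r ∂(timeMeasure T) - ∫ r in Set.Iic s, f r ∂(timeMeasure T)
      = ∫ r in Set.Ioc s t, f r ∂(timeMeasure T) := by
  rw [← Set.Iic_union_Ioc_eq_Iic h, setIntegral_union (Set.Iic_disjoint_Ioc le_rfl)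
    measurableSet_Ioc (hf.mono_set (Set.Iic_subset_Iic.2 h))
    (hf.mono_set Set.Ioc_subset_Iic_self)]
  ring

theorem setIntegral_Ioi_sub {s t : Time T} (h : s ≤ t) {f : Time T → ℝ}
    (hf : Integrable f (timeMeasure T)) :
    ∫ r in Set.Ioi s, f r ∂(timeMeasure T) - ∫ r in Set.Ioi t, f r ∂(timeMeasure T)
      = ∫ r in Set.Ioc s t, f r ∂(timeMeasure T) := by
  rw [← Set.Ioc_union_Ioi_eq_Ioi h, setIntegral_union (Set.Ioc_disjoint_Ioi le_rfl)
    measurableSet_Ioi hf.integrableOn hf.integrableOn]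
  ring

/-- The product rule for an absolutely continuous function and an exponential. -/
theorem exp_mul_add_setIntegral {s t : Time T} (h : s ≤ t) {k : Time T → ℝ}
    (hk : IntegrableOn k (Set.Ioc s t) (timeMeasure T)) (a c : ℝ) {f : Time T → ℝ}
    (hf : ∀ r, s ≤ r → r ≤ t → f r = c + ∫ q in Set.Ioc s r, k q ∂(timeMeasure T)) :
    Real.exp (a * t) * f t = Real.exp (a * s) * c +
      ∫ r in Set.Ioc s t, Real.exp (a * r) * (k r + a * f r) ∂(timeMeasure T) := by
  set ν := (timeMeasure T).restrict (Set.Ioc s t) with hν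
  have hfin : IsFiniteMeasure ν :=
    ⟨by rw [hν, Measure.restrict_apply_univ, timeMeasure_Ioc]; exact ENNReal.ofReal_lt_top⟩
  have hbd : ∀ a : ℝ, ∃ C, ∀ᵐ r : Time T ∂ν, ‖Real.exp (a * r)‖ ≤ C := fun a => by
    refine ⟨Real.exp (|a| * t), ?_⟩
    filter_upwards [ae_restrict_mem measurableSet_Ioc] with r hr
    rw [Real.norm_eq_abs, Real.abs_exp, Real.exp_le_exp]
    have h1 : (r : ℝ) ≤ t := hr.2
    calc a * r ≤ |a| * r := mul_le_mul_of_nonneg_right (le_abs_self a) r.coe_nonneg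
      _ ≤ _ := by gcongr
  have hexp : ∀ a : ℝ, AEStronglyMeasurable (fun r : Time T => Real.exp (a * r)) ν := fun a =>
    (by fun_prop : Measurable fun r : Time T => Real.exp (a * r)).aestronglyMeasurable
  have hek : Integrable (fun r : Time T => Real.exp (a * r) * k r) ν := by
    obtain ⟨C, hC⟩ := hbd a
    exact Integrable.bdd_mul hk (hexp a) hC
  have hea : Integrable (fun r : Time T => a * Real.exp (a * r)) ν := by
    obtain ⟨C, hC⟩ := hbd a
    exact (Integrable.of_bound (hexp a) C hC).const_mul a
  have hkk : Integrable (fun z : Time T × Time T => a * Real.exp (a * z.1) * k z.2) (ν.prod ν) :=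
    hea.mul_prod hk
  have hS : MeasurableSet {q : Time T × Time T | q.2 ≤ q.1} :=
    measurableSet_le measurable_snd measurable_fst
  -- The function `f` is only absolutely continuous, so the product rule comes from Fubini on the
  -- triangle `q ≤ r`: integrating `a e^{a r}` over `[q, t]` produces the boundary terms.
  set G : Time T → Time T → ℝ := fun r q =>
    {q : Time T × Time T | q.2 ≤ q.1}.indicator (fun z => a * Real.exp (a * z.1) * k z.2) (r, q)
    with hG
  have hGi : Integrable (Function.uncurry G) (ν.prod ν) := hkk.indicator hS
  have hswap := integral_integral_swap hGi
  have e1 : ∀ r ∈ Set.Ioc s t, ∫ q, G r q ∂ν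
      = a * Real.exp (a * r) * ∫ q in Set.Ioc s r, k q ∂(timeMeasure T) := by
    intro r hr
    have : ∀ q, G r q = (Set.Iic r).indicator (fun q => a * Real.exp (a * r) * k q) q :=
      fun q => rfl
    simp_rw [this]
    rw [hν, setIntegral_indicator measurableSet_Iic, Set.Ioc_inter_Iic, min_eq_right hr.2,
      integral_const_mul]
  have e2 : ∀ q ∈ Set.Ioc s t, ∫ r, G r q ∂ν
      = (Real.exp (a * t) - Real.exp (a * q)) * k q := by
    intro q hq
    have : ∀ r, G r q = (Set.Ici q).indicator (fun r : Time T => a * Real.exp (a * r) * k q) r :=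
      fun r => rfl
    simp_rw [this]
    rw [hν, setIntegral_indicator measurableSet_Ici]
    have : Set.Ioc s t ∩ Set.Ici q = Set.Icc q t := by
      ext x
      simp only [Set.mem_inter_iff, Set.mem_Ioc, Set.mem_Ici, Set.mem_Icc]
      constructor
      · rintro ⟨⟨-, h2⟩, h3⟩
        exact ⟨h3, h2⟩
      · rintro ⟨h3, h2⟩
        exact ⟨⟨hq.1.trans_le h3, h2⟩, h3⟩
    rw [this, integral_Icc_eq_integral_Ioc, integral_mul_const, setIntegral_Ioc_exp hq.2]
  rw [setIntegral_congr_fun measurableSet_Ioc e1, setIntegral_congr_fun measurableSet_Ioc e2]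
    at hswap
  have e3 : ∀ r ∈ Set.Ioc s t, Real.exp (a * r) * (k r + a * f r)
      = Real.exp (a * r) * k r + (a * Real.exp (a * r) * c
        + a * Real.exp (a * r) * ∫ q in Set.Ioc s r, k q ∂(timeMeasure T)) := by
    intro r hr
    rw [hf r hr.1.le hr.2]
    ring
  have i2 : Integrable (fun r : Time T =>
      a * Real.exp (a * r) * ∫ q in Set.Ioc s r, k q ∂(timeMeasure T)) ν := by
    refine hGi.integral_prod_left.congr ?_
    filter_upwards [ae_restrict_mem measurableSet_Ioc] with r hr
    exact e1 r hr
  have i3 : Integrable (fun r : Time T => a * Real.exp (a * r) * c) ν := hea.mul_const c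
  have i4 : Integrable (fun r : Time T => a * Real.exp (a * r) * c +
      a * Real.exp (a * r) * ∫ q in Set.Ioc s r, k q ∂(timeMeasure T)) ν := i3.add i2
  rw [setIntegral_congr_fun measurableSet_Ioc e3, integral_add hek i4,
    integral_add i3 i2, hswap, hf t h le_rfl, integral_mul_const, setIntegral_Ioc_exp h]
  have e4 : ∫ q in Set.Ioc s t, (Real.exp (a * t) - Real.exp (a * q)) * k q ∂(timeMeasure T)
      = Real.exp (a * t) * ∫ q in Set.Ioc s t, k q ∂(timeMeasure T)
        - ∫ q in Set.Ioc s t, Real.exp (a * q) * k q ∂(timeMeasure T) := by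
    simp_rw [sub_mul]
    rw [integral_sub (Integrable.const_mul hk _) hek, integral_const_mul]
  rw [e4]
  ring

end Deterministic

/-! ### Equivalence of the backward equation and the conditional expectation formula. -/

section BackwardEquation

variable {Ω : Type*} {mΩ : MeasurableSpace Ω} {P : Measure Ω} [IsProbabilityMeasure P] {T : ℝ≥0∞}
  {F : Filtration (Time T) mΩ} {δ : ℝ} {X Y y g h : Time T → Ω → ℝ}

theorem exists_time_of_ae (hT : 0 < T) {p : Time T → Prop}
    (hp : ∀ᵐ t ∂(timeMeasure T), p t) : ∃ t, p t := by
  have : timeMeasure T ≠ 0 := by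
    intro h0
    have h1 : timeMeasure T Set.univ = volume (timeSet T) := by
      rw [timeMeasure, (measurableEmbedding_time T).comap_apply]
      simp
    have h2 : 0 < min T.toReal 1 ∨ T = ∞ := by
      by_cases h : T = ∞
      · exact Or.inr h
      · exact Or.inl (lt_min (ENNReal.toReal_pos hT.ne' h) one_pos)
    have h3 : ∃ x : ℝ, 0 < x ∧ x ∈ timeSet T := by
      rcases h2 with h2 | h2
      · by_cases h : T = ∞
        · exact ⟨1, one_pos, by simp [timeSet, h]⟩
        · exact ⟨_, h2, h2.le, (ENNReal.ofReal_le_iff_le_toReal h).2 (min_le_left _ _)⟩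
      · exact ⟨1, one_pos, by simp [timeSet, h2]⟩
    obtain ⟨x, hx, hxT⟩ := h3
    have h4 := timeMeasure_Iic (⟨x, hxT⟩ : Time T)
    rw [h0] at h4
    simp only [Measure.coe_zero, Pi.zero_apply] at h4
    exact absurd h4.symm (by simpa using hx)
  have := ae_neBot.2 this
  exact hp.exists

variable [hδ : Discount T δ]

theorem MemL2.position_sub (hh : MemL2 P F δ h) :
    ∀ᵐ ω ∂P, ∀ s t, s ≤ t → position h t ω - position h s ω
      = ∫ r in Set.Ioc s t, h r ω ∂(timeMeasure T) := by
  filter_upwards [hh.ae_integrableOn] with ω hω s t hst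
  exact setIntegral_Iic_sub hst (hω t)

theorem MemL2.remaining_sub (hg : MemL2 P F δ g) :
    ∀ᵐ ω ∂P, ∀ s t, s ≤ t → remaining δ g s ω - remaining δ g t ω
      = ∫ r in Set.Ioc s t, Real.exp (-δ * r) * g r ω ∂(timeMeasure T) := by
  filter_upwards [hg.ae_integrable_discount] with ω hω s t hst
  exact setIntegral_Ioi_sub hst hω

theorem MemL2.integrable_Ioc (hh : MemL2 P F δ h) (s t : Time T) (A : Set Ω) :
    Integrable (Function.uncurry h)
      (((timeMeasure T).restrict (Set.Ioc s t)).prod (P.restrict A)) :=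
  (hh.integrable_restrict t).mono_measure
    (Measure.prod_mono (Measure.restrict_mono Set.Ioc_subset_Iic_self le_rfl)
      Measure.restrict_le_self)

theorem MemL2.setIntegral_setIntegral (hh : MemL2 P F δ h) (s t : Time T) (A : Set Ω) :
    ∫ ω in A, ∫ r in Set.Ioc s t, h r ω ∂(timeMeasure T) ∂P
      = ∫ r in Set.Ioc s t, ∫ ω in A, h r ω ∂P ∂(timeMeasure T) :=
  (integral_integral_swap (hh.integrable_Ioc s t A)).symm

theorem MemL2.integrableOn_setIntegral (hh : MemL2 P F δ h) (s t : Time T) (A : Set Ω) :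
    IntegrableOn (fun r => ∫ ω in A, h r ω ∂P) (Set.Ioc s t) (timeMeasure T) :=
  (hh.integrable_Ioc s t A).integral_prod_left

theorem MemL2.integrable_position (hh : MemL2 P F δ h) (t : Time T) :
    Integrable (position h t) P := (hh.memLp_position t).integrable one_le_two

theorem MemL2.integrable_remaining (hg : MemL2 P F δ g) (t : Time T) :
    Integrable (remaining δ g t) P := (hg.memLp_remaining t).integrable one_le_two

theorem MemL2.setIntegral_position_sub (hh : MemL2 P F δ h) {s t : Time T} (hst : s ≤ t)
    (A : Set Ω) : ∫ ω in A, position h t ω ∂P - ∫ ω in A, position h s ω ∂P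
      = ∫ r in Set.Ioc s t, ∫ ω in A, h r ω ∂P ∂(timeMeasure T) := by
  rw [← hh.setIntegral_setIntegral, ← integral_sub (hh.integrable_position t).integrableOn
    (hh.integrable_position s).integrableOn]
  refine integral_congr_ae (ae_restrict_of_ae ?_)
  filter_upwards [hh.position_sub] with ω hω
  exact hω s t hst

theorem MemL2.setIntegral_remaining_sub (hg : MemL2 P F δ g) {s t : Time T} (hst : s ≤ t)
    (A : Set Ω) : ∫ ω in A, remaining δ g s ω ∂P - ∫ ω in A, remaining δ g t ω ∂P
      = ∫ r in Set.Ioc s t, Real.exp (-δ * r) * ∫ ω in A, g r ω ∂P ∂(timeMeasure T) := by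
  have h1 := hg.discount.setIntegral_setIntegral s t A
  simp_rw [integral_const_mul] at h1
  rw [← h1, ← integral_sub (hg.integrable_remaining s).integrableOn
    (hg.integrable_remaining t).integrableOn]
  refine integral_congr_ae (ae_restrict_of_ae ?_)
  filter_upwards [hg.remaining_sub] with ω hω
  exact hω s t hst

theorem MemL2.ae_setIntegral_drift (hy : MemL2 P F δ y) (hg : MemL2 P F δ g) (A : Set Ω) :
    ∀ᵐ r ∂(timeMeasure T), ∫ ω in A, (δ * y r ω - g r ω) ∂P
      = δ * ∫ ω in A, y r ω ∂P - ∫ ω in A, g r ω ∂P := by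
  filter_upwards [hy.ae_memLp, hg.ae_memLp] with r h1 h2
  rw [integral_sub ((h1.integrable one_le_two).const_mul δ).integrableOn
    (h2.integrable one_le_two).integrableOn, integral_const_mul]

theorem IsBackward.memLp (hb : IsBackward P F δ y g) (hg : MemL2 P F δ g) (t : Time T) :
    MemLp (y t) 2 P :=
  (((hg.memLp_remaining t).condExp one_le_two).const_mul (Real.exp (δ * t))).ae_eq (hb t).symm

theorem IsBackward.setIntegral (hb : IsBackward P F δ y g) (hg : MemL2 P F δ g) (t : Time T)
    {A : Set Ω} (hA : MeasurableSet[F t] A) :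
    ∫ ω in A, y t ω ∂P = Real.exp (δ * t) * ∫ ω in A, remaining δ g t ω ∂P := by
  rw [← setIntegral_condExp (F.le t) (hg.integrable_remaining t) hA, ← integral_const_mul]
  exact integral_congr_ae (ae_restrict_of_ae (hb t))

/-- A square-integrable backward process solves a backward stochastic differential equation. -/
theorem IsBackward.martingale (hb : IsBackward P F δ y g) (hy : MemL2 P F δ y)
    (hg : MemL2 P F δ g) :
    Martingale (fun t ω => y t ω - position (fun s ω => δ * y s ω - g s ω) t ω) F P := by
  have hd : MemL2 P F δ fun s ω => δ * y s ω - g s ω := (hy.const_mul δ).sub hg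
  have hyi : ∀ t, Integrable (y t) P := fun t => (hb.memLp hg t).integrable one_le_two
  have hMi : ∀ t, Integrable (fun ω => y t ω - position (fun s ω => δ * y s ω - g s ω) t ω) P :=
    fun t => (hyi t).sub (hd.integrable_position t)
  have hMa : StronglyAdapted F
      fun t ω => y t ω - position (fun s ω => δ * y s ω - g s ω) t ω :=
    fun t => (hy.1.stronglyAdapted t).sub (hd.integral.1.stronglyAdapted t)
  refine ⟨hMa, fun s t hst => ?_⟩
  refine (ae_eq_condExp_of_forall_setIntegral_eq (F.le s) (hMi t)
    (fun A _ _ => (hMi s).integrableOn) (fun A hA _ => ?_)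
    (hMa s).aestronglyMeasurable).symm
  rw [integral_sub (hyi s).integrableOn (hd.integrable_position s).integrableOn,
    integral_sub (hyi t).integrableOn (hd.integrable_position t).integrableOn]
  have h1 := hd.setIntegral_position_sub hst A
  -- Integration over a fixed `A` in `F s` turns the martingale property into a linear equation for
  -- `r ↦ E[y_r; A]`, `r ≥ s`. The factor `e^{δ r}` converts remaining integrals into `y`.
  have h2 := exp_mul_add_setIntegral hst
    (k := fun r => -(Real.exp (-δ * r) * ∫ ω in A, g r ω ∂P))
    (f := fun r => ∫ ω in A, remaining δ g r ω ∂P) (by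
      have := (hg.discount.integrableOn_setIntegral s t A).neg
      simp_rw [integral_const_mul] at this
      exact this) δ
    (∫ ω in A, remaining δ g s ω ∂P) (fun r hr _ => by
      rw [integral_neg, ← hg.setIntegral_remaining_sub hr]
      ring)
  rw [← hb.setIntegral hg t (F.mono hst _ hA), ← hb.setIntegral hg s hA] at h2
  have h3 : ∫ r in Set.Ioc s t, ∫ ω in A, (δ * y r ω - g r ω) ∂P ∂(timeMeasure T) =
      ∫ r in Set.Ioc s t, Real.exp (δ * r) * (-(Real.exp (-δ * r) * ∫ ω in A, g r ω ∂P)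
        + δ * ∫ ω in A, remaining δ g r ω ∂P) ∂(timeMeasure T) := by
    refine integral_congr_ae ?_
    filter_upwards [ae_restrict_mem measurableSet_Ioc,
      ae_restrict_of_ae (hy.ae_setIntegral_drift hg A)] with r hr hr2
    rw [hr2, hb.setIntegral hg r (F.mono hr.1.le _ hA)]
    have : Real.exp (δ * r) * Real.exp (-δ * r) = 1 := by
      rw [← Real.exp_add]; ring_nf; exact Real.exp_zero
    linear_combination (∫ ω in A, g r ω ∂P) * this
  linarith

/-- The solution of a backward stochastic differential equation is the backward process. -/
theorem isBackward_of_martingale (hy : MemL2 P F δ y) (hg : MemL2 P F δ g)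
    {M : Time T → Ω → ℝ} (hM : Martingale M F P)
    (heq : ∀ t, ∀ᵐ ω ∂P, y t ω = y ⊥ ω + (M t ω - M ⊥ ω)
      + position (fun s ω => δ * y s ω - g s ω) t ω)
    (hterm : ∀ t : Time T, ENNReal.ofReal t = T → y t =ᵐ[P] 0) : IsBackward P F δ y g := by
  have hd : MemL2 P F δ fun s ω => δ * y s ω - g s ω := (hy.const_mul δ).sub hg
  have hMi : ∀ t, Integrable (fun ω => M t ω - M ⊥ ω) P :=
    fun t => (hM.integrable t).sub (hM.integrable ⊥)
  -- Membership in `L²_δ` controls `y` only at almost all times. One good time and the equation give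
  -- integrability at the initial time, and then at all times.
  have hy0 : Integrable (y ⊥) P := by
    obtain ⟨t, ht⟩ := exists_time_of_ae hδ.horizon_pos hy.ae_memLp
    refine (((ht.integrable one_le_two).sub (hMi t)).sub (hd.integrable_position t)).congr ?_
    filter_upwards [heq t] with ω hω
    simp only [Pi.sub_apply, hω]
    ring
  have hyi : ∀ t, Integrable (y t) P := fun t =>
    (((hy0.add (hMi t)).add (hd.integrable_position t))).congr
      ((heq t).mono fun ω hω => hω.symm)
  -- For `A` in `F s` the discounted difference between `y` and the candidate, integrated over `A`,
  -- does not depend on the time after `s`. It remains to see that this constant is zero.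
  have hinv : ∀ s t, s ≤ t → ∀ A, MeasurableSet[F s] A →
      Real.exp (-δ * s) * ∫ ω in A, y s ω ∂P - ∫ ω in A, remaining δ g s ω ∂P
        = Real.exp (-δ * t) * ∫ ω in A, y t ω ∂P - ∫ ω in A, remaining δ g t ω ∂P := by
    intro s t hst A hA
    have hstep : ∀ r, s ≤ r → ∫ ω in A, y r ω ∂P = ∫ ω in A, y s ω ∂P +
        ∫ q in Set.Ioc s r, ∫ ω in A, (δ * y q ω - g q ω) ∂P ∂(timeMeasure T) := by
      intro r hr
      have e : ∀ t, ∫ ω in A, y t ω ∂P = ∫ ω in A, y ⊥ ω ∂P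
          + (∫ ω in A, M t ω ∂P - ∫ ω in A, M ⊥ ω ∂P)
          + ∫ ω in A, position (fun s ω => δ * y s ω - g s ω) t ω ∂P := fun t => by
        have i1 : Integrable (fun ω => y ⊥ ω + (M t ω - M ⊥ ω)) P := hy0.add (hMi t)
        rw [← integral_sub (hM.integrable t).integrableOn (hM.integrable ⊥).integrableOn,
          ← integral_add hy0.integrableOn (hMi t).integrableOn,
          ← integral_add i1.integrableOn (hd.integrable_position t).integrableOn]
        exact integral_congr_ae (ae_restrict_of_ae (heq t))
      rw [← hd.setIntegral_position_sub hr A, e r, e s, hM.setIntegral_eq hr hA]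
      ring
    have h2 := exp_mul_add_setIntegral hst (hd.integrableOn_setIntegral s t A) (-δ)
      (∫ ω in A, y s ω ∂P) (f := fun r => ∫ ω in A, y r ω ∂P) (fun r hr _ => hstep r hr)
    have h3 : ∫ r in Set.Ioc s t, Real.exp (-δ * r) * (∫ ω in A, (δ * y r ω - g r ω) ∂P
        + -δ * ∫ ω in A, y r ω ∂P) ∂(timeMeasure T)
        = - ∫ r in Set.Ioc s t, Real.exp (-δ * r) * ∫ ω in A, g r ω ∂P ∂(timeMeasure T) := by
      rw [← integral_neg]
      refine integral_congr_ae (ae_restrict_of_ae ?_)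
      filter_upwards [hy.ae_setIntegral_drift hg A] with r hr
      rw [hr]
      ring
    rw [h3, ← hg.setIntegral_remaining_sub hst A] at h2
    linarith
  have hzero : ∀ s A, MeasurableSet[F s] A →
      Real.exp (-δ * s) * ∫ ω in A, y s ω ∂P = ∫ ω in A, remaining δ g s ω ∂P := by
    intro s A hA
    by_cases hT : T = ∞
    -- Infinite horizon: the constant square `κ ^ 2` is dominated on `[s, ∞)` by a function that is
    -- integrable because `y` and `g` belong to `L²_δ`. As the half-line has infinite measure, `κ =
    -- 0`; this replaces a transversality condition.
    · set κ := Real.exp (-δ * s) * ∫ ω in A, y s ω ∂P - ∫ ω in A, remaining δ g s ω ∂P with hκ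
      have hi : Integrable (fun t : Time T => 2 * (∫ ω, discounted δ y (t, ω) ^ 2 ∂P) +
          2 * ∫ ω, (Real.exp (δ / 2 * t) * remaining δ g t ω) ^ 2 ∂P) (timeMeasure T) :=
        (hy.memLp.integrable_sq.integral_prod_left.const_mul 2).add
          (hg.memLp_exp_remaining.integrable_sq.integral_prod_left.const_mul 2)
      have hbd : ∀ᵐ t ∂((timeMeasure T).restrict (Set.Ici s)), κ ^ 2 ≤
          2 * (∫ ω, discounted δ y (t, ω) ^ 2 ∂P) +
          2 * ∫ ω, (Real.exp (δ / 2 * t) * remaining δ g t ω) ^ 2 ∂P := by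
        filter_upwards [ae_restrict_mem measurableSet_Ici, ae_restrict_of_ae hy.ae_memLp]
          with t ht hyt
        have hR := hg.memLp_remaining t
        have h1 : κ = ∫ ω in A, (Real.exp (-δ * t) * y t ω - remaining δ g t ω) ∂P := by
          rw [hκ, hinv s t ht A hA, integral_sub ((hyi t).const_mul _).integrableOn
            (hg.integrable_remaining t).integrableOn, integral_const_mul]
        have hL : MemLp (fun ω => Real.exp (-δ * t) * y t ω - remaining δ g t ω) 2 P :=
          (hyt.const_mul _).sub hR
        have h2 : κ ^ 2 ≤ ∫ ω, (Real.exp (-δ * t) * y t ω - remaining δ g t ω) ^ 2 ∂P := by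
          rw [h1, ← integral_indicator (F.le s A hA)]
          have hLA := hL.indicator (F.le s A hA)
          -- Nonnegativity of the variance is the form of Jensen's inequality used here: the squared
          -- mean is at most the mean of the square.
          have hv := variance_nonneg (A.indicator fun ω =>
            Real.exp (-δ * t) * y t ω - remaining δ g t ω) P
          rw [variance_eq_sub hLA] at hv
          refine (sub_nonneg.1 hv).trans (integral_mono hLA.integrable_sq hL.integrable_sq
            fun ω => ?_)
          simp only [Pi.pow_apply]
          by_cases h : ω ∈ A
          · rw [Set.indicator_of_mem h]
          · rw [Set.indicator_of_notMem h, zero_pow two_ne_zero]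
            exact sq_nonneg _
        refine h2.trans ?_
        have i1 : Integrable (fun ω => discounted δ y (t, ω) ^ 2) P :=
          (hyt.const_mul (Real.exp (-δ / 2 * t))).integrable_sq
        have i2 : Integrable (fun ω => (Real.exp (δ / 2 * t) * remaining δ g t ω) ^ 2) P :=
          (hR.const_mul (Real.exp (δ / 2 * t))).integrable_sq
        rw [← integral_const_mul, ← integral_const_mul,
          ← integral_add (i1.const_mul 2) (i2.const_mul 2)]
        refine integral_mono hL.integrable_sq ((i1.const_mul 2).add (i2.const_mul 2)) fun ω => ?_
        have hx1 : Real.exp (-δ / 2 * t) ≤ 1 := by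
          rw [Real.exp_le_one_iff]
          have := hδ.nonneg
          have := t.coe_nonneg
          nlinarith
        have hx2 : 1 ≤ Real.exp (δ / 2 * t) := by
          rw [Real.one_le_exp_iff]
          have := hδ.nonneg
          have := t.coe_nonneg
          positivity
        have e1 : Real.exp (-δ * t) * y t ω = Real.exp (-δ / 2 * t) * discounted δ y (t, ω) := by
          rw [discounted, ← mul_assoc, ← Real.exp_add]
          ring_nf
        simp only [e1, discounted]
        have hp := Real.exp_pos (-δ / 2 * t)
        set u := Real.exp (-δ / 2 * t)
        set v := Real.exp (δ / 2 * t)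
        have h4 : (u * (u * y t ω)) ^ 2 ≤ (u * y t ω) ^ 2 := by
          rw [mul_pow u]
          exact mul_le_of_le_one_left (sq_nonneg _) (pow_le_one₀ hp.le hx1)
        have h5 : (remaining δ g t ω) ^ 2 ≤ (v * remaining δ g t ω) ^ 2 := by
          rw [mul_pow v]
          exact le_mul_of_one_le_left (sq_nonneg _) (one_le_pow₀ hx2)
        nlinarith [sq_nonneg (u * (u * y t ω) + remaining δ g t ω)]
      have hc : IntegrableOn (fun _ : Time T => κ ^ 2) (Set.Ici s) (timeMeasure T) := by
        refine (hi.integrableOn (s := Set.Ici s)).mono' aestronglyMeasurable_const ?_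
        filter_upwards [hbd] with t ht
        rwa [Real.norm_of_nonneg (sq_nonneg κ)]
      have htop : timeMeasure T (Set.Ici s) = ∞ := by
        by_contra hne
        obtain ⟨n, hn⟩ := ENNReal.exists_nat_gt hne
        have hm : (s : ℝ) + n ∈ timeSet T :=
          ⟨add_nonneg s.coe_nonneg n.cast_nonneg, le_of_le_of_eq le_top hT.symm⟩
        have h1 := timeMeasure_Ioc s (⟨(s : ℝ) + n, hm⟩ : Time T)
        have h2 := measure_mono (μ := timeMeasure T)
          (fun r (hr : r ∈ Set.Ioc s (⟨(s : ℝ) + n, hm⟩ : Time T)) => (hr.1.le : r ∈ Set.Ici s))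
        rw [h1, add_sub_cancel_left, ENNReal.ofReal_natCast] at h2
        exact absurd hn (not_lt.2 h2)
      rw [integrableOn_const_iff] at hc
      rcases hc with hc | hc
      · have : κ = 0 := pow_eq_zero_iff two_ne_zero |>.1 (enorm_eq_zero.1 hc)
        linarith
      · exact absurd hc (by rw [htop]; simp)
    -- Finite horizon: at `t = T` both the process and the remaining integral vanish.
    · have hm : T.toReal ∈ timeSet T := ⟨ENNReal.toReal_nonneg, by rw [ENNReal.ofReal_toReal hT]⟩
      set t : Time T := ⟨T.toReal, hm⟩ with ht
      have htop : ∀ r : Time T, r ≤ t := fun r =>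
        (ENNReal.ofReal_le_iff_le_toReal hT).1 r.2.2
      have h1 := hinv s t (htop s) A hA
      have h2 : ∫ ω in A, y t ω ∂P = 0 := by
        rw [integral_congr_ae (ae_restrict_of_ae (hterm t (ENNReal.ofReal_toReal hT)))]
        simp
      have h3 : ∀ ω, remaining δ g t ω = 0 := fun ω => by
        have : Set.Ioi t = ∅ := Set.eq_empty_of_forall_notMem fun r hr =>
          absurd (htop r) (not_le.2 hr)
        rw [remaining, this]
        simp
      rw [h2] at h1
      simp only [h3, mul_zero, integral_zero, sub_zero] at h1
      linarith
  intro s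
  have h1 : (fun ω => Real.exp (-δ * s) * y s ω) =ᵐ[P] P[remaining δ g s | F s] := by
    refine ae_eq_condExp_of_forall_setIntegral_eq (F.le s) (hg.integrable_remaining s)
      (fun A _ _ => ((hyi s).const_mul _).integrableOn) (fun A hA _ => ?_)
      ((hy.1.stronglyAdapted s).const_mul _).aestronglyMeasurable
    rw [integral_const_mul, hzero s A hA]
  filter_upwards [h1] with ω hω
  rw [← hω, ← mul_assoc, ← Real.exp_add]
  ring_nf
  simp

end BackwardEquation

/-! ### Absolutely continuous functions on the time set. -/

section Deterministic

variable {T : ℝ≥0∞}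

theorem continuous_setIntegral_Iic {f : Time T → ℝ}
    (hf : ∀ t, IntegrableOn f (Set.Iic t) (timeMeasure T)) :
    Continuous fun t => ∫ r in Set.Iic t, f r ∂(timeMeasure T) := by
  refine continuous_iff_continuousAt.2 fun t => ?_
  obtain ⟨b, hb⟩ : ∃ b : Time T, ∀ᶠ x in 𝓝 t, x ≤ b := by
    by_cases h : IsTop t
    · exact ⟨t, Eventually.of_forall h⟩
    · simp only [IsTop, not_forall, not_le] at h
      obtain ⟨b, hb⟩ := h
      exact ⟨b, Filter.mem_of_superset (Iio_mem_nhds hb) fun x hx => Set.mem_Iic.2 (Set.mem_Iio.1 hx).le⟩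
  simp_rw [← integral_indicator (measurableSet_Iic)]
  refine continuousAt_of_dominated (bound := (Set.Iic b).indicator fun r => ‖f r‖) ?_ ?_ ?_ ?_
  · exact Eventually.of_forall fun x =>
      ((integrable_indicator_iff measurableSet_Iic).2 (hf x)).aestronglyMeasurable
  · filter_upwards [hb] with x hx
    refine ae_of_all _ fun r => ?_
    rw [norm_indicator_eq_indicator_norm]
    exact Set.indicator_le_indicator_of_subset (Set.Iic_subset_Iic.2 hx)
      (fun _ => norm_nonneg _) r
  · exact (integrable_indicator_iff measurableSet_Iic).2 (hf b).norm
  · have : ∀ᵐ r ∂(timeMeasure T), r ≠ t := by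
      simp [ae_iff]
    filter_upwards [this] with r hr
    rcases lt_or_gt_of_ne hr with h | h
    · refine (continuousAt_const (y := f r)).congr ?_
      filter_upwards [Ioi_mem_nhds h] with x hx
      exact (Set.indicator_of_mem (Set.mem_Iic.2 (Set.mem_Ioi.1 hx).le) _).symm
    · refine (continuousAt_const (y := (0 : ℝ))).congr ?_
      filter_upwards [Iio_mem_nhds h] with x hx
      exact (Set.indicator_of_notMem (fun h' => not_lt.2 (Set.mem_Iic.1 h') hx) _).symm

/-- On `[0, t]` the positive and negative parts of `f` are densities of finite measures that agree
on all half-lines. Hence the measures, and then the densities, coincide. -/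
theorem ae_eq_zero_of_setIntegral_Iic {f : Time T → ℝ}
    (hf : ∀ t, IntegrableOn f (Set.Iic t) (timeMeasure T))
    (h0 : ∀ t, ∫ r in Set.Iic t, f r ∂(timeMeasure T) = 0) : f =ᵐ[timeMeasure T] 0 := by
  suffices h : ∀ t, ∀ᵐ r ∂((timeMeasure T).restrict (Set.Iic t)), f r = 0 by
    have h2 : ∀ᵐ r ∂(timeMeasure T), ∀ n, r ∈ Set.Iic (Time.exhaust T n) → f r = 0 :=
      ae_all_iff.2 fun n => (ae_restrict_iff' measurableSet_Iic).1 (h _)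
    filter_upwards [h2] with r hr
    obtain ⟨n, hn⟩ := Time.exists_le_exhaust r
    exact hr n hn
  intro t
  have hfi := hf t
  set ν := (timeMeasure T).restrict (Set.Iic t) with hν
  have hpos : Integrable (fun r => max (f r) 0) ν := hfi.pos_part
  have hneg : Integrable (fun r => max (-f r) 0) ν := hfi.neg_part
  have hlt : ∫⁻ r, ENNReal.ofReal (f r) ∂ν ≠ ∞ := by
    refine (lintegral_mono fun r => ?_).trans_lt hfi.2 |>.ne
    exact Real.ofReal_le_enorm _
  have hfin : IsFiniteMeasure (ν.withDensity fun r => ENNReal.ofReal (f r)) :=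
    isFiniteMeasure_withDensity hlt
  have key : ν.withDensity (fun r => ENNReal.ofReal (f r))
      = ν.withDensity fun r => ENNReal.ofReal (-f r) := by
    refine Measure.ext_of_Iic _ _ fun a => ?_
    rw [withDensity_apply _ measurableSet_Iic, withDensity_apply _ measurableSet_Iic]
    have hia : Integrable f (ν.restrict (Set.Iic a)) := Integrable.mono_measure hfi
      Measure.restrict_le_self
    have hr : ν.restrict (Set.Iic a) = (timeMeasure T).restrict (Set.Iic (min a t)) := by
      rw [hν, Measure.restrict_restrict measurableSet_Iic, Set.Iic_inter_Iic]
    have h1 := integral_eq_lintegral_pos_part_sub_lintegral_neg_part (f := f)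
      (μ := ν.restrict (Set.Iic a)) hia
    rw [hr, h0, ← hr] at h1
    refine (ENNReal.toReal_eq_toReal_iff' ?_ ?_).1 (sub_eq_zero.1 h1.symm)
    · exact ((lintegral_mono fun r => Real.ofReal_le_enorm _).trans_lt hia.2).ne
    · exact ((lintegral_mono fun r => Real.ofReal_le_enorm _).trans_lt hia.neg.2).ne
  have h2 := (withDensity_eq_iff (by exact hfi.aestronglyMeasurable.aemeasurable.ennreal_ofReal)
    (by exact hfi.neg.aestronglyMeasurable.aemeasurable.ennreal_ofReal) hlt).1 key
  filter_upwards [h2] with r hr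
  rcases le_total (f r) 0 with h | h
  · rw [ENNReal.ofReal_of_nonpos h] at hr
    have := ENNReal.ofReal_eq_zero.1 hr.symm
    linarith
  · rw [ENNReal.ofReal_of_nonpos (neg_nonpos.2 h)] at hr
    have := ENNReal.ofReal_eq_zero.1 hr
    linarith

/-- The square is a double integral of a symmetric function over `[0, t]²`, and the two triangles
contribute equally. -/
theorem sq_setIntegral_Iic {t : Time T} {f : Time T → ℝ}
    (hf : IntegrableOn f (Set.Iic t) (timeMeasure T)) :
    (∫ r in Set.Iic t, f r ∂(timeMeasure T)) ^ 2
      = 2 * ∫ r in Set.Iic t, (∫ q in Set.Iic r, f q ∂(timeMeasure T)) * f r ∂(timeMeasure T) := by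
  set ν := (timeMeasure T).restrict (Set.Iic t) with hν
  have hff : Integrable (fun z : Time T × Time T => f z.1 * f z.2) (ν.prod ν) := hf.mul_prod hf
  have hS : MeasurableSet {q : Time T × Time T | q.2 ≤ q.1} :=
    measurableSet_le measurable_snd measurable_fst
  have hS' : MeasurableSet {q : Time T × Time T | q.1 < q.2} :=
    measurableSet_lt measurable_fst measurable_snd
  set G : Time T → Time T → ℝ := fun r q =>
    {q : Time T × Time T | q.2 ≤ q.1}.indicator (fun z => f z.1 * f z.2) (r, q) with hG
  set G' : Time T → Time T → ℝ := fun r q =>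
    {q : Time T × Time T | q.1 < q.2}.indicator (fun z => f z.1 * f z.2) (r, q) with hG'
  have hGi : Integrable (Function.uncurry G) (ν.prod ν) := hff.indicator hS
  have hGi' : Integrable (Function.uncurry G') (ν.prod ν) := hff.indicator hS'
  have hsum : ∀ r q, f r * f q = G r q + G' r q := by
    intro r q
    rcases le_or_gt q r with h | h
    · simp [hG, hG', h, not_lt.2 h]
    · simp [hG, hG', h, not_le.2 h]
  have e1 : ∀ r ∈ Set.Iic t, ∫ q, G r q ∂ν
      = (∫ q in Set.Iic r, f q ∂(timeMeasure T)) * f r := by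
    intro r hr
    have : ∀ q, G r q = (Set.Iic r).indicator (fun q => f r * f q) q := fun q => rfl
    simp_rw [this]
    rw [hν, setIntegral_indicator measurableSet_Iic, Set.Iic_inter_Iic, min_eq_right hr,
      integral_const_mul, mul_comm]
  have e2 : ∀ q ∈ Set.Iic t, ∫ r, G' r q ∂ν
      = (∫ q in Set.Iic q, f q ∂(timeMeasure T)) * f q := by
    intro q hq
    have : ∀ r, G' r q = (Set.Iio q).indicator (fun r => f r * f q) r := fun q => rfl
    simp_rw [this]
    have h3 : Set.Iic t ∩ Set.Iio q = Set.Iio q :=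
      Set.inter_eq_right.2 fun x hx => Set.mem_Iic.2 ((Set.mem_Iio.1 hx).le.trans hq)
    rw [hν, setIntegral_indicator measurableSet_Iio, h3, integral_mul_const,
      integral_Iic_eq_integral_Iio]
  have h1 : (∫ r, f r ∂ν) ^ 2 = ∫ r, ∫ q, f r * f q ∂ν ∂ν := by
    simp_rw [integral_const_mul, integral_mul_const]
    ring
  have h2 : ∫ r, ∫ q, f r * f q ∂ν ∂ν = ∫ r, ∫ q, G r q ∂ν ∂ν + ∫ r, ∫ q, G' r q ∂ν ∂ν := by
    refine Eq.trans ?_ (integral_add hGi.integral_prod_left hGi'.integral_prod_left)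
    refine integral_congr_ae ?_
    filter_upwards [hGi.prod_right_ae, hGi'.prod_right_ae] with r hr hr'
    simp_rw [hsum]
    exact integral_add hr hr'
  rw [h1, h2, integral_integral_swap hGi', setIntegral_congr_fun measurableSet_Iic e1,
    setIntegral_congr_fun measurableSet_Iic e2]
  ring

/-- The time set is convex with nonempty interior, hence contained in the closure of its interior,
so each nonempty relatively open set meets that interior. This lets statements at almost all times
reach all times by continuity or density. -/
theorem isOpenPosMeasure_timeMeasure (hT : 0 < T) : (timeMeasure T).IsOpenPosMeasure := by
  refine ⟨fun U hU hne h0 => ?_⟩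
  obtain ⟨V, hV, rfl⟩ := isOpen_induced_iff.1 hU
  obtain ⟨t, ht⟩ := hne
  rw [timeMeasure, (measurableEmbedding_time T).comap_apply, Subtype.image_preimage_coe] at h0
  obtain ⟨x, hx, hxT⟩ : ∃ x : ℝ, 0 < x ∧ x ∈ timeSet T := by
    by_cases h : T = ∞
    · exact ⟨1, one_pos, by simp [timeSet, h]⟩
    · exact ⟨T.toReal, ENNReal.toReal_pos hT.ne' h, ENNReal.toReal_nonneg,
        by rw [ENNReal.ofReal_toReal h]⟩
  have hsub : Set.Ioo 0 x ⊆ timeSet T := fun y hy =>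
    Time.mem_of_le (⟨x, hxT⟩ : Time T) hy.1.le hy.2.le
  have hint : (interior (timeSet T)).Nonempty :=
    ⟨x / 2, mem_interior.2 ⟨_, hsub, isOpen_Ioo, by constructor <;> linarith⟩⟩
  have hcl : (t : ℝ) ∈ closure (interior (timeSet T)) :=
    (Convex.closure_interior_eq_closure_of_nonempty_interior (𝕜 := ℝ)
      (timeSet_ordConnected T).convex hint).symm ▸ subset_closure t.2
  obtain ⟨y, hyV, hy⟩ := mem_closure_iff.1 hcl V hV ht
  have := (isOpen_interior.inter hV).measure_pos volume ⟨y, hy, hyV⟩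
  exact this.ne' (measure_mono_null (Set.inter_subset_inter_left _ interior_subset) h0)

end Deterministic

/-! ### Finite variation martingales. -/

section FiniteVariation

variable {Ω : Type*} {mΩ : MeasurableSpace Ω} {P : Measure Ω} [IsProbabilityMeasure P] {T : ℝ≥0∞}
  {F : Filtration (Time T) mΩ} {δ : ℝ} {k : Time T → Ω → ℝ}

theorem ae_ae_time_of_ae_ae {p : Time T → Ω → Prop}
    (hp : MeasurableSet {z : Time T × Ω | p z.1 z.2})
    (h : ∀ᵐ t ∂(timeMeasure T), ∀ᵐ ω ∂P, p t ω) : ∀ᵐ ω ∂P, ∀ᵐ t ∂(timeMeasure T), p t ω :=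
  (Measure.ae_ae_comm hp).1 h

theorem ae_prod_of_ae_ae {p : Time T → Ω → Prop}
    (hp : MeasurableSet {z : Time T × Ω | p z.1 z.2})
    (h : ∀ᵐ t ∂(timeMeasure T), ∀ᵐ ω ∂P, p t ω) :
    ∀ᵐ z ∂((timeMeasure T).prod P), p z.1 z.2 :=
  (Measure.ae_prod_iff_ae_ae hp).2 h

variable [hδ : Discount T δ]

theorem MemL2.ae_continuous_position (hk : MemL2 P F δ k) :
    ∀ᵐ ω ∂P, Continuous fun t => position k t ω := by
  filter_upwards [hk.ae_integrableOn] with ω hω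
  exact continuous_setIntegral_Iic hω

/-- A process of finite variation whose integral is a martingale vanishes. -/
theorem MemL2.ae_eq_zero_of_martingale_position (hk : MemL2 P F δ k)
    (hM : ∀ᵐ t ∂(timeMeasure T), ∀ᵐ s ∂(timeMeasure T), s < t →
      P[position k t | F s] =ᵐ[P] position k s) :
    ∀ᵐ z ∂((timeMeasure T).prod P), k z.1 z.2 = 0 := by
  have h0 : ∀ᵐ t ∂(timeMeasure T), ∀ᵐ ω ∂P, position k t ω = 0 := by
    filter_upwards [hM] with t ht
    have hKt := hk.memLp_position t
    have i1 : Integrable (fun z : Time T × Ω => position k t z.2 * k z.1 z.2)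
        (((timeMeasure T).restrict (Set.Iic t)).prod P) :=
      (hKt.comp_snd _).integrable_mul (hk.memLp_restrict t)
    have i2 : Integrable (fun z : Time T × Ω => position k z.1 z.2 * k z.1 z.2)
        (((timeMeasure T).restrict (Set.Iic t)).prod P) :=
      (hk.integral.memLp_restrict t).integrable_mul (hk.memLp_restrict t)
    -- With `K` the position, `E K_t²` is `E ∫ K_t k_s ds`, which by the martingale property equals
    -- `E ∫ K_s k_s ds`, which is half of `E K_t²`.
    have e1 : ∫ ω, position k t ω ^ 2 ∂P
        = ∫ s in Set.Iic t, ∫ ω, position k t ω * k s ω ∂P ∂(timeMeasure T) := by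
      rw [← integral_prod _ i1, integral_prod_symm _ i1]
      refine integral_congr_ae (ae_of_all _ fun ω => ?_)
      simp only [integral_const_mul]
      rw [sq]
      rfl
    have e2 : ∫ ω, position k t ω ^ 2 ∂P
        = 2 * ∫ s in Set.Iic t, ∫ ω, position k s ω * k s ω ∂P ∂(timeMeasure T) := by
      rw [← integral_prod _ i2, integral_prod_symm _ i2, ← integral_const_mul]
      refine integral_congr_ae ?_
      filter_upwards [hk.ae_integrableOn] with ω hω
      exact sq_setIntegral_Iic (hω t)
    have e3 : ∫ s in Set.Iic t, ∫ ω, position k t ω * k s ω ∂P ∂(timeMeasure T)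
        = ∫ s in Set.Iic t, ∫ ω, position k s ω * k s ω ∂P ∂(timeMeasure T) := by
      refine integral_congr_ae ?_
      rw [← restrict_Iio_eq_restrict_Iic]
      filter_upwards [ae_restrict_mem measurableSet_Iio, ae_restrict_of_ae ht,
        ae_restrict_of_ae hk.ae_memLp] with s hs h1 h2
      have h3 := integral_mul_condExp (F.le s) (P := P) (Y := k s) (g := position k t)
        (hk.1.stronglyAdapted s).aestronglyMeasurable (h2.integrable_mul hKt)
        (hk.integrable_position t)
      simp only [mul_comm _ (k s _)]
      rw [← h3]
      refine integral_congr_ae ?_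
      filter_upwards [h1 hs] with ω hω
      rw [hω]
    have e4 : ∫ ω, position k t ω ^ 2 ∂P = 0 := by linarith
    rw [integral_eq_zero_iff_of_nonneg (fun _ => sq_nonneg _) hKt.integrable_sq] at e4
    filter_upwards [e4] with ω hω
    exact pow_eq_zero_iff two_ne_zero |>.1 hω
  have h1 : ∀ᵐ ω ∂P, ∀ᵐ t ∂(timeMeasure T), position k t ω = 0 :=
    ae_ae_time_of_ae_ae (measurableSet_eq_fun hk.integral.1.measurable_uncurry measurable_const) h0
  have h2 : ∀ᵐ ω ∂P, ∀ᵐ t ∂(timeMeasure T), k t ω = 0 := by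
    filter_upwards [h1, hk.ae_integrableOn, hk.ae_continuous_position] with ω hω hi hc
    have := isOpenPosMeasure_timeMeasure hδ.horizon_pos
    refine ae_eq_zero_of_setIntegral_Iic hi fun t => ?_
    exact congrFun ((hc.ae_eq_iff_eq (timeMeasure T) continuous_const).1 hω) t
  refine ae_prod_of_ae_ae (p := fun t ω => k t ω = 0)
    (measurableSet_eq_fun hk.1.measurable_uncurry measurable_const) ?_
  exact (Measure.ae_ae_comm (p := fun t ω => k t ω = 0)
    (measurableSet_eq_fun hk.1.measurable_uncurry measurable_const)).2 h2

end FiniteVariation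

/-! ### Optional stopping along a grid of good times. -/

section OptionalStopping

variable {Ω : Type*} {mΩ : MeasurableSpace Ω} {P : Measure Ω} [IsProbabilityMeasure P] {T : ℝ≥0∞}
  {F : Filtration (Time T) mΩ}

/-- The first of the times `d 0, …, d (n - 1)` that is at least `τ`, or `t` if that is earlier. -/
noncomputable def gridTime (d : ℕ → Time T) (t : Time T) (τ : Ω → WithTop (Time T)) :
    ℕ → Ω → WithTop (Time T)
  | 0, _ => t
  | n + 1, ω => min (gridTime d t τ n ω) (if τ ω ≤ d n then (d n : WithTop (Time T)) else ⊤)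

theorem untopA_coe_time (t : Time T) : (t : WithTop (Time T)).untopA = t := rfl

variable {d : ℕ → Time T} {t : Time T} {τ : Ω → WithTop (Time T)}

theorem isStoppingTime_gridTime (hτ : IsStoppingTime F τ) (n : ℕ) :
    IsStoppingTime F (gridTime d t τ n) := by
  induction n with
  | zero => exact isStoppingTime_const F t
  | succ n ih =>
    refine ih.min fun r => ?_
    by_cases h : d n ≤ r
    · convert F.mono h _ (hτ (d n)) using 1
      ext ω
      by_cases hω : τ ω ≤ d n <;> simp [hω, h]
    · convert MeasurableSet.empty using 1
      ext ω
      by_cases hω : τ ω ≤ d n <;> simp [hω, h]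

theorem antitone_gridTime (ω : Ω) : Antitone fun n => gridTime d t τ n ω :=
  antitone_nat_of_succ_le fun _ => min_le_left _ _

theorem gridTime_le (n : ℕ) (ω : Ω) : gridTime d t τ n ω ≤ t :=
  antitone_gridTime ω (Nat.zero_le n)

theorem min_le_gridTime (n : ℕ) (ω : Ω) : min (t : WithTop (Time T)) (τ ω) ≤ gridTime d t τ n ω := by
  induction n with
  | zero => exact min_le_left _ _
  | succ n ih =>
    refine le_min ih ?_
    split_ifs with h
    · exact (min_le_right _ _).trans h
    · exact le_top

theorem exists_gridTime_eq (n : ℕ) (ω : Ω) :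
    ∃ r ∈ insert t (Set.range d), gridTime d t τ n ω = r := by
  induction n with
  | zero => exact ⟨t, Set.mem_insert _ _, rfl⟩
  | succ n ih =>
    obtain ⟨r, hr, h⟩ := ih
    by_cases hω : τ ω ≤ d n
    · rcases le_total r (d n) with h2 | h2
      · exact ⟨r, hr, by simp [gridTime, h, hω, h2]⟩
      · exact ⟨d n, Set.mem_insert_of_mem _ ⟨n, rfl⟩, by simp [gridTime, h, hω, h2]⟩
    · exact ⟨r, hr, by simp [gridTime, h, hω]⟩

theorem countable_range_gridTime (n : ℕ) : (Set.range (gridTime d t τ n)).Countable := by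
  refine (((Set.countable_range d).insert t).image
    (fun r : Time T => (r : WithTop (Time T)))).mono ?_
  rintro _ ⟨ω, rfl⟩
  obtain ⟨r, hr, h⟩ := exists_gridTime_eq (d := d) (t := t) (τ := τ) n ω
  exact ⟨r, hr, h.symm⟩

/-- The grid times decrease and stay above `t ∧ τ`. If `τ < t`, each `a > τ` is eventually passed,
because some `d n` lies strictly between `τ` and `a`. Approaching from the right is what
right-continuity of paths requires. -/
theorem tendsto_gridTime (hd : ∀ r q : Time T, r < q → ∃ n, r < d n ∧ d n < q) (ω : Ω) :
    Tendsto (fun n => (gridTime d t τ n ω).untopA) atTop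
      (𝓝[≥] (min (t : WithTop (Time T)) (τ ω)).untopA) := by
  obtain ⟨r, hr⟩ : ∃ r : Time T, min (t : WithTop (Time T)) (τ ω) = r :=
    ⟨_, (WithTop.coe_untop _ (ne_top_of_le_ne_top (WithTop.coe_ne_top (a := t))
      (min_le_left _ _))).symm⟩
  choose ρ _ hρ using fun n => exists_gridTime_eq (d := d) (t := t) (τ := τ) n ω
  simp_rw [hρ, hr, untopA_coe_time]
  have hge : ∀ n, r ≤ ρ n := fun n => by
    have := min_le_gridTime (d := d) (t := t) (τ := τ) n ω
    rw [hr, hρ] at this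
    exact_mod_cast this
  have hle : ∀ n, ρ n ≤ t := fun n => by
    have := gridTime_le (d := d) (t := t) (τ := τ) n ω
    rw [hρ] at this
    exact_mod_cast this
  have hanti : Antitone ρ := fun m n hmn => by
    have := antitone_gridTime (d := d) (t := t) (τ := τ) ω hmn
    simp only [hρ] at this
    exact_mod_cast this
  refine tendsto_nhdsWithin_iff.2 ⟨tendsto_order.2 ⟨fun a ha => ?_, fun a ha => ?_⟩,
    Eventually.of_forall hge⟩
  · exact Eventually.of_forall fun n => ha.trans_le (hge n)
  · by_cases hrt : r = t
    · exact Eventually.of_forall fun n => ((hle n).trans_eq hrt.symm).trans_lt ha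
    · have hτr : τ ω = r := by
        rcases min_choice (t : WithTop (Time T)) (τ ω) with h | h
        · rw [h] at hr
          exact absurd (WithTop.coe_injective hr).symm hrt
        · rw [← h, hr]
      obtain ⟨n, h1, h2⟩ := hd r a ha
      filter_upwards [eventually_ge_atTop (n + 1)] with m hm
      refine (hanti hm).trans_lt (lt_of_le_of_lt ?_ h2)
      have h3 : gridTime d t τ (n + 1) ω ≤ d n := by
        refine (min_le_right _ _).trans_eq (if_pos ?_)
        rw [hτr]
        exact_mod_cast h1.le
      rw [hρ] at h3
      exact_mod_cast h3

/-- An almost sure set of times is dense, so it contains a grid on which exceptional times are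
avoided altogether. -/
theorem exists_good_seq (hT : 0 < T) {p : Time T → Prop} (hp : ∀ᵐ r ∂(timeMeasure T), p r) :
    ∃ d : ℕ → Time T, (∀ n, p (d n)) ∧ ∀ r q : Time T, r < q → ∃ n, r < d n ∧ d n < q := by
  have := isOpenPosMeasure_timeMeasure hT
  have hdense : Dense {r | p r} := Measure.dense_of_ae hp
  obtain ⟨D, hDs, hDc, hDd⟩ := hdense.exists_countable_dense_subset
  have hDn : D.Nonempty := hDd.nonempty
  obtain ⟨d, rfl⟩ := hDc.exists_eq_range hDn
  refine ⟨d, fun n => hDs ⟨n, rfl⟩, fun r q hrq => ?_⟩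
  obtain ⟨x, hx⟩ : (Set.Ioo r q).Nonempty := Set.nonempty_Ioo.2 hrq
  obtain ⟨_, h1, ⟨n, rfl⟩⟩ := hDd.inter_open_nonempty _ isOpen_Ioo ⟨x, hx⟩
  exact ⟨n, h1⟩

/-- Optional stopping for a martingale that agrees with a right-continuous process at almost all
times. -/
theorem MeasureTheory.Martingale.setIntegral_stoppedProcess (hT : 0 < T) {L Y : Time T → Ω → ℝ}
    (hL : Martingale L F P)
    (hY : ∀ᵐ ω ∂P, ∀ r, ContinuousWithinAt (fun t => Y t ω) (Set.Ioi r) r)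
    (hLY : ∀ᵐ r ∂(timeMeasure T), Y r =ᵐ[P] L r) (hτ : IsStoppingTime F τ) (ht : Y t =ᵐ[P] L t) :
    Integrable (stoppedProcess Y τ t) P ∧ ∀ s < t, ∀ A, MeasurableSet[F s] A →
      ∫ ω in A ∩ {ω | s < τ ω}, stoppedProcess Y τ t ω ∂P
        = ∫ ω in A ∩ {ω | s < τ ω}, L t ω ∂P := by
  obtain ⟨d, hdp, hd⟩ := exists_good_seq hT hLY
  have hst := fun n => isStoppingTime_gridTime (F := F) (d := d) (t := t) hτ n
  -- A stopping time with countable range needs no path regularity of `L` for optional sampling, and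
  -- `Y` agrees with `L` simultaneously at the countably many possible values.
  have heq : ∀ n, P[L t | (hst n).measurableSpace] =ᵐ[P] stoppedValue Y (gridTime d t τ n) := by
    intro n
    refine (hL.stoppedValue_ae_eq_condExp_of_le_const_of_countable_range (hst n) (gridTime_le n)
      (countable_range_gridTime n)).symm.trans ?_
    filter_upwards [ae_all_iff.2 hdp, ht] with ω h1 h2
    obtain ⟨r, hr, h⟩ := exists_gridTime_eq (d := d) (t := t) (τ := τ) n ω
    rw [stoppedValue, stoppedValue, h, untopA_coe_time]
    rcases hr with rfl | ⟨m, rfl⟩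
    · exact h2.symm
    · exact (h1 m).symm
  -- Conditional expectations of one integrable variable are uniformly integrable, so the almost
  -- sure limit given by right-continuity is also a limit in `L¹`.
  have hUI : UniformIntegrable (fun n => stoppedValue Y (gridTime d t τ n)) 1 P :=
    ((hL.integrable t).uniformIntegrable_condExp fun n => (hst n).measurableSpace_le).ae_eq heq
  have hlim : ∀ᵐ ω ∂P, Tendsto (fun n => stoppedValue Y (gridTime d t τ n) ω) atTop
      (𝓝 (stoppedProcess Y τ t ω)) := by
    filter_upwards [hY] with ω hω
    exact ((continuousWithinAt_Ioi_iff_Ici.1 (hω _)).tendsto.comp (tendsto_gridTime hd ω))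
  have hint : Integrable (stoppedProcess Y τ t) P := hUI.integrable_of_ae_tendsto hlim
  refine ⟨hint, fun s hs A hA => ?_⟩
  have hL1 := tendsto_Lp_finite_of_tendsto_ae le_rfl ENNReal.one_ne_top hUI.1
    (memLp_one_iff_integrable.2 hint) hUI.2.1 hlim
  have h1 := tendsto_setIntegral_of_L1' _ hint.aestronglyMeasurable
    (Eventually.of_forall fun n => memLp_one_iff_integrable.1 (hUI.memLp n)) hL1
    (A ∩ {ω | s < τ ω})
  refine tendsto_nhds_unique h1 (tendsto_const_nhds.congr fun n => ?_)
  have hA' : MeasurableSet[F s] (A ∩ {ω | s < τ ω}) := hA.inter (hτ.measurableSet_gt s)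
  -- On `{s < τ}` each grid time exceeds `s`, because `s < t`; so this `F s`-event is known at the
  -- grid time.
  have hmeas : MeasurableSet[(hst n).measurableSpace] (A ∩ {ω | s < τ ω}) := by
    rw [IsStoppingTime.measurableSet]
    refine ⟨le_iSup (fun t => (F t : MeasurableSpace Ω)) s _ hA', fun r => ?_⟩
    rcases le_or_gt s r with h | h
    · exact (F.mono h _ hA').inter (hst n r)
    · convert MeasurableSet.empty using 1
      ext ω
      simp only [Set.mem_inter_iff, Set.mem_ofPred_eq, Set.mem_empty_iff_false, iff_false, not_and,
        and_imp, not_le]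
      intro _ h2
      refine lt_of_lt_of_le (lt_min ?_ ?_) (min_le_gridTime n ω)
      · exact_mod_cast h.trans hs
      · exact lt_trans (by exact_mod_cast h) h2
  rw [← setIntegral_condExp (hst n).measurableSpace_le (hL.integrable t) hmeas]
  exact integral_congr_ae (ae_restrict_of_ae (heq n))

end OptionalStopping

/-! ### Identification of drifts by localization. -/

section StoppedRate

variable {Ω : Type*} {mΩ : MeasurableSpace Ω} {P : Measure Ω} [IsProbabilityMeasure P] {T : ℝ≥0∞}
  {F : Filtration (Time T) mΩ} {δ : ℝ} {h : Time T → Ω → ℝ} {τ : Ω → WithTop (Time T)}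

open Classical in
/-- The rate `h`, set to zero after the time `τ`. -/
noncomputable def stoppedRate (τ : Ω → WithTop (Time T)) (h : Time T → Ω → ℝ) (r : Time T)
    (ω : Ω) : ℝ :=
  if (r : WithTop (Time T)) ≤ τ ω then h r ω else 0

theorem stoppedRate_of_le {r : Time T} {ω : Ω} (hr : (r : WithTop (Time T)) ≤ τ ω) :
    stoppedRate τ h r ω = h r ω := if_pos hr

theorem stoppedRate_of_lt {r : Time T} {ω : Ω} (hr : τ ω < (r : WithTop (Time T))) :
    stoppedRate τ h r ω = 0 := if_neg (not_le.2 hr)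

/-- The event `r ≤ τ` is the coincidence set of `r ∧ τ` and `r`, both of which are progressive. -/
theorem isStronglyProgressive_stoppedRate (hh : IsStronglyProgressive F h)
    (hτ : IsStoppingTime F τ) : IsStronglyProgressive F (stoppedRate τ h) := by
  classical
  intro i
  have h1 := (isStronglyProgressive_min_stopping_time hτ i).measurable
  have h2 : @Measurable _ _ (@Prod.instMeasurableSpace (Set.Iic i) Ω _ (F i)) _
      (fun p : Set.Iic i × Ω => (p.1 : Time T)) :=
    measurable_subtype_coe.comp (@measurable_fst _ _ _ (F i))
  have h3 : MeasurableSet[@Prod.instMeasurableSpace (Set.Iic i) Ω _ (F i)]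
      {p : Set.Iic i × Ω | (min ((p.1 : Time T) : WithTop (Time T)) (τ p.2)).untopA = p.1} :=
    measurableSet_eq_fun h1 h2
  have h4 : StronglyMeasurable[@Prod.instMeasurableSpace (Set.Iic i) Ω _ (F i)]
      fun p : Set.Iic i × Ω =>
        if (min ((p.1 : Time T) : WithTop (Time T)) (τ p.2)).untopA = p.1 then h p.1 p.2 else 0 :=
    StronglyMeasurable.ite h3 (hh i) stronglyMeasurable_const
  suffices h : (fun p : Set.Iic i × Ω => stoppedRate τ h p.1 p.2) = _ by rw [h]; exact h4
  funext p
  refine if_congr ⟨fun h => by rw [min_eq_left h]; rfl, fun h => ?_⟩ rfl rfl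
  have h5 : min ((p.1 : Time T) : WithTop (Time T)) (τ p.2) ≠ ⊤ :=
    ne_top_of_le_ne_top (WithTop.coe_ne_top (a := (p.1 : Time T))) (min_le_left _ _)
  obtain ⟨q, hq⟩ := WithTop.ne_top_iff_exists.1 h5
  have h6 : q = (p.1 : Time T) := by
    rw [← hq] at h
    exact h
  rw [h6] at hq
  exact min_eq_left_iff.1 hq.symm

theorem MemL2.stoppedRate (hh : MemL2 P F δ h) (hτ : IsStoppingTime F τ) :
    MemL2 P F δ (stoppedRate τ h) := by
  have hp := isStronglyProgressive_stoppedRate hh.1 hτ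
  refine memL2_iff.2 ⟨hp, hh.memLp.mono ((hp.measurable_discounted δ).mono (progSigma_le F) le_rfl).aestronglyMeasurable
    (ae_of_all _ fun z => ?_)⟩
  simp only [discounted, norm_mul]
  refine mul_le_mul_of_nonneg_left ?_ (norm_nonneg _)
  rw [_root_.stoppedRate]
  split_ifs
  · exact le_rfl
  · simp

theorem position_stoppedRate (t : Time T) (ω : Ω) :
    position (stoppedRate τ h) t ω = stoppedProcess (position h) τ t ω := by
  obtain ⟨q, hq⟩ : ∃ q : Time T, (q : WithTop (Time T)) = min (t : WithTop (Time T)) (τ ω) :=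
    WithTop.ne_top_iff_exists.1
      (ne_top_of_le_ne_top (WithTop.coe_ne_top (a := t)) (min_le_left _ _))
  rw [stoppedProcess, ← hq, untopA_coe_time, position, position]
  have hqt : q ≤ t := by
    have : (q : WithTop (Time T)) ≤ t := hq.trans_le (min_le_left _ _)
    exact_mod_cast this
  have : Set.Iic q = Set.Iic t ∩ Set.Iic q := by
    rw [Set.Iic_inter_Iic, min_eq_right hqt]
  rw [this, ← setIntegral_indicator measurableSet_Iic]
  refine setIntegral_congr_fun measurableSet_Iic fun r hr => ?_
  by_cases hrq : r ≤ q
  · rw [Set.indicator_of_mem (Set.mem_Iic.2 hrq), stoppedRate_of_le]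
    refine le_trans ?_ (hq.trans_le (min_le_right _ _))
    exact_mod_cast hrq
  · rw [Set.indicator_of_notMem (s := Set.Iic q) (fun h => hrq h)]
    refine stoppedRate_of_lt ?_
    have h1 : q < r := not_le.1 hrq
    have h2 : q < t := h1.trans_le hr
    rcases min_choice (t : WithTop (Time T)) (τ ω) with h3 | h3
    · rw [h3] at hq
      exact absurd (WithTop.coe_injective hq) h2.ne
    · rw [← h3, ← hq]
      exact_mod_cast h1

theorem stoppedProcess_of_le {V : Type*} {X : Time T → Ω → V} {t : Time T} {ω : Ω}
    (h : (t : WithTop (Time T)) ≤ τ ω) :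
    stoppedProcess X τ t ω = X t ω := stoppedProcess_eq_of_le h

/-- Right-continuity is local: for `u > r` some localizing time exceeds `u`, and until `u` the
process coincides with its stopped version. At a last time there is nothing to the right. -/
theorem ae_rightContinuous_of_locally {M : Time T → Ω → ℝ} (hM : IsLocalMartingale P F M) :
    ∀ᵐ ω ∂P, ∀ r, ContinuousWithinAt (fun t => M t ω) (Set.Ioi r) r := by
  obtain ⟨τ, hτ, hp⟩ := hM
  filter_upwards [hτ.tendsto_top, ae_all_iff.2 fun k => (hp k).2] with ω h1 h2 r
  by_cases hr : IsTop r
  · rw [show Set.Ioi r = ∅ from Set.eq_empty_of_forall_notMem fun x hx => not_lt.2 (hr x) hx]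
    exact continuousWithinAt_of_notMem_closure (by simp)
  · simp only [IsTop, not_forall, not_le] at hr
    obtain ⟨u, hu⟩ := hr
    obtain ⟨k, hk⟩ := (h1.eventually (Ioi_mem_nhds (WithTop.coe_lt_top u))).exists
    have hk' : (u : WithTop (Time T)) < τ k ω := hk
    have heq : ∀ x ≤ u, stoppedProcess (fun i => {ω | ⊥ < τ k ω}.indicator (M i)) (τ k) x ω
        = M x ω := by
      intro x hx
      have hx' : (x : WithTop (Time T)) ≤ τ k ω := le_trans (by exact_mod_cast hx) hk'.le
      rw [stoppedProcess_of_le hx']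
      exact Set.indicator_of_mem (s := {ω | ⊥ < τ k ω}) (bot_le.trans_lt hk') _
    refine ((h2 k r).1).congr_of_eventuallyEq ?_ (heq r hu.le).symm
    filter_upwards [mem_nhdsWithin_of_mem_nhds (Iio_mem_nhds hu)] with x hx
    exact (heq x (Set.mem_Iio.1 hx).le).symm

variable [hδ : Discount T δ]

/-- The drift of a semimartingale that is represented by the adjoint of integration in time. -/
theorem drift_eq_of_toSpace_eq {η m g M : Time T → Ω → ℝ} (hη : MemL2 P F δ η)
    (hm : MemL2 P F δ m) (hg : MemL2 P F δ g) (hM : IsLocalMartingale P F M)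
    (heq : ∀ t, ∀ᵐ ω ∂P, η t ω = η ⊥ ω + position m t ω + (M t ω - M ⊥ ω))
    (hadj : hη.toSpace = (integrationOp P F δ).adjoint hg.toSpace) :
    ∀ᵐ z ∂((timeMeasure T).prod P), g z.1 z.2 = δ * η z.1 z.2 - m z.1 z.2 := by
  obtain ⟨y, hy, hb⟩ := hg.exists_isBackward
  have hyη : ∀ᵐ z ∂((timeMeasure T).prod P), y z.1 z.2 = η z.1 z.2 :=
    (hy.toSpace_eq_iff hη).1 ((hb.toSpace_eq hy hg).trans hadj.symm)
  have hL := hb.martingale hy hg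
  set L : Time T → Ω → ℝ := fun t ω => y t ω - position (fun s ω => δ * y s ω - g s ω) t ω
    with hLdef
  have hh : MemL2 P F δ fun t ω => (δ * η t ω - g t ω) - m t ω := ((hη.const_mul δ).sub hg).sub hm
  set h : Time T → Ω → ℝ := fun t ω => (δ * η t ω - g t ω) - m t ω with hhdef
  -- The equation for `η` and that for its version `y` give `L = Y` at almost all times. So the
  -- integral of the drift difference `h` is a local martingale minus a right-continuous copy of a
  -- true martingale, up to an initial value.
  set Y : Time T → Ω → ℝ := fun t ω => η ⊥ ω + (M t ω - M ⊥ ω) - position h t ω with hYdef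
  have hLY : ∀ᵐ r ∂(timeMeasure T), Y r =ᵐ[P] L r := by
    have h1 : ∀ᵐ ω ∂P, ∀ t, position (fun s ω => δ * y s ω - g s ω) t ω
        = position (fun s ω => h s ω + m s ω) t ω := by
      refine position_congr ?_
      filter_upwards [hyη] with z hz
      rw [hz, hhdef]
      ring
    filter_upwards [Measure.ae_ae_of_ae_prod hyη] with r hr
    filter_upwards [hr, h1, heq r, hh.position_add hm] with ω h2 h3 h4 h5
    simp only [hLdef, hYdef]
    rw [h3, h5, show y r ω = η r ω from h2, h4]
    ring
  have hYc : ∀ᵐ ω ∂P, ∀ r, ContinuousWithinAt (fun t => Y t ω) (Set.Ioi r) r := by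
    filter_upwards [ae_rightContinuous_of_locally hM, hh.ae_continuous_position] with ω h1 h2 r
    exact ((continuousWithinAt_const.add ((h1 r).sub continuousWithinAt_const))).sub
      h2.continuousWithinAt
  obtain ⟨τ, hτ, hp⟩ := hM
  -- Stopped at `τ j`, the integral of `h` is a martingale (at almost all times) of finite
  -- variation, so `h` vanishes before `τ j`.
  have hk : ∀ j, ∀ᵐ z ∂((timeMeasure T).prod P), stoppedRate (τ j) h z.1 z.2 = 0 := by
    intro j
    have hst := hτ.isStoppingTime j
    have hkm := hh.stoppedRate hst
    refine hkm.ae_eq_zero_of_martingale_position ?_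
    filter_upwards [hLY] with t ht
    filter_upwards [hLY] with s hs hst'
    refine (ae_eq_condExp_of_forall_setIntegral_eq (F.le s) (hkm.integrable_position t)
      (fun A _ _ => (hkm.integrable_position s).integrableOn) (fun A hA _ => ?_)
      (hkm.integral.1.stronglyAdapted s).aestronglyMeasurable).symm
    have hA' : MeasurableSet[F s] (A ∩ {ω | (s : WithTop (Time T)) < τ j ω}) :=
      hA.inter (hst.measurableSet_gt s)
    obtain ⟨hYi, hYA⟩ := hL.setIntegral_stoppedProcess hδ.horizon_pos hYc hLY hst ht
    have hN := (hp j).1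
    set N := stoppedProcess (fun i => {ω | ⊥ < τ j ω}.indicator (M i)) (τ j) with hNdef
    have e1 : ∫ ω in A ∩ {ω | (s : WithTop (Time T)) < τ j ω}, stoppedProcess Y (τ j) t ω ∂P
        = ∫ ω in A ∩ {ω | (s : WithTop (Time T)) < τ j ω}, Y s ω ∂P := by
      rw [hYA s hst' A hA, ← hL.setIntegral_eq hst'.le hA']
      exact integral_congr_ae (ae_restrict_of_ae hs.symm)
    have e2 := hN.setIntegral_eq hst'.le hA'
    have hYs : Integrable (Y s) P := (hL.integrable s).congr hs.symm
    -- The stopped position does not move between `s` and `t` unless `s < τ j`, and on that event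
    -- the indicator in the localized `N` is one.
    have e3 : ∫ ω in A, (position (stoppedRate (τ j) h) t ω - position (stoppedRate (τ j) h) s ω) ∂P
        = ∫ ω in A ∩ {ω | (s : WithTop (Time T)) < τ j ω},
          ((Y s ω - stoppedProcess Y (τ j) t ω) + (N t ω - N s ω)) ∂P := by
      rw [← setIntegral_indicator (F.le s _ (hst.measurableSet_gt s))]
      refine setIntegral_congr_fun (F.le s _ hA) fun ω _ => ?_
      by_cases hω : (s : WithTop (Time T)) < τ j ω
      · rw [Set.indicator_of_mem (by exact hω), position_stoppedRate, position_stoppedRate,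
          stoppedProcess_of_le (X := position h) (t := s) hω.le, hNdef,
          stoppedProcess_of_le (t := s) hω.le]
        have hbot : ∀ f : Ω → ℝ, {ω | ⊥ < τ j ω}.indicator f ω = f ω := fun f =>
          Set.indicator_of_mem (s := {ω | ⊥ < τ j ω}) (bot_le.trans_lt hω) _
        simp only [stoppedProcess, hbot, hYdef]
        ring
      · rw [Set.indicator_of_notMem (by exact hω), position_stoppedRate, position_stoppedRate,
          stoppedProcess_eq_of_ge (not_lt.1 hω), stoppedProcess_eq_of_ge
            ((not_lt.1 hω).trans (by exact_mod_cast hst'.le)), sub_self]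
    have i1 : Integrable (fun ω => Y s ω - stoppedProcess Y (τ j) t ω) P := hYs.sub hYi
    have i2 : Integrable (fun ω => N t ω - N s ω) P := (hN.integrable t).sub (hN.integrable s)
    rw [integral_add i1.integrableOn i2.integrableOn,
      integral_sub hYs.integrableOn hYi.integrableOn, integral_sub (hN.integrable t).integrableOn
      (hN.integrable s).integrableOn, integral_sub (hkm.integrable_position t).integrableOn
      (hkm.integrable_position s).integrableOn] at e3
    linarith
  have htop : ∀ᵐ z ∂((timeMeasure T).prod P), Tendsto (fun j => τ j z.2) atTop (𝓝 ⊤) :=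
    Measure.quasiMeasurePreserving_snd.ae hτ.tendsto_top
  filter_upwards [ae_all_iff.2 hk, htop] with z h1 h2
  obtain ⟨j, hj⟩ := (h2.eventually (Ioi_mem_nhds (WithTop.coe_lt_top z.1))).exists
  have h3 := h1 j
  rw [stoppedRate_of_le (le_of_lt (Set.mem_Ioi.1 hj))] at h3
  simp only [hhdef] at h3
  linarith

end StoppedRate

/-! ### Accretive linear systems and quadratic optimization in a Hilbert space. -/

section HilbertSpace

variable {H : Type*} [NormedAddCommGroup H] [InnerProductSpace ℝ H] {ι : Type*} [Fintype ι]

/-- In an orthonormal basis of the span of the vectors the sum splits into scalar quadratic forms,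
one for each basis vector. Symmetry of `S` plays no role. -/
theorem sum_mul_inner_nonneg {S : ι → ι → ℝ} (hS : ∀ x : ι → ℝ, 0 ≤ ∑ i, ∑ j, S i j * (x i * x j))
    (x : ι → H) : 0 ≤ ∑ i, ∑ j, S i j * inner ℝ (x i) (x j) := by
  let W : Submodule ℝ H := Submodule.span ℝ (Set.range x)
  have : FiniteDimensional ℝ W := FiniteDimensional.span_of_finite ℝ (Set.finite_range x)
  let b := stdOrthonormalBasis ℝ W
  let y : ι → W := fun i => ⟨x i, Submodule.subset_span ⟨i, rfl⟩⟩
  have h1 : ∀ i j, inner ℝ (x i) (x j) = ∑ k, inner ℝ (y i) (b k) * inner ℝ (y j) (b k) := by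
    intro i j
    rw [show inner ℝ (x i) (x j) = inner ℝ (y i) (y j) from rfl,
      ← b.sum_inner_mul_inner (y i) (y j)]
    exact Finset.sum_congr rfl fun k _ => by rw [real_inner_comm (y j) (b k)]
  have h2 : ∑ i, ∑ j, S i j * inner ℝ (x i) (x j)
      = ∑ k, ∑ i, ∑ j, S i j * (inner ℝ (y i) (b k) * inner ℝ (y j) (b k)) := by
    simp only [h1, Finset.mul_sum]
    calc _ = ∑ i, ∑ k, ∑ j, S i j * (inner ℝ (y i) (b k) * inner ℝ (y j) (b k)) :=
          Finset.sum_congr rfl fun i _ => Finset.sum_comm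
      _ = _ := Finset.sum_comm
  rw [h2]
  exact Finset.sum_nonneg fun k _ => hS fun i => inner ℝ (y i) (b k)

variable [CompleteSpace H]

/-- A linear system for the Gram operator of `V` is uniquely solvable if its matrix is accretive
for a weighted inner product. -/
theorem existsUnique_add_sum_adjoint (V : H →L[ℝ] H) (B : ι → ι → ℝ) (w : ι → ℝ)
    (hw : ∀ i, 0 < w i) (hB : ∀ x : ι → ℝ, 0 ≤ ∑ i, ∑ j, w i * B i j * (x i * x j)) (f : ι → H) :
    ∃! u : ι → H, ∀ i, u i + ∑ j, B i j • V.adjoint (V (u j)) = f i := by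
  let e := PiLp.continuousLinearEquiv 2 ℝ fun _ : ι => H
  let A' : (ι → H) →L[ℝ] (ι → H) := ContinuousLinearMap.pi fun i =>
    w i • (ContinuousLinearMap.proj i + ∑ j, B i j • (V.adjoint ∘L V ∘L ContinuousLinearMap.proj j))
  have hA' : ∀ u i, A' u i = w i • (u i + ∑ j, B i j • V.adjoint (V (u j))) := by
    intro u i
    simp [A']
  let A : PiLp 2 (fun _ : ι => H) →L[ℝ] PiLp 2 (fun _ : ι => H) :=
    e.symm.toContinuousLinearMap ∘L A' ∘L e.toContinuousLinearMap
  have hA : ∀ u i, A u i = w i • (u i + ∑ j, B i j • V.adjoint (V (u j))) := fun u i => hA' _ i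
  obtain ⟨c, hc, hcw⟩ : ∃ c : NNReal, 0 < c ∧ ∀ i, (c : ℝ) ≤ w i := by
    rcases isEmpty_or_nonempty ι with h | h
    · exact ⟨1, one_pos, fun i => h.elim i⟩
    · obtain ⟨i, hi⟩ := Finite.exists_min w
      exact ⟨⟨w i, (hw i).le⟩, hw i, hi⟩
  -- Lax-Milgram for the system with row `i` multiplied by `w i`: pairing with `u` gives `∑ w_i
  -- ‖u_i‖²` plus the form of `w B` in the vectors `V u_i`, which is nonnegative. The coercivity
  -- constant is the smallest weight.
  have hunit : IsUnit A := by
    refine ContinuousLinearMap.isUnit_of_forall_le_norm_inner_map A hc fun u => ?_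
    refine le_trans ?_ (Real.le_norm_self _)
    have h1 : inner ℝ (A u) u = ∑ i, w i * ‖u i‖ ^ 2
        + ∑ i, ∑ j, w i * B i j * inner ℝ (V (u i)) (V (u j)) := by
      rw [PiLp.inner_apply, ← Finset.sum_add_distrib]
      refine Finset.sum_congr rfl fun i _ => ?_
      rw [hA, inner_smul_left, inner_add_left, real_inner_self_eq_norm_sq, sum_inner, mul_add,
        Finset.mul_sum]
      congr 1
      refine Finset.sum_congr rfl fun j _ => ?_
      rw [inner_smul_left, ContinuousLinearMap.adjoint_inner_left, real_inner_comm]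
      simp only [conj_trivial]
      ring
    have h2 := sum_mul_inner_nonneg hB fun i => V (u i)
    rw [h1, PiLp.norm_sq_eq_of_L2, Finset.sum_mul]
    have h3 : ∑ i, ‖u i‖ ^ 2 * (c : ℝ) ≤ ∑ i, w i * ‖u i‖ ^ 2 :=
      Finset.sum_le_sum fun i _ => by
        rw [mul_comm]
        exact mul_le_mul_of_nonneg_right (hcw i) (sq_nonneg _)
    linarith
  have hbij : Function.Bijective A := (ContinuousLinearMap.isUnit_iff_bijective).1 hunit
  have key : ∀ u : ι → H, (∀ i, u i + ∑ j, B i j • V.adjoint (V (u j)) = f i) ↔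
      A (WithLp.toLp 2 u) = WithLp.toLp 2 fun i => w i • f i := by
    intro u
    rw [PiLp.ext_iff]
    refine forall_congr' fun i => ?_
    rw [hA]
    exact (smul_right_injective H (hw i).ne').eq_iff.symm
  obtain ⟨u, hu⟩ := hbij.2 (WithLp.toLp 2 fun i => w i • f i)
  refine ⟨fun i => u i, (key _).2 hu, fun v hv => ?_⟩
  have := hbij.1 (((key v).1 hv).trans hu.symm)
  funext i
  exact congrFun (congrArg (WithLp.ofLp) this) i

/-- The mean-variance functional of the position `V u` with quadratic costs on the rate `u`. -/
noncomputable def quadraticGoal (V : H →L[ℝ] H) (S : ι → ι → ℝ) (lam : ι → ℝ) (γ : ℝ) (μ ζ u : ι → H) :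
    ℝ :=
  ∑ i, inner ℝ (V (u i)) (μ i)
    - γ / 2 * ∑ i, ∑ j, S i j * inner ℝ (V (u i) + ζ i) (V (u j) + ζ j)
    - ∑ i, lam i * ‖u i‖ ^ 2

variable {V : H →L[ℝ] H} {S : ι → ι → ℝ} {lam : ι → ℝ} {γ : ℝ} {μ ζ u v : ι → H}

/-- The functional is quadratic, so its second-order expansion is exact. Moving `V` to the other
side in the linear term exhibits the gradient; the remainder is nonpositive when `S` is positive
semidefinite and `γ`, `lam` are nonnegative. -/
theorem quadraticGoal_add (hsymm : ∀ i j, S i j = S j i) (u h : ι → H) :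
    quadraticGoal V S lam γ μ ζ (u + h) = quadraticGoal V S lam γ μ ζ u
      + ∑ i, inner ℝ (V.adjoint (μ i - γ • ∑ j, S i j • (V (u j) + ζ j)) - (2 * lam i) • u i) (h i)
      - (γ / 2 * ∑ i, ∑ j, S i j * inner ℝ (V (h i)) (V (h j)) + ∑ i, lam i * ‖h i‖ ^ 2) := by
  have h1 : ∑ i, ∑ j, S i j * inner ℝ (V (u i) + ζ i) (V (h j))
      = ∑ i, ∑ j, S i j * inner ℝ (V (u j) + ζ j) (V (h i)) := by
    rw [Finset.sum_comm]
    exact Finset.sum_congr rfl fun i _ => Finset.sum_congr rfl fun j _ => by rw [hsymm]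
  have h2 : ∑ i, ∑ j, S i j * inner ℝ (V ((u + h) i) + ζ i) (V ((u + h) j) + ζ j)
      = ∑ i, ∑ j, S i j * inner ℝ (V (u i) + ζ i) (V (u j) + ζ j)
        + 2 * ∑ i, ∑ j, S i j * inner ℝ (V (u j) + ζ j) (V (h i))
        + ∑ i, ∑ j, S i j * inner ℝ (V (h i)) (V (h j)) := by
    rw [two_mul]
    nth_rw 1 [← h1]
    simp only [← Finset.sum_add_distrib]
    refine Finset.sum_congr rfl fun i _ => Finset.sum_congr rfl fun j _ => ?_
    simp only [Pi.add_apply, map_add]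
    rw [show V (u i) + V (h i) + ζ i = (V (u i) + ζ i) + V (h i) by abel,
      show V (u j) + V (h j) + ζ j = (V (u j) + ζ j) + V (h j) by abel, inner_add_left,
      inner_add_right _ (V (u j) + ζ j), inner_add_right _ (V (u j) + ζ j),
      real_inner_comm (V (u j) + ζ j) (V (h i))]
    ring
  have h3 : ∀ i, inner ℝ (V.adjoint (μ i - γ • ∑ j, S i j • (V (u j) + ζ j)) - (2 * lam i) • u i)
      (h i) = inner ℝ (V (h i)) (μ i) - γ * ∑ j, S i j * inner ℝ (V (u j) + ζ j) (V (h i))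
        - 2 * lam i * inner ℝ (u i) (h i) := by
    intro i
    rw [inner_sub_left, ContinuousLinearMap.adjoint_inner_left, inner_sub_left, inner_smul_left,
      inner_smul_left, sum_inner, real_inner_comm]
    simp only [inner_smul_left, conj_trivial]
  have h4 : ∀ i, ‖(u + h) i‖ ^ 2 = ‖u i‖ ^ 2 + 2 * inner ℝ (u i) (h i) + ‖h i‖ ^ 2 := fun i => by
    rw [Pi.add_apply, norm_add_sq_real]
  have h5 : ∀ i, inner ℝ (V ((u + h) i)) (μ i) = inner ℝ (V (u i)) (μ i) + inner ℝ (V (h i)) (μ i) :=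
    fun i => by rw [Pi.add_apply, map_add, inner_add_left]
  simp only [quadraticGoal, h2, h3, h4, h5, mul_add, Finset.sum_add_distrib,
    Finset.sum_sub_distrib, ← Finset.mul_sum]
  have h6 : ∑ i, lam i * (2 * inner ℝ (u i) (h i)) = ∑ i, 2 * lam i * inner ℝ (u i) (h i) :=
    Finset.sum_congr rfl fun i _ => by ring
  rw [h6]
  ring

/-- The first-order condition for the mean-variance functional. -/
theorem isMax_quadraticGoal_iff (hsymm : ∀ i j, S i j = S j i) (hlam : ∀ i, 0 < lam i)
    (hγ : 0 ≤ γ) (hS : ∀ x : ι → ℝ, 0 ≤ ∑ i, ∑ j, S i j * (x i * x j)) :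
    (∀ v, quadraticGoal V S lam γ μ ζ v ≤ quadraticGoal V S lam γ μ ζ u) ↔
      ∀ i, (2 * lam i) • u i = V.adjoint (μ i - γ • ∑ j, S i j • (V (u j) + ζ j)) := by
  constructor
  · intro h i
    set G : ι → H := fun i =>
      V.adjoint (μ i - γ • ∑ j, S i j • (V (u j) + ζ j)) - (2 * lam i) • u i with hG
    suffices hGi : G i = 0 by
      exact (sub_eq_zero.1 hGi).symm
    set Q := γ / 2 * ∑ i, ∑ j, S i j * inner ℝ (V (G i)) (V (G j)) + ∑ i, lam i * ‖G i‖ ^ 2 with hQ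
    -- A step of length `ε` along the gradient gains `ε ∑ ‖G_i‖²` to first order and loses `ε² Q`;
    -- maximality and `ε → 0` force `G = 0`.
    have hstep : ∀ ε : ℝ, 0 < ε → ∑ i, ‖G i‖ ^ 2 ≤ ε * Q := by
      intro ε hε
      have h1 := h (u + ε • G)
      rw [quadraticGoal_add hsymm] at h1
      have h2 : ∑ i, inner ℝ (G i) ((ε • G) i) = ε * ∑ i, ‖G i‖ ^ 2 := by
        rw [Finset.mul_sum]
        exact Finset.sum_congr rfl fun i _ => by
          rw [Pi.smul_apply, inner_smul_right, real_inner_self_eq_norm_sq]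
      have h3 : γ / 2 * ∑ i, ∑ j, S i j * inner ℝ (V ((ε • G) i)) (V ((ε • G) j))
          + ∑ i, lam i * ‖(ε • G) i‖ ^ 2 = ε * (ε * Q) := by
        rw [hQ, mul_add, mul_add]
        congr 1
        · simp only [Pi.smul_apply, map_smul, inner_smul_left, inner_smul_right, conj_trivial,
            Finset.mul_sum]
          exact Finset.sum_congr rfl fun i _ => Finset.sum_congr rfl fun j _ => by ring
        · simp only [Pi.smul_apply, norm_smul, mul_pow, Real.norm_eq_abs, sq_abs, Finset.mul_sum]
          exact Finset.sum_congr rfl fun i _ => by ring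
      have h4 : ∑ i, inner ℝ (V.adjoint (μ i - γ • ∑ j, S i j • (V (u j) + ζ j))
          - (2 * lam i) • u i) ((ε • G) i) = ε * ∑ i, ‖G i‖ ^ 2 := h2
      rw [h3, h4] at h1
      exact le_of_mul_le_mul_left (by linarith) hε
    have hlim : Tendsto (fun ε : ℝ => ε * Q) (𝓝[>] 0) (𝓝 0) := by
      have : Tendsto (fun ε : ℝ => ε * Q) (𝓝 0) (𝓝 (0 * Q)) :=
        (continuous_id.mul continuous_const).tendsto 0
      rw [zero_mul] at this
      exact this.mono_left nhdsWithin_le_nhds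
    have hle : ∑ i, ‖G i‖ ^ 2 ≤ 0 :=
      ge_of_tendsto hlim (eventually_nhdsWithin_of_forall fun ε hε => hstep ε hε)
    have h0 : ∑ i, ‖G i‖ ^ 2 = 0 := le_antisymm hle (Finset.sum_nonneg fun i _ => sq_nonneg _)
    have := (Finset.sum_eq_zero_iff_of_nonneg fun i _ => sq_nonneg ‖G i‖).1 h0 i (Finset.mem_univ i)
    exact norm_eq_zero.1 (pow_eq_zero_iff two_ne_zero |>.1 this)
  · intro h v
    have h1 := quadraticGoal_add (V := V) (lam := lam) (γ := γ) (μ := μ) (ζ := ζ) hsymm u (v - u)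
    rw [add_sub_cancel] at h1
    simp only [h, sub_self, inner_zero_left, Finset.sum_const_zero] at h1
    have h2 := sum_mul_inner_nonneg hS fun i => V ((v - u) i)
    have h3 : 0 ≤ ∑ i, lam i * ‖(v - u) i‖ ^ 2 :=
      Finset.sum_nonneg fun i _ => mul_nonneg (hlam i).le (sq_nonneg _)
    have h4 : 0 ≤ γ / 2 * ∑ i, ∑ j, S i j * inner ℝ (V ((v - u) i)) (V ((v - u) j)) := by positivity
    linarith

/-- Strict concavity comes from the costs `lam` alone: at a critical point the functional drops by
at least `∑ lam_i ‖v_i - u_i‖²`. -/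
theorem eq_of_isMax_quadraticGoal (hsymm : ∀ i j, S i j = S j i) (hlam : ∀ i, 0 < lam i)
    (hγ : 0 ≤ γ) (hS : ∀ x : ι → ℝ, 0 ≤ ∑ i, ∑ j, S i j * (x i * x j))
    (hu : ∀ v, quadraticGoal V S lam γ μ ζ v ≤ quadraticGoal V S lam γ μ ζ u)
    (hv : ∀ w, quadraticGoal V S lam γ μ ζ w ≤ quadraticGoal V S lam γ μ ζ v) : v = u := by
  have h := (isMax_quadraticGoal_iff hsymm hlam hγ hS).1 hu
  have h1 := quadraticGoal_add (V := V) (lam := lam) (γ := γ) (μ := μ) (ζ := ζ) hsymm u (v - u)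
  rw [add_sub_cancel] at h1
  simp only [h, sub_self, inner_zero_left, Finset.sum_const_zero] at h1
  have h2 := sum_mul_inner_nonneg hS fun i => V ((v - u) i)
  have h4 : 0 ≤ γ / 2 * ∑ i, ∑ j, S i j * inner ℝ (V ((v - u) i)) (V ((v - u) j)) := by positivity
  have h5 := hv u
  have h6 : ∑ i, lam i * ‖(v - u) i‖ ^ 2 = 0 :=
    le_antisymm (by linarith) (Finset.sum_nonneg fun i _ => mul_nonneg (hlam i).le (sq_nonneg _))
  funext i
  have := (Finset.sum_eq_zero_iff_of_nonneg fun i _ =>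
    mul_nonneg (hlam i).le (sq_nonneg ‖(v - u) i‖)).1 h6 i (Finset.mem_univ i)
  rcases mul_eq_zero.1 this with h | h
  · exact absurd h (hlam i).ne'
  · exact sub_eq_zero.1 (norm_eq_zero.1 (pow_eq_zero_iff two_ne_zero |>.1 h))

end HilbertSpace

/-! ### Passage from coordinates to vector-valued processes. -/

section VectorProcesses

variable {Ω : Type*} {mΩ : MeasurableSpace Ω} {P : Measure Ω} [IsProbabilityMeasure P] {T : ℝ≥0∞}
  {F : Filtration (Time T) mΩ} {δ : ℝ} {ι κ : Type*} [Fintype ι] [Fintype κ]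
  {X Y : Time T → Ω → ι → ℝ}

theorem MeasureTheory.Martingale.apply {M : Time T → Ω → ι → ℝ} (hM : Martingale M F P) (i : ι) :
    Martingale (fun t ω => M t ω i) F P := by
  refine ⟨fun t => (continuous_apply i).comp_stronglyMeasurable (hM.1 t), fun s t hst => ?_⟩
  have h1 := (ContinuousLinearMap.proj (R := ℝ) (φ := fun _ : ι => ℝ) i).comp_condExp_comm
    (hM.integrable t) (m := F s)
  filter_upwards [h1, hM.2 s t hst] with ω h2 h3
  rw [show (P[fun ω => M t ω i | F s]) ω = (P[M t | F s]) ω i from h2.symm, h3]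

theorem martingale_pi {M : Time T → Ω → ι → ℝ} (hM : ∀ i, Martingale (fun t ω => M t ω i) F P) :
    Martingale M F P := by
  have hint : ∀ t, Integrable (M t) P := fun t => Integrable.of_eval fun i => (hM i).integrable t
  refine ⟨fun t => (@measurable_pi_lambda _ _ _ (F t) _ _ fun i =>
    ((hM i).1 t).measurable).stronglyMeasurable, fun s t hst => ?_⟩
  have h1 := fun i => (ContinuousLinearMap.proj (R := ℝ) (φ := fun _ : ι => ℝ) i).comp_condExp_comm
    (hint t) (m := F s)
  filter_upwards [ae_all_iff.2 h1, ae_all_iff.2 fun i => (hM i).2 s t hst] with ω h2 h3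
  funext i
  exact (h2 i).trans (h3 i)

theorem IsLocalMartingale.apply {M : Time T → Ω → ι → ℝ} (hM : IsLocalMartingale P F M) (i : ι) :
    IsLocalMartingale P F (fun t ω => M t ω i) := by
  obtain ⟨τ, hτ, hp⟩ := hM
  refine ⟨τ, hτ, fun n => ?_⟩
  have heq : stoppedProcess (fun t => {ω | ⊥ < τ n ω}.indicator fun ω => M t ω i) (τ n)
      = fun t ω => stoppedProcess (fun t => {ω | ⊥ < τ n ω}.indicator (M t)) (τ n) t ω i := by
    funext t ω
    simp only [stoppedProcess]
    by_cases h : ω ∈ {ω | ⊥ < τ n ω}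
    · rw [Set.indicator_of_mem h, Set.indicator_of_mem h]
    · rw [Set.indicator_of_notMem h, Set.indicator_of_notMem h, Pi.zero_apply]
  rw [heq]
  refine ⟨(hp n).1.apply i, (hp n).2.mono fun ω hω t => ⟨?_, ?_⟩⟩
  · exact (continuous_apply i).continuousAt.comp_continuousWithinAt (hω t).1
  · obtain ⟨l, hl⟩ := (hω t).2
    exact ⟨l i, (tendsto_pi_nhds.1 hl) i⟩

theorem MemL2.apply (hX : MemL2 P F δ X) (i : ι) : MemL2 P F δ fun t ω => X t ω i :=
  memL2_pi_iff.1 hX i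

theorem memL2_mulVec (A : Matrix κ ι ℝ) (hX : MemL2 P F δ X) :
    MemL2 P F δ fun t ω => A *ᵥ X t ω :=
  memL2_pi_iff.2 fun i => MemL2.sum Finset.univ fun j _ => (hX.apply j).const_mul (A i j)

theorem MemL2.toSpace_mulVec (A : Matrix κ ι ℝ) (hX : MemL2 P F δ X) (i : κ) :
    ((memL2_mulVec A hX).apply i).toSpace = ∑ j, A i j • (hX.apply j).toSpace := by
  simp only [← MemL2.toSpace_const_mul]
  rw [← MemL2.toSpace_sum]
  rfl

theorem MemL2.add_pi (hX : MemL2 P F δ X) (hY : MemL2 P F δ Y) :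
    MemL2 P F δ fun t ω => X t ω + Y t ω :=
  memL2_pi_iff.2 fun i => (hX.apply i).add (hY.apply i)

theorem MemL2.sub_pi (hX : MemL2 P F δ X) (hY : MemL2 P F δ Y) :
    MemL2 P F δ fun t ω => X t ω - Y t ω :=
  memL2_pi_iff.2 fun i => (hX.apply i).sub (hY.apply i)

theorem MemL2.neg_pi (hX : MemL2 P F δ X) : MemL2 P F δ fun t ω => - X t ω :=
  memL2_pi_iff.2 fun i => (hX.apply i).neg

theorem MemL2.const_smul_pi (hX : MemL2 P F δ X) (a : ℝ) : MemL2 P F δ fun t ω => a • X t ω :=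
  memL2_pi_iff.2 fun i => (hX.apply i).const_mul a

theorem memL2_sum_pi {α : Type*} (s : Finset α) {Z : α → Time T → Ω → ι → ℝ}
    (hZ : ∀ a ∈ s, MemL2 P F δ (Z a)) : MemL2 P F δ fun t ω => ∑ a ∈ s, Z a t ω := by
  refine memL2_pi_iff.2 fun i => ?_
  simp only [Finset.sum_apply]
  exact MemL2.sum s fun a ha => (hZ a ha).apply i

theorem exists_toSpace_apply_eq (δ : ℝ) (f : ι → ProcessSpace P F) :
    ∃ (X : Time T → Ω → ι → ℝ) (hX : MemL2 P F δ X), ∀ i, (hX.apply i).toSpace = f i := by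
  choose Z hZ hZf using fun i => exists_toSpace_eq δ (f i)
  exact ⟨fun t ω i => Z i t ω, memL2_pi_iff.2 hZ, hZf⟩

theorem MemL2.ae_eq_of_toSpace_apply_eq (hX : MemL2 P F δ X) (hY : MemL2 P F δ Y)
    (h : ∀ i, (hX.apply i).toSpace = (hY.apply i).toSpace) :
    ∀ᵐ z ∂((timeMeasure T).prod P), X z.1 z.2 = Y z.1 z.2 := by
  filter_upwards [ae_all_iff.2 fun i => ((hX.apply i).toSpace_eq_iff (hY.apply i)).1 (h i)]
    with z hz
  exact funext hz

theorem ae_prod_of_ae_forall {p : Time T → Ω → Prop}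
    (hp : MeasurableSet {z : Time T × Ω | p z.1 z.2}) (h : ∀ᵐ ω ∂P, ∀ t, p t ω) :
    ∀ᵐ z ∂((timeMeasure T).prod P), p z.1 z.2 := by
  rw [Measure.ae_prod_iff_ae_ae hp, Measure.ae_ae_comm hp]
  exact h.mono fun ω hω => ae_of_all _ hω

variable [hδ : Discount T δ]

theorem MemL2.integral_pi (hX : MemL2 P F δ X) : MemL2 P F δ (position X) := by
  have hprog := isStronglyProgressive_position hX.1
  refine memL2_pi_iff.2 fun i => (hX.apply i).integral.congr
    (isStronglyProgressive_pi_iff.1 hprog i) ?_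
  refine ae_prod_of_ae_forall (p := fun t ω => position (fun t ω => X t ω i) t ω = position X t ω i)
    (measurableSet_eq_fun (hX.apply i).integral.measurable
      (isStronglyProgressive_pi_iff.1 hprog i).measurable_uncurry) ?_
  filter_upwards [ae_position_apply hX] with ω hω t
  exact (hω t i).symm

theorem MemL2.toSpace_integral_pi (hX : MemL2 P F δ X) (i : ι) :
    (hX.integral_pi.apply i).toSpace = integrationOp P F δ (hX.apply i).toSpace := by
  rw [(hX.apply i).integrationOp_toSpace, MemL2.toSpace_eq_iff]
  refine ae_prod_of_ae_forall (p := fun t ω => position X t ω i = position (fun t ω => X t ω i) t ω)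
    (measurableSet_eq_fun (hX.integral_pi.apply i).measurable (hX.apply i).integral.measurable) ?_
  filter_upwards [ae_position_apply hX] with ω hω t
  exact hω t i

end VectorProcesses

/-! ### The first-order condition of an agent. -/

namespace Market

variable {Ω : Type*} {mΩ : MeasurableSpace Ω} {P : Measure Ω} [IsProbabilityMeasure P] {T : ℝ≥0∞}
  {F : Filtration (Time T) mΩ} {K d : ℕ} (E : Market P F K d)
  {n : Fin (K + 1)} {μ u v : Time T → Ω → Fin d → ℝ}

instance discount : Discount T E.δ := ⟨E.horizon_pos, E.δ_nonneg, E.δ_pos⟩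

theorem cov_symm (i j : Fin d) : E.cov i j = E.cov j i := by
  simp only [cov, Matrix.mul_apply, Matrix.transpose_apply]
  exact Finset.sum_congr rfl fun k _ => mul_comm _ _

theorem cov_nonneg (x : Fin d → ℝ) : 0 ≤ ∑ i, ∑ j, E.cov i j * (x i * x j) := by
  have : ∑ i, ∑ j, E.cov i j * (x i * x j) = ∑ k, (∑ i, E.σ i k * x i) ^ 2 := by
    have h : ∀ k, (∑ i, E.σ i k * x i) ^ 2 = ∑ i, ∑ j, E.σ i k * E.σ j k * (x i * x j) := fun k => by
      rw [sq, Finset.sum_mul_sum]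
      exact Finset.sum_congr rfl fun i _ => Finset.sum_congr rfl fun j _ => by ring
    simp only [h, cov, Matrix.mul_apply, Matrix.transpose_apply, Finset.sum_mul]
    calc _ = ∑ i, ∑ k, ∑ j, E.σ i k * E.σ j k * (x i * x j) :=
          Finset.sum_congr rfl fun i _ => Finset.sum_comm
      _ = ∑ k, ∑ i, ∑ j, E.σ i k * E.σ j k * (x i * x j) := Finset.sum_comm
  rw [this]
  exact Finset.sum_nonneg fun k _ => sq_nonneg _

/-- Boundedness of integration in time makes the condition on the position automatic. -/
theorem admissible_iff : E.Admissible u ↔ MemL2 P F E.δ u :=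
  ⟨fun h => h.1, fun h => ⟨h, h.integral_pi⟩⟩

/-- Each term of the goal is a combination of products of processes in `L²_δ`, hence integrable on
the product space, so the iterated integral splits into inner products of classes. -/
theorem goal_eq (hμ : MemL2 P F E.δ μ) (hu : MemL2 P F E.δ u) :
    E.goal n μ u = quadraticGoal (integrationOp P F E.δ) E.cov E.lam (E.γ n)
      (fun i => (hμ.apply i).toSpace) (fun i => ((E.ζ_mem n).apply i).toSpace)
      (fun i => (hu.apply i).toSpace) + E.c n := by
  have hp := fun i => hu.integral_pi.apply i
  have hq := fun i => (hp i).add ((E.ζ_mem n).apply i)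
  unfold goal quadraticGoal
  congr 1
  simp only [← hu.toSpace_integral_pi, ← (hp _).toSpace_add ((E.ζ_mem n).apply _),
    ← real_inner_self_eq_norm_sq]
  simp only [fun i => (hp i).inner_toSpace (hμ.apply i), fun i j => (hq i).inner_toSpace (hq j),
    fun i => (hu.apply i).inner_toSpace (hu.apply i), ← integral_const_mul]
  have i1 := fun i => (hp i).integrable_mul (hμ.apply i)
  have i2 := fun i j => ((hq i).integrable_mul (hq j)).const_mul (E.cov i j)
  have i3 := fun i => ((hu.apply i).integrable_mul (hu.apply i)).const_mul (E.lam i)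
  have j2 := fun i => integrable_finsetSum Finset.univ fun j _ => i2 i j
  have k1 := integrable_finsetSum Finset.univ fun i _ => i1 i
  have k2 := (integrable_finsetSum Finset.univ fun i _ => j2 i).const_mul (E.γ n / 2)
  have k3 := integrable_finsetSum Finset.univ fun i _ => i3 i
  have e2 : ∀ i, ∑ j, ∫ z : Time T × Ω, E.cov i j * (Real.exp (-E.δ * z.1) *
      ((position u z.1 z.2 i + E.ζ n z.1 z.2 i) * (position u z.1 z.2 j + E.ζ n z.1 z.2 j)))
        ∂((timeMeasure T).prod P) = _ :=
    fun i => (integral_finsetSum Finset.univ fun j _ => i2 i j).symm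
  simp only [e2]
  rw [← integral_finsetSum Finset.univ fun i _ => i1 i,
    ← integral_finsetSum Finset.univ fun i _ => j2 i,
    ← integral_finsetSum Finset.univ fun i _ => i3 i, ← integral_const_mul,
    ← integral_sub k1 k2]
  refine Eq.trans ?_ (integral_sub (k1.sub k2) k3)
  refine Eq.trans ?_ (integral_prod_symm _ ((k1.sub k2).sub k3)).symm
  refine integral_congr_ae (ae_of_all _ fun ω => integral_congr_ae (ae_of_all _ fun t => ?_))
  have h1 : ∀ x : Fin d → ℝ, Real.exp (-E.δ * t) * (x ⬝ᵥ (E.cov *ᵥ x))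
      = ∑ i, ∑ j, E.cov i j * (Real.exp (-E.δ * t) * (x i * x j)) := fun x => by
    simp only [dotProduct, Matrix.mulVec, Finset.mul_sum]
    exact Finset.sum_congr rfl fun i _ => Finset.sum_congr rfl fun j _ => by ring
  have h2 : ∀ x : Fin d → ℝ, Real.exp (-E.δ * t) * (x ⬝ᵥ (E.cost *ᵥ x))
      = ∑ i, E.lam i * (Real.exp (-E.δ * t) * (x i * x i)) := fun x => by
    simp only [dotProduct, cost, Matrix.mulVec_diagonal, Finset.mul_sum]
    exact Finset.sum_congr rfl fun i _ => by ring
  have h3 : ∀ x y : Fin d → ℝ, Real.exp (-E.δ * t) * (x ⬝ᵥ y)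
      = ∑ i, Real.exp (-E.δ * t) * (x i * y i) := fun x y => by
    simp only [dotProduct, Finset.mul_sum]
  have h4 := h1 (position u t ω + E.ζ n t ω)
  simp only [Pi.add_apply] at h4
  simp only [Pi.sub_apply, ← h4, ← h2, ← h3]
  ring

/-- Every tuple of classes comes from an admissible rate, so nothing is gained or lost by optimizing
over the Hilbert space. -/
theorem isOptimal_iff (hμ : MemL2 P F E.δ μ) (hu : MemL2 P F E.δ u) :
    E.IsOptimal n μ u ↔ ∀ v, quadraticGoal (integrationOp P F E.δ) E.cov E.lam (E.γ n)
      (fun i => (hμ.apply i).toSpace) (fun i => ((E.ζ_mem n).apply i).toSpace) v ≤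
      quadraticGoal (integrationOp P F E.δ) E.cov E.lam (E.γ n)
      (fun i => (hμ.apply i).toSpace) (fun i => ((E.ζ_mem n).apply i).toSpace)
      (fun i => (hu.apply i).toSpace) := by
  constructor
  · intro h v
    obtain ⟨X, hX, hXv⟩ := exists_toSpace_apply_eq E.δ v
    have := h.2 X (E.admissible_iff.2 hX)
    rw [E.goal_eq hμ hX, E.goal_eq hμ hu] at this
    simp only [hXv] at this
    linarith
  · refine fun h => ⟨E.admissible_iff.2 hu, fun v hv => ?_⟩
    rw [E.goal_eq hμ hv.1, E.goal_eq hμ hu]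
    linarith [h fun i => (hv.1.apply i).toSpace]

/-- The marginal holding benefit of Agent `n` at the position `φ`. -/
noncomputable def marginal (n : Fin (K + 1)) (μ φ : Time T → Ω → Fin d → ℝ) (t : Time T) (ω : Ω) :
    Fin d → ℝ :=
  μ t ω - E.γ n • (E.cov *ᵥ (φ t ω + E.ζ n t ω))

theorem memL2_marginal (n : Fin (K + 1)) {φ : Time T → Ω → Fin d → ℝ} (hμ : MemL2 P F E.δ μ)
    (hφ : MemL2 P F E.δ φ) : MemL2 P F E.δ (E.marginal n μ φ) :=
  hμ.sub_pi ((memL2_mulVec E.cov (hφ.add_pi (E.ζ_mem n))).const_smul_pi (E.γ n))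

/-- The vanishing gradient of the concave goal: the marginal cost of trading equals the expected
discounted marginal benefit of the position over the remaining time. -/
theorem isOptimal_iff_adjoint (hμ : MemL2 P F E.δ μ) (hu : MemL2 P F E.δ u) :
    E.IsOptimal n μ u ↔ ∀ i, (2 * E.lam i) • (hu.apply i).toSpace =
      (integrationOp P F E.δ).adjoint
        ((E.memL2_marginal n hμ hu.integral_pi).apply i).toSpace := by
  rw [E.isOptimal_iff hμ hu,
    isMax_quadraticGoal_iff E.cov_symm E.lam_pos (E.γ_pos n).le E.cov_nonneg]
  refine forall_congr' fun i => ?_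
  have h : ((E.memL2_marginal n hμ hu.integral_pi).apply i).toSpace = (hμ.apply i).toSpace
      - E.γ n • ∑ j, E.cov i j • (integrationOp P F E.δ (hu.apply j).toSpace
        + ((E.ζ_mem n).apply j).toSpace) := by
    have h1 := memL2_mulVec E.cov (hu.integral_pi.add_pi (E.ζ_mem n))
    have h2 : ∀ j, ((hu.integral_pi.add_pi (E.ζ_mem n)).apply j).toSpace
        = integrationOp P F E.δ (hu.apply j).toSpace + ((E.ζ_mem n).apply j).toSpace := fun j => by
      rw [← hu.toSpace_integral_pi, ← MemL2.toSpace_add]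
    simp only [← h2]
    rw [← MemL2.toSpace_mulVec E.cov (hu.integral_pi.add_pi (E.ζ_mem n)),
      ← MemL2.toSpace_const_mul, ← MemL2.toSpace_sub]
    rfl
  rw [h]

theorem ae_position_eq_of_isOptimal (hμ : MemL2 P F E.δ μ) (hu : E.IsOptimal n μ u)
    (hv : E.IsOptimal n μ v) : ∀ᵐ ω ∂P, ∀ t, position v t ω = position u t ω := by
  refine position_congr (hv.1.1.ae_eq_of_toSpace_apply_eq hu.1.1 fun i => ?_)
  exact congrFun (eq_of_isMax_quadraticGoal E.cov_symm E.lam_pos (E.γ_pos n).le E.cov_nonneg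
    ((E.isOptimal_iff hμ hu.1.1).1 hu) ((E.isOptimal_iff hμ hv.1.1).1 hv)) i

end Market

/-- With weights `a n` the first part would be the square of `α = ∑ a_n y_n`, but such weights can
vanish. The shift by `ε` makes them positive and creates the mixed term `ε s α`, where `s = ∑ y_n`;
the diagonal part, at least `ε² ∑ y_n²`, absorbs it. -/
theorem sum_weighted_nonneg {K : ℕ} {a γ : Fin K → ℝ} {ε : ℝ} (ha : ∀ n, 0 ≤ a n) (hε : 0 < ε)
    (hγ : ∀ n, ε ≤ γ n) (y : Fin K → ℝ) :
    0 ≤ ∑ n, ∑ m, (a n + ε) * (a m / ((K : ℝ) + 1) + if n = m then γ n else 0) * (y n * y m) := by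
  have hN : (0 : ℝ) < (K : ℝ) + 1 := by positivity
  set α := ∑ m, a m * y m with hα
  set s := ∑ n, y n with hs
  set q := ∑ n, y n ^ 2 with hq
  have h1 : ∑ n, ∑ m, (a n + ε) * (a m / ((K : ℝ) + 1) + if n = m then γ n else 0) * (y n * y m)
      = (α + ε * s) * α / ((K : ℝ) + 1) + ∑ n, (a n + ε) * γ n * y n ^ 2 := by
    have h2 : ∀ n, ∑ m, (a n + ε) * (a m / ((K : ℝ) + 1) + if n = m then γ n else 0) * (y n * y m)
        = (a n * y n + ε * y n) * (α / ((K : ℝ) + 1)) + (a n + ε) * γ n * y n ^ 2 := by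
      intro n
      have h3 : ∀ m, (a n + ε) * (a m / ((K : ℝ) + 1) + if n = m then γ n else 0) * (y n * y m)
          = (a n * y n + ε * y n) / ((K : ℝ) + 1) * (a m * y m)
            + if n = m then (a n + ε) * γ n * y n ^ 2 else 0 := by
        intro m
        split_ifs with h
        · subst h
          ring
        · ring
      rw [Finset.sum_congr rfl fun m _ => h3 m, Finset.sum_add_distrib, ← Finset.mul_sum,
        Finset.sum_ite_eq Finset.univ n, if_pos (Finset.mem_univ n)]
      ring
    rw [Finset.sum_congr rfl fun n _ => h2 n, Finset.sum_add_distrib, ← Finset.sum_mul,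
      Finset.sum_add_distrib, ← Finset.mul_sum]
    ring
  have h4 : ε * ε * q ≤ ∑ n, (a n + ε) * γ n * y n ^ 2 := by
    rw [hq, Finset.mul_sum]
    refine Finset.sum_le_sum fun n _ => mul_le_mul_of_nonneg_right ?_ (sq_nonneg _)
    exact mul_le_mul (by linarith [ha n]) (hγ n) hε.le (by linarith [ha n])
  have h5 : s ^ 2 ≤ K * q := by
    have := sq_sum_le_card_mul_sum_sq (s := (Finset.univ : Finset (Fin K))) (f := y)
    simpa using this
  have hq0 : 0 ≤ q := Finset.sum_nonneg fun n _ => sq_nonneg _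
  -- Completing the square gives `(α + ε s) α ≥ -ε² s² / 4`, and `s² ≤ K q` by Cauchy-Schwarz.
  have h6 : -(ε * ε * q) ≤ (α + ε * s) * α / ((K : ℝ) + 1) := by
    rw [le_div_iff₀ hN]
    nlinarith [sq_nonneg (2 * α + ε * s), mul_nonneg (sq_nonneg ε) hq0,
      mul_le_mul_of_nonneg_left h5 (sq_nonneg ε), mul_nonneg (mul_nonneg (sq_nonneg ε) hq0)
      (Nat.cast_nonneg (α := ℝ) K)]
  rw [h1]
  linarith

theorem MemL2.measurable_uncurry_pi {Ω : Type*} {mΩ : MeasurableSpace Ω} {P : Measure Ω} {T : ℝ≥0∞}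
    {F : Filtration (Time T) mΩ} {δ : ℝ} {ι : Type*} [Fintype ι] {X : Time T → Ω → ι → ℝ}
    (hX : MemL2 P F δ X) : Measurable fun z : Time T × Ω => X z.1 z.2 :=
  (measurable_progSigma_iff.2 hX.1.isProgressive).mono (progSigma_le F) le_rfl

/-! ### The forward-backward system as a linear equation for the adjoint. -/

namespace Market

variable {Ω : Type*} {mΩ : MeasurableSpace Ω} {P : Measure Ω} {T : ℝ≥0∞}
  {F : Filtration (Time T) mΩ} {K d : ℕ} (E : Market P F K d)

theorem halfRatio_apply (i j : Fin d) : E.halfRatio i j = E.cov i j / (2 * E.lam i) := by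
  have h : E.cost⁻¹ = Matrix.diagonal fun i => (E.lam i)⁻¹ := by
    refine Matrix.inv_eq_right_inv ?_
    rw [cost, Matrix.diagonal_mul_diagonal, ← Matrix.diagonal_one]
    congr 1
    funext i
    exact mul_inv_cancel₀ (E.lam_pos i).ne'
  rw [halfRatio, h, Matrix.smul_apply, Matrix.diagonal_mul, smul_eq_mul]
  have := (E.lam_pos i).ne'
  field_simp

theorem sum_cov_mul (x y : Fin d → ℝ) : ∑ i, ∑ j, E.cov i j * (x i * y j)
    = ∑ k, (∑ i, E.σ i k * x i) * ∑ j, E.σ j k * y j := by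
  have h : ∀ k, (∑ i, E.σ i k * x i) * ∑ j, E.σ j k * y j
      = ∑ i, ∑ j, E.σ i k * E.σ j k * (x i * y j) := fun k => by
    rw [Finset.sum_mul_sum]
    exact Finset.sum_congr rfl fun i _ => Finset.sum_congr rfl fun j _ => by ring
  simp only [h, cov, Matrix.mul_apply, Matrix.transpose_apply, Finset.sum_mul]
  calc _ = ∑ i, ∑ k, ∑ j, E.σ i k * E.σ j k * (x i * y j) :=
        Finset.sum_congr rfl fun i _ => Finset.sum_comm
    _ = ∑ k, ∑ i, ∑ j, E.σ i k * E.σ j k * (x i * y j) := Finset.sum_comm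

/-- The weight `λ_i (γ^N - γ^n + ε)`, with `ε` the smallest risk aversion, cancels `Λ⁻¹` and leaves
`Σ = σ σᵀ`. Expanding along the columns of `σ` separates the assets and leads to the scalar form of
`sum_weighted_nonneg` with `a n = γ^N - γ^n ≥ 0`. -/
theorem exists_weight : ∃ w : Fin K × Fin d → ℝ, (∀ p, 0 < w p) ∧
    ∀ x : Fin K × Fin d → ℝ, 0 ≤ ∑ p, ∑ q, w p * E.B p q * (x p * x q) := by
  obtain ⟨n₀, hn₀⟩ := Finite.exists_min E.γ
  set ε := E.γ n₀ with hε
  have hε0 : 0 < ε := E.γ_pos n₀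
  have ha : ∀ n : Fin K, 0 ≤ E.γN - E.γ n.castSucc := fun n => sub_nonneg.2 (E.γ_le_last _)
  refine ⟨fun p => E.lam p.2 * (E.γN - E.γ p.1.castSucc + ε), fun p =>
    mul_pos (E.lam_pos _) (by linarith [ha p.1]), fun x => ?_⟩
  set c : Fin K → Fin K → ℝ := fun n m => (E.γN - E.γ n.castSucc + ε) *
    ((E.γN - E.γ m.castSucc) / ((K : ℝ) + 1) + if n = m then E.γ n.castSucc else 0) with hc
  set y : Fin K → Fin d → ℝ := fun n k => ∑ i, E.σ i k * x (n, i) with hy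
  have h1 : ∑ p, ∑ q, E.lam p.2 * (E.γN - E.γ p.1.castSucc + ε) * E.B p q * (x p * x q)
      = ∑ k, 1 / 2 * ∑ n, ∑ m, c n m * (y n k * y m k) := by
    have h2 : ∀ n i m j, E.lam i * (E.γN - E.γ n.castSucc + ε) * E.B (n, i) (m, j)
        * (x (n, i) * x (m, j)) = 1 / 2 * c n m * (E.cov i j * (x (n, i) * x (m, j))) := by
      intro n i m j
      have := (E.lam_pos i).ne'
      simp only [B, Matrix.of_apply, halfRatio_apply, hc]
      field_simp
    simp only [Fintype.sum_prod_type, h2]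
    calc _ = ∑ n, ∑ m, ∑ i, ∑ j, 1 / 2 * c n m * (E.cov i j * (x (n, i) * x (m, j))) :=
          Finset.sum_congr rfl fun n _ => Finset.sum_comm
      _ = ∑ n, ∑ m, ∑ k, 1 / 2 * (c n m * (y n k * y m k)) := by
          refine Finset.sum_congr rfl fun n _ => Finset.sum_congr rfl fun m _ => ?_
          simp only [← Finset.mul_sum]
          rw [E.sum_cov_mul (fun i => x (n, i)) fun j => x (m, j), mul_assoc]
      _ = ∑ n, ∑ k, ∑ m, 1 / 2 * (c n m * (y n k * y m k)) :=
          Finset.sum_congr rfl fun n _ => Finset.sum_comm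
      _ = ∑ k, ∑ n, ∑ m, 1 / 2 * (c n m * (y n k * y m k)) := Finset.sum_comm
      _ = _ := by simp only [Finset.mul_sum]
  rw [h1]
  exact Finset.sum_nonneg fun k _ => mul_nonneg (by norm_num)
    (sum_weighted_nonneg ha hε0 (fun n => hn₀ _) fun n => y n k)

/-- The backward source term `A ζ - B φ - χ`. -/
noncomputable def source (φ : Time T → Ω → (Fin K × Fin d → ℝ)) (t : Time T) (ω : Ω) :
    Fin K × Fin d → ℝ :=
  E.A *ᵥ E.stackedζ t ω - E.χ t ω - E.B *ᵥ φ t ω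

variable [IsProbabilityMeasure P] {φ φrate M u v : Time T → Ω → (Fin K × Fin d → ℝ)}

theorem memL2_exogenous : MemL2 P F E.δ fun t ω => E.A *ᵥ E.stackedζ t ω - E.χ t ω := by
  have h1 : MemL2 P F E.δ E.stackedζ := memL2_pi_iff.2 fun q => (E.ζ_mem q.1).apply q.2
  have h2 : MemL2 P F E.δ E.χ := memL2_pi_iff.2 fun p =>
    ((((memL2_mulVec E.halfRatio E.ψ_mem).const_smul_pi E.γN).add_pi
      (E.ψrate_mem.const_smul_pi E.δ)).sub_pi E.μψ_mem).apply p.2 |>.const_mul _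
  exact (memL2_mulVec E.A h1).sub_pi h2

theorem memL2_source (hφ : MemL2 P F E.δ φ) : MemL2 P F E.δ (E.source φ) :=
  E.memL2_exogenous.sub_pi (memL2_mulVec E.B hφ)

/-- The rate `u` represents the backward equation through the adjoint of integration in time. -/
def IsAdjointSolution (hu : MemL2 P F E.δ u) : Prop :=
  ∀ p, (hu.apply p).toSpace = (integrationOp P F E.δ).adjoint
    ((E.memL2_source hu.integral_pi).apply p).toSpace

/-- The source is affine in the position `V u`; collecting the unknown on the left produces the Gram
operator `V* V`. -/
theorem isAdjointSolution_iff (hu : MemL2 P F E.δ u) : E.IsAdjointSolution hu ↔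
    ∀ p, (hu.apply p).toSpace + ∑ q, E.B p q • (integrationOp P F E.δ).adjoint
      (integrationOp P F E.δ (hu.apply q).toSpace) =
      (integrationOp P F E.δ).adjoint (E.memL2_exogenous.apply p).toSpace := by
  refine forall_congr' fun p => ?_
  have h : ((E.memL2_source hu.integral_pi).apply p).toSpace = (E.memL2_exogenous.apply p).toSpace
      - ∑ q, E.B p q • integrationOp P F E.δ (hu.apply q).toSpace := by
    simp only [← hu.toSpace_integral_pi]
    rw [← hu.integral_pi.toSpace_mulVec, ← MemL2.toSpace_sub]
    rfl
  rw [h, map_sub, map_sum, eq_sub_iff_add_eq]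
  simp only [map_smul]

theorem IsAdjointSolution.ae_eq {hu : MemL2 P F E.δ u} {hv : MemL2 P F E.δ v}
    (h : E.IsAdjointSolution hu) (h' : E.IsAdjointSolution hv) :
    ∀ᵐ z ∂((timeMeasure T).prod P), u z.1 z.2 = v z.1 z.2 := by
  obtain ⟨w, hw, hB⟩ := E.exists_weight
  have := (existsUnique_add_sum_adjoint (integrationOp P F E.δ) E.B w hw hB fun p =>
    (integrationOp P F E.δ).adjoint (E.memL2_exogenous.apply p).toSpace).unique
    ((E.isAdjointSolution_iff hu).1 h) ((E.isAdjointSolution_iff hv).1 h')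
  exact hu.ae_eq_of_toSpace_apply_eq hv fun p => congrFun this p

theorem exists_isAdjointSolution : ∃ (u : Time T → Ω → (Fin K × Fin d → ℝ))
    (hu : MemL2 P F E.δ u), E.IsAdjointSolution hu := by
  obtain ⟨w, hw, hB⟩ := E.exists_weight
  obtain ⟨f, hf, -⟩ := existsUnique_add_sum_adjoint (integrationOp P F E.δ) E.B w hw hB fun p =>
    (integrationOp P F E.δ).adjoint (E.memL2_exogenous.apply p).toSpace
  obtain ⟨X, hX, hXf⟩ := exists_toSpace_apply_eq E.δ f
  refine ⟨X, hX, (E.isAdjointSolution_iff hX).2 ?_⟩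
  simpa only [hXf] using hf

theorem ae_source_eq {φ₂ : Time T → Ω → (Fin K × Fin d → ℝ)} (hφ : MemL2 P F E.δ φ)
    (hφ₂ : MemL2 P F E.δ φ₂) (h : ∀ᵐ ω ∂P, ∀ t, φ t ω = φ₂ t ω) :
    ∀ᵐ z ∂((timeMeasure T).prod P), E.source φ z.1 z.2 = E.source φ₂ z.1 z.2 := by
  have := ae_prod_of_ae_forall (p := fun t ω => φ t ω = φ₂ t ω)
    (measurableSet_eq_fun hφ.measurable_uncurry_pi hφ₂.measurable_uncurry_pi) h
  filter_upwards [this] with z hz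
  simp only [source, hz]

variable {E}

/-- The drift of the rate is `δ φrate` minus the source, so coordinatewise the system is a backward
equation whose driver is the source. -/
theorem IsFBSDESolution.isBackward (h : E.IsFBSDESolution φ φrate M) (p : Fin K × Fin d) :
    IsBackward P F E.δ (fun t ω => φrate t ω p) (fun t ω => E.source φ t ω p) := by
  have hg := E.memL2_source h.mem
  have hD : MemL2 P F E.δ fun s ω => E.δ • φrate s ω - E.source φ s ω :=
    (h.rate_mem.const_smul_pi E.δ).sub_pi hg
  have hDeq : (fun s ω => E.B *ᵥ φ s ω + E.δ • φrate s ω - E.A *ᵥ E.stackedζ s ω + E.χ s ω)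
      = fun s ω => E.δ • φrate s ω - E.source φ s ω := by
    funext s ω
    simp only [source]
    abel
  refine isBackward_of_martingale (h.rate_mem.apply p) (hg.apply p) (h.martingale.apply p)
    (fun t => ?_) fun t ht => ?_
  · have h1 := h.backward t
    rw [hDeq] at h1
    filter_upwards [h1, ae_position_apply hD] with ω h2 h3
    rw [h2, Pi.add_apply, Pi.add_apply, Pi.sub_apply, h3]
    rfl
  · filter_upwards [h.terminal t ht] with ω h2
    rw [h2]
    rfl

theorem IsFBSDESolution.isAdjointSolution (h : E.IsFBSDESolution φ φrate M) :
    E.IsAdjointSolution h.rate_mem := by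
  intro p
  rw [(h.isBackward p).toSpace_eq (h.rate_mem.apply p) ((E.memL2_source h.mem).apply p)]
  congr 1
  rw [MemL2.toSpace_eq_iff]
  filter_upwards [E.ae_source_eq h.mem h.rate_mem.integral_pi h.forward] with z hz
  rw [hz]

theorem IsFBSDESolution.unique {φ₂ φrate₂ M₂ : Time T → Ω → (Fin K × Fin d → ℝ)}
    (h : E.IsFBSDESolution φ φrate M) (h₂ : E.IsFBSDESolution φ₂ φrate₂ M₂) :
    (∀ᵐ ω ∂P, ∀ t, φ₂ t ω = φ t ω) ∧ ∀ t, φrate₂ t =ᵐ[P] φrate t := by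
  have h1 := h₂.isAdjointSolution.ae_eq E h.isAdjointSolution
  have h2 : ∀ᵐ ω ∂P, ∀ t, φ₂ t ω = φ t ω := by
    filter_upwards [position_congr h1, h.forward, h₂.forward] with ω e1 e2 e3 t
    rw [e2, e3, e1]
  refine ⟨h2, fun t => ?_⟩
  -- The Hilbert space only identifies the rates at almost all times. The conditional expectation
  -- formula depends on the source only up to null sets and fixes the rate at each time.
  have h3 : ∀ p, (fun ω => φrate₂ t ω p) =ᵐ[P] fun ω => φrate t ω p := fun p =>
    ((h₂.isBackward p).congr ((E.ae_source_eq h₂.mem h.mem h2).mono fun z hz => by rw [hz]) t).trans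
      (h.isBackward p t).symm
  filter_upwards [ae_all_iff.2 h3] with ω hω
  exact funext hω

variable (E)

theorem exists_isFBSDESolution : ∃ φ φrate M, E.IsFBSDESolution φ φrate M := by
  obtain ⟨X, hX, hsol⟩ := E.exists_isAdjointSolution
  have hgX := E.memL2_source hX.integral_pi
  -- The Hilbert space solution `X` is known only up to null sets. The backward process of its
  -- source is a version of `X` that satisfies the equation at every time and the terminal
  -- condition.
  choose y hy hb using fun p => (hgX.apply p).exists_isBackward
  set φrate : Time T → Ω → (Fin K × Fin d → ℝ) := fun t ω p => y p t ω with hφrate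
  have hr : MemL2 P F E.δ φrate := memL2_pi_iff.2 hy
  have hXr : ∀ᵐ z ∂((timeMeasure T).prod P), X z.1 z.2 = φrate z.1 z.2 :=
    hX.ae_eq_of_toSpace_apply_eq hr fun p =>
      (hsol p).trans ((hb p).toSpace_eq (hy p) (hgX.apply p)).symm
  have hg := E.memL2_source hr.integral_pi
  have hsrc := E.ae_source_eq hX.integral_pi hr.integral_pi (position_congr hXr)
  have hb' : ∀ p, IsBackward P F E.δ (y p) fun t ω => E.source (position φrate) t ω p := fun p =>
    (hb p).congr (hsrc.mono fun z hz => by rw [hz])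
  have hD : ∀ p, MemL2 P F E.δ fun s ω => E.δ * y p s ω - E.source (position φrate) s ω p :=
    fun p => ((hy p).const_mul E.δ).sub (hg.apply p)
  refine ⟨position φrate, φrate, fun t ω p => y p t ω -
    position (fun s ω => E.δ * y p s ω - E.source (position φrate) s ω p) t ω,
    hr.integral_pi, hr, ?_, ?_, ?_, ?_, ?_⟩
  · exact martingale_pi fun p => (hb' p).martingale (hy p) (hg.apply p)
  · exact fun t => MemLp.of_eval fun p =>
      ((hb' p).memLp (hg.apply p) t).sub ((hD p).memLp_position t)
  · exact ae_of_all _ fun ω t => rfl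
  · intro t
    have hDeq : (fun s ω => E.B *ᵥ position φrate s ω + E.δ • φrate s ω
        - E.A *ᵥ E.stackedζ s ω + E.χ s ω)
        = fun s ω => E.δ • φrate s ω - E.source (position φrate) s ω := by
      funext s ω
      simp only [source]
      abel
    rw [hDeq]
    filter_upwards [ae_position_apply ((hr.const_smul_pi E.δ).sub_pi hg)] with ω hω
    funext p
    have h0 : position (fun s ω => E.δ * y p s ω - E.source (position φrate) s ω p) ⊥ ω = 0 := by
      rw [position, setIntegral_measure_zero]
      rw [timeMeasure_Iic]
      exact ENNReal.ofReal_zero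
    rw [Pi.add_apply, Pi.add_apply, Pi.sub_apply, hω, h0]
    simp only [Pi.sub_apply, Pi.smul_apply, smul_eq_mul, hφrate]
    ring
  · intro t ht
    have h0 : ∀ p, y p t =ᵐ[P] 0 := by
      intro p
      have h1 : remaining E.δ (fun t ω => E.source (position φrate) t ω p) t = 0 := by
        funext ω
        have : Set.Ioi t = ∅ := Set.eq_empty_of_forall_notMem fun x hx => by
          have h2 : ENNReal.ofReal t < ENNReal.ofReal x :=
            (ENNReal.ofReal_lt_ofReal_iff_of_nonneg t.coe_nonneg).2 hx
          exact absurd x.2.2 (not_le.2 (ht.symm.trans_lt h2))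
        rw [remaining, this, setIntegral_empty]
        rfl
      filter_upwards [hb' p t] with ω hω
      rw [hω, h1, condExp_zero]
      simp
    filter_upwards [ae_all_iff.2 h0] with ω hω
    exact funext hω

end Market

/-! ### Market clearing and the formula for the return. -/

namespace Market

variable {Ω : Type*} {mΩ : MeasurableSpace Ω} {P : Measure Ω} {T : ℝ≥0∞}
  {F : Filtration (Time T) mΩ} {K d : ℕ} (E : Market P F K d)
  {φ φrate : Time T → Ω → (Fin K × Fin d → ℝ)} {ν : Time T → Ω → Fin d → ℝ}

@[simp] theorem agentPosition_castSucc (m : Fin K) (t : Time T) (ω : Ω) :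
    E.agentPosition φ m.castSucc t ω = fun i => φ t ω (m, i) := by
  simp [agentPosition]

@[simp] theorem agentPosition_last (t : Time T) (ω : Ω) : E.agentPosition φ (Fin.last K) t ω
    = -(∑ m : Fin K, fun i => φ t ω (m, i)) - E.ψ t ω := by
  simp [agentPosition]

@[simp] theorem agentRate_castSucc (m : Fin K) (t : Time T) (ω : Ω) :
    E.agentRate φrate m.castSucc t ω = fun i => φrate t ω (m, i) := by
  simp [agentRate]

@[simp] theorem agentRate_last (t : Time T) (ω : Ω) : E.agentRate φrate (Fin.last K) t ω
    = -(∑ m : Fin K, fun i => φrate t ω (m, i)) - E.ψrate t ω := by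
  simp [agentRate]

theorem sum_agentPosition (t : Time T) (ω : Ω) :
    ∑ n, E.agentPosition φ n t ω + E.ψ t ω = 0 := by
  rw [Fin.sum_univ_castSucc, agentPosition_last]
  simp only [agentPosition_castSucc]
  abel

theorem two_lam_mul_B_mulVec (x : Fin K × Fin d → ℝ) (m : Fin K) (i : Fin d) :
    2 * E.lam i * (E.B *ᵥ x) (m, i) =
      ∑ n : Fin K, (E.γN - E.γ n.castSucc) / ((K : ℝ) + 1) * (E.cov *ᵥ fun i => x (n, i)) i
        + E.γ m.castSucc * (E.cov *ᵥ fun i => x (m, i)) i := by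
  have hi := (E.lam_pos i).ne'
  have h : ∀ n, 2 * E.lam i * ∑ j, E.B (m, i) (n, j) * x (n, j) =
      (E.γN - E.γ n.castSucc) / ((K : ℝ) + 1) * (E.cov *ᵥ fun i => x (n, i)) i
      + if m = n then E.γ m.castSucc * (E.cov *ᵥ fun i => x (m, i)) i else 0 := by
    intro n
    have h2 : (if m = n then E.γ m.castSucc * (E.cov *ᵥ fun i => x (m, i)) i else 0)
        = (if m = n then E.γ m.castSucc else 0) * (E.cov *ᵥ fun i => x (n, i)) i := by
      split_ifs with h
      · rw [h]
      · rw [zero_mul]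
    rw [h2, ← add_mul]
    simp only [B, Matrix.of_apply, halfRatio_apply, Matrix.mulVec, dotProduct, Finset.mul_sum]
    refine Finset.sum_congr rfl fun j _ => ?_
    field_simp
  simp only [Matrix.mulVec, dotProduct, Fintype.sum_prod_type]
  rw [Finset.mul_sum, Finset.sum_congr rfl fun n _ => h n, Finset.sum_add_distrib,
    Finset.sum_ite_eq Finset.univ m, if_pos (Finset.mem_univ m)]
  rfl

theorem two_lam_mul_A_mulVec (t : Time T) (ω : Ω) (m : Fin K) (i : Fin d) :
    2 * E.lam i * (E.A *ᵥ E.stackedζ t ω) (m, i) =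
      ∑ n, E.γ n / ((K : ℝ) + 1) * (E.cov *ᵥ E.ζ n t ω) i
        - E.γ m.castSucc * (E.cov *ᵥ E.ζ m.castSucc t ω) i := by
  have hi := (E.lam_pos i).ne'
  have h : ∀ n, 2 * E.lam i * ∑ j, E.A (m, i) (n, j) * E.stackedζ t ω (n, j) =
      E.γ n / ((K : ℝ) + 1) * (E.cov *ᵥ E.ζ n t ω) i
      - if m.castSucc = n then E.γ m.castSucc * (E.cov *ᵥ E.ζ m.castSucc t ω) i else 0 := by
    intro n
    have h2 : (if m.castSucc = n then E.γ m.castSucc * (E.cov *ᵥ E.ζ m.castSucc t ω) i else 0)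
        = (if m.castSucc = n then E.γ m.castSucc else 0) * (E.cov *ᵥ E.ζ n t ω) i := by
      split_ifs with h
      · rw [h]
      · rw [zero_mul]
    rw [h2, ← sub_mul]
    simp only [A, Matrix.of_apply, halfRatio_apply, Matrix.mulVec, dotProduct, Finset.mul_sum,
      stackedζ]
    refine Finset.sum_congr rfl fun j _ => ?_
    field_simp
  simp only [Matrix.mulVec, dotProduct, Fintype.sum_prod_type]
  rw [Finset.mul_sum, Finset.sum_congr rfl fun n _ => h n, Finset.sum_sub_distrib,
    Finset.sum_ite_eq Finset.univ m.castSucc, if_pos (Finset.mem_univ _)]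
  rfl

theorem two_lam_mul_χ (t : Time T) (ω : Ω) (m : Fin K) (i : Fin d) :
    2 * E.lam i * E.χ t ω (m, i) = E.γN / ((K : ℝ) + 1) * (E.cov *ᵥ E.ψ t ω) i
      + 2 / ((K : ℝ) + 1) * (E.lam i * (E.δ * E.ψrate t ω i - E.μψ t ω i)) := by
  have hi := (E.lam_pos i).ne'
  have h : (E.halfRatio *ᵥ E.ψ t ω) i = (E.cov *ᵥ E.ψ t ω) i / (2 * E.lam i) := by
    simp only [Matrix.mulVec, dotProduct, halfRatio_apply, Finset.sum_div]
    exact Finset.sum_congr rfl fun j _ => by ring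
  simp only [χ, Pi.add_apply, Pi.sub_apply, Pi.smul_apply, smul_eq_mul, h]
  field_simp
  ring

theorem equilibriumReturn_apply (t : Time T) (ω : Ω) (i : Fin d) : E.equilibriumReturn φ t ω i =
    ∑ n : Fin K, (E.γ n.castSucc - E.γN) / ((K : ℝ) + 1) * (E.cov *ᵥ fun i => φ t ω (n, i)) i
      + ∑ n, E.γ n / ((K : ℝ) + 1) * (E.cov *ᵥ E.ζ n t ω) i
      - E.γN / ((K : ℝ) + 1) * (E.cov *ᵥ E.ψ t ω) i
      + 2 / ((K : ℝ) + 1) * (E.lam i * (E.μψ t ω i - E.δ * E.ψrate t ω i)) := by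
  simp only [equilibriumReturn, cost, Pi.add_apply, Pi.sub_apply, Finset.sum_apply, Pi.smul_apply,
    smul_eq_mul, Matrix.mulVec_diagonal]

theorem marginal_apply (n : Fin (K + 1)) (ψ₁ : Time T → Ω → Fin d → ℝ) (t : Time T) (ω : Ω)
    (i : Fin d) : E.marginal n ν ψ₁ t ω i
      = ν t ω i - E.γ n * ((E.cov *ᵥ ψ₁ t ω) i + (E.cov *ᵥ E.ζ n t ω) i) := by
  simp only [marginal, Pi.sub_apply, Pi.smul_apply, smul_eq_mul, Matrix.mulVec_add, Pi.add_apply]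

/-- The link between the two descriptions: with the stated return, the first-order conditions of the
Agents `1, …, N - 1` are exactly the rows of the forward-backward system. Agent `N` has been
eliminated by market clearing. -/
theorem two_lam_mul_source (t : Time T) (ω : Ω) (m : Fin K) (i : Fin d) :
    2 * E.lam i * E.source φ t ω (m, i) =
      E.marginal m.castSucc (E.equilibriumReturn φ) (E.agentPosition φ m.castSucc) t ω i := by
  have h : ∑ n : Fin K, (E.γ n.castSucc - E.γN) / ((K : ℝ) + 1) * (E.cov *ᵥ fun i => φ t ω (n, i)) i
      = -∑ n : Fin K, (E.γN - E.γ n.castSucc) / ((K : ℝ) + 1)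
        * (E.cov *ᵥ fun i => φ t ω (n, i)) i := by
    rw [← Finset.sum_neg_distrib]
    exact Finset.sum_congr rfl fun n _ => by ring
  rw [marginal_apply, equilibriumReturn_apply, agentPosition_castSucc, h]
  simp only [source, Pi.sub_apply]
  rw [mul_sub, mul_sub, two_lam_mul_B_mulVec, two_lam_mul_A_mulVec, two_lam_mul_χ]
  ring

/-- Writing the position of Agent `N` through clearing turns `∑ γ^n Σ φ^n` into `∑ (γ^n - γ^N) Σ φ^n
- γ^N Σ ψ`, which cancels against `N` times the return together with the endowment terms. Only the
drift of the noise traders remains. -/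
theorem sum_marginal (t : Time T) (ω : Ω) (i : Fin d) :
    ∑ n, E.marginal n (E.equilibriumReturn φ) (E.agentPosition φ n) t ω i
      = 2 * E.lam i * (E.μψ t ω i - E.δ * E.ψrate t ω i) := by
  have hN : ((K : ℝ) + 1) ≠ 0 := by positivity
  have h1 : (E.cov *ᵥ E.agentPosition φ (Fin.last K) t ω) i
      = -(∑ m : Fin K, (E.cov *ᵥ fun i => φ t ω (m, i)) i) - (E.cov *ᵥ E.ψ t ω) i := by
    rw [agentPosition_last, Matrix.mulVec_sub, Matrix.mulVec_neg, Matrix.mulVec_sum, Pi.sub_apply,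
      Pi.neg_apply, Finset.sum_apply]
  have h2 : ∑ n, E.γ n * (E.cov *ᵥ E.agentPosition φ n t ω) i
      = ∑ m : Fin K, (E.γ m.castSucc - E.γN) * (E.cov *ᵥ fun i => φ t ω (m, i)) i
        - E.γN * (E.cov *ᵥ E.ψ t ω) i := by
    rw [Fin.sum_univ_castSucc, h1]
    simp only [agentPosition_castSucc, sub_mul, Finset.sum_sub_distrib, ← Finset.mul_sum]
    rw [γN]
    ring
  have h3 : ((K : ℝ) + 1) * E.equilibriumReturn φ t ω i
      = ∑ m : Fin K, (E.γ m.castSucc - E.γN) * (E.cov *ᵥ fun i => φ t ω (m, i)) i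
        + ∑ n, E.γ n * (E.cov *ᵥ E.ζ n t ω) i - E.γN * (E.cov *ᵥ E.ψ t ω) i
        + 2 * E.lam i * (E.μψ t ω i - E.δ * E.ψrate t ω i) := by
    rw [equilibriumReturn_apply]
    simp only [div_mul_eq_mul_div, ← Finset.sum_div]
    field_simp
  simp only [marginal_apply, mul_add, Finset.sum_sub_distrib, Finset.sum_add_distrib, h2]
  rw [Finset.sum_const, Finset.card_univ, Fintype.card_fin, nsmul_eq_mul]
  push_cast
  rw [h3]
  ring

/-- The summed marginal benefit is affine in the return with slope `N = K + 1`, so its value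
determines the return. -/
theorem eq_equilibriumReturn {t : Time T} {ω : Ω} (h : ∀ i, ∑ n, E.marginal n ν
    (E.agentPosition φ n) t ω i = 2 * E.lam i * (E.μψ t ω i - E.δ * E.ψrate t ω i)) :
    ν t ω = E.equilibriumReturn φ t ω := by
  funext i
  have h1 := (h i).trans (E.sum_marginal (φ := φ) t ω i).symm
  simp only [marginal_apply, Finset.sum_sub_distrib, sub_left_inj] at h1
  rw [Finset.sum_const, Finset.sum_const, Finset.card_univ, Fintype.card_fin, nsmul_eq_mul,
    nsmul_eq_mul] at h1
  exact mul_left_cancel₀ (by positivity) h1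

end Market

/-! ### Rates are determined by positions. -/

section

variable {Ω : Type*} {mΩ : MeasurableSpace Ω} {P : Measure Ω} [IsProbabilityMeasure P] {T : ℝ≥0∞}
  {F : Filtration (Time T) mΩ} {δ : ℝ} [hδ : Discount T δ]

theorem MemL2.ae_eq_zero_of_position {X : Time T → Ω → ℝ} (hX : MemL2 P F δ X)
    (h : ∀ᵐ ω ∂P, ∀ t, position X t ω = 0) : ∀ᵐ z ∂((timeMeasure T).prod P), X z.1 z.2 = 0 := by
  have hm : MeasurableSet {z : Time T × Ω | X z.1 z.2 = 0} :=
    measurableSet_eq_fun hX.measurable measurable_const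
  refine ae_prod_of_ae_ae (p := fun t ω => X t ω = 0) hm
    ((Measure.ae_ae_comm (p := fun t ω => X t ω = 0) hm).2 ?_)
  filter_upwards [h, hX.ae_integrableOn] with ω h1 h2
  exact ae_eq_zero_of_setIntegral_Iic h2 h1

theorem MemL2.ae_position_sum {ι : Type*} (s : Finset ι) {X : ι → Time T → Ω → ℝ}
    (hX : ∀ i ∈ s, MemL2 P F δ (X i)) :
    ∀ᵐ ω ∂P, ∀ t, position (fun t ω => ∑ i ∈ s, X i t ω) t ω = ∑ i ∈ s, position (X i) t ω := by
  have h1 : ∀ᵐ ω ∂P, ∀ i ∈ s, ∀ t, IntegrableOn (fun r => X i r ω) (Set.Iic t) (timeMeasure T) :=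
    (ae_ball_iff s.countable_toSet).2 fun i hi => (hX i hi).ae_integrableOn
  filter_upwards [h1] with ω hω t
  exact integral_finsetSum s fun i hi => hω i hi t

end

/-! ### Verification and uniqueness of the equilibrium. -/

namespace Market

variable {Ω : Type*} {mΩ : MeasurableSpace Ω} {P : Measure Ω} [IsProbabilityMeasure P] {T : ℝ≥0∞}
  {F : Filtration (Time T) mΩ} {K d : ℕ} (E : Market P F K d)
  {φ φrate M : Time T → Ω → (Fin K × Fin d → ℝ)} {ν : Time T → Ω → Fin d → ℝ}

theorem memL2_equilibriumReturn (hφ : MemL2 P F E.δ φ) :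
    MemL2 P F E.δ (E.equilibriumReturn φ) := by
  have h1 : ∀ n : Fin K, MemL2 P F E.δ fun t ω => ((E.γ n.castSucc - E.γN) / ((K : ℝ) + 1)) •
      (E.cov *ᵥ fun i => φ t ω (n, i)) := fun n =>
    (memL2_mulVec E.cov (memL2_pi_iff.2 fun i => hφ.apply (n, i))).const_smul_pi _
  have h2 : ∀ n, MemL2 P F E.δ fun t ω => (E.γ n / ((K : ℝ) + 1)) • (E.cov *ᵥ E.ζ n t ω) :=
    fun n => (memL2_mulVec E.cov (E.ζ_mem n)).const_smul_pi _
  exact (((memL2_sum_pi Finset.univ fun n _ => h1 n).add_pi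
    (memL2_sum_pi Finset.univ fun n _ => h2 n)).sub_pi
    ((memL2_mulVec E.cov E.ψ_mem).const_smul_pi _)).add_pi
    ((memL2_mulVec E.cost (E.μψ_mem.sub_pi (E.ψrate_mem.const_smul_pi E.δ))).const_smul_pi _)

theorem memL2_agentRate (h : MemL2 P F E.δ φrate) (n : Fin (K + 1)) :
    MemL2 P F E.δ (E.agentRate φrate n) := by
  have h1 : ∀ m : Fin K, MemL2 P F E.δ fun t ω i => φrate t ω (m, i) := fun m =>
    memL2_pi_iff.2 fun i => h.apply (m, i)
  refine Fin.lastCases ?_ (fun m => ?_) n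
  · rw [show E.agentRate φrate (Fin.last K) = fun t ω => -(∑ m : Fin K, fun i => φrate t ω (m, i))
      - E.ψrate t ω from funext₂ fun t ω => E.agentRate_last t ω]
    exact (memL2_sum_pi Finset.univ fun m _ => h1 m).neg_pi.sub_pi E.ψrate_mem
  · rw [show E.agentRate φrate m.castSucc = fun t ω i => φrate t ω (m, i) from
      funext₂ fun t ω => E.agentRate_castSucc m t ω]
    exact h1 m

theorem memL2_agentPosition (h : MemL2 P F E.δ φ) (n : Fin (K + 1)) :
    MemL2 P F E.δ (E.agentPosition φ n) := by
  have h1 : ∀ m : Fin K, MemL2 P F E.δ fun t ω i => φ t ω (m, i) := fun m =>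
    memL2_pi_iff.2 fun i => h.apply (m, i)
  refine Fin.lastCases ?_ (fun m => ?_) n
  · rw [show E.agentPosition φ (Fin.last K) = fun t ω => -(∑ m : Fin K, fun i => φ t ω (m, i))
      - E.ψ t ω from funext₂ fun t ω => E.agentPosition_last t ω]
    exact (memL2_sum_pi Finset.univ fun m _ => h1 m).neg_pi.sub_pi E.ψ_mem
  · rw [show E.agentPosition φ m.castSucc = fun t ω i => φ t ω (m, i) from
      funext₂ fun t ω => E.agentPosition_castSucc m t ω]
    exact h1 m

theorem ae_position_agentRate (h : MemL2 P F E.δ φrate)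
    (hφ : ∀ᵐ ω ∂P, ∀ t, φ t ω = position φrate t ω) (n : Fin (K + 1)) :
    ∀ᵐ ω ∂P, ∀ t, position (E.agentRate φrate n) t ω = E.agentPosition φ n t ω := by
  have hint : ∀ᵐ ω ∂P, ∀ p t, IntegrableOn (fun r => φrate r ω p) (Set.Iic t) (timeMeasure T) :=
    ae_all_iff.2 fun p => (h.apply p).ae_integrableOn
  have hint' : ∀ᵐ ω ∂P, ∀ i t, IntegrableOn (fun r => E.ψrate r ω i) (Set.Iic t) (timeMeasure T) :=
    ae_all_iff.2 fun i => (E.ψrate_mem.apply i).ae_integrableOn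
  filter_upwards [hint, hint', hφ, E.ψ_eq, ae_position_apply h, ae_position_apply E.ψrate_mem,
    ae_position_apply (E.memL2_agentRate h n)] with ω h1 h2 h3 h4 h5 h6 h7 t
  funext i
  rw [h7]
  induction n using Fin.lastCases with
  | last =>
    simp only [agentRate_last, agentPosition_last, Pi.sub_apply, Pi.neg_apply, Finset.sum_apply, h3,
      h4, h5, h6]
    have i1 : Integrable (fun r => -∑ m : Fin K, φrate r ω (m, i))
        ((timeMeasure T).restrict (Set.Iic t)) :=
      (integrable_finsetSum _ fun m _ => h1 (m, i) t).neg
    unfold position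
    rw [integral_sub i1 (h2 i t), integral_neg, integral_finsetSum _ fun m _ => h1 (m, i) t]
  | cast m =>
    simp only [agentRate_castSucc, agentPosition_castSucc, h3, h5]

theorem ae_marginal_eq (n : Fin (K + 1)) {φ₁ φ₂ : Time T → Ω → Fin d → ℝ}
    (h₁ : MemL2 P F E.δ φ₁) (h₂ : MemL2 P F E.δ φ₂) (h : ∀ᵐ ω ∂P, ∀ t, φ₁ t ω = φ₂ t ω) :
    ∀ᵐ z ∂((timeMeasure T).prod P), E.marginal n ν φ₁ z.1 z.2 = E.marginal n ν φ₂ z.1 z.2 := by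
  have := ae_prod_of_ae_forall (p := fun t ω => φ₁ t ω = φ₂ t ω)
    (measurableSet_eq_fun h₁.measurable_uncurry_pi h₂.measurable_uncurry_pi) h
  filter_upwards [this] with z hz
  simp only [marginal, hz]

/-- The noise traders' rate is the adjoint of integration in time of its negative drift. -/
theorem isBackward_ψrate (hM : Martingale E.Mψ F P)
    (hterm : ∀ t : Time T, ENNReal.ofReal t = T → E.ψrate t =ᵐ[P] 0) (i : Fin d) :
    IsBackward P F E.δ (fun t ω => E.ψrate t ω i)
      (fun t ω => E.δ * E.ψrate t ω i - E.μψ t ω i) := by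
  have hr := E.ψrate_mem.apply i
  refine isBackward_of_martingale hr ((hr.const_mul E.δ).sub (E.μψ_mem.apply i)) (hM.apply i)
    (fun t => ?_) fun t ht => ?_
  · filter_upwards [E.ψrate_eq t, ae_position_apply E.μψ_mem] with ω h1 h2
    rw [h1, Pi.add_apply, Pi.add_apply, Pi.sub_apply, h2]
    simp only [sub_sub_cancel]
    ring
  · filter_upwards [hterm t ht] with ω h1
    rw [h1]
    rfl

variable {E}

/-- For the Agents `1, …, N - 1` the first-order condition is a row of the system. For Agent `N` the
other conditions are subtracted from the identity for the noise traders' rate, the only place where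
the martingale property and the terminal value of that rate enter. -/
theorem IsFBSDESolution.isOptimal (h : E.IsFBSDESolution φ φrate M) (hM : Martingale E.Mψ F P)
    (hterm : ∀ t : Time T, ENNReal.ofReal t = T → E.ψrate t =ᵐ[P] 0) (n : Fin (K + 1)) :
    E.IsOptimal n (E.equilibriumReturn φ) (E.agentRate φrate n) := by
  have hν := E.memL2_equilibriumReturn h.mem
  have hr := E.memL2_agentRate h.rate_mem
  have hp := E.memL2_agentPosition h.mem
  have hm := fun n => E.memL2_marginal n hν (hp n)
  have hs := E.memL2_source h.mem
  rw [E.isOptimal_iff_adjoint hν (hr n)]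
  intro i
  have hcongr : ((E.memL2_marginal n hν (hr n).integral_pi).apply i).toSpace
      = ((hm n).apply i).toSpace := by
    rw [MemL2.toSpace_eq_iff]
    filter_upwards [E.ae_marginal_eq (ν := E.equilibriumReturn φ) n (hr n).integral_pi (hp n)
      (E.ae_position_agentRate h.rate_mem h.forward n)] with z hz
    rw [hz]
  rw [hcongr]
  have hcast : ∀ m : Fin K, (2 * E.lam i) • (h.rate_mem.apply (m, i)).toSpace =
      (integrationOp P F E.δ).adjoint ((hm m.castSucc).apply i).toSpace := by
    intro m
    rw [(h.isBackward (m, i)).toSpace_eq (h.rate_mem.apply (m, i)) (hs.apply (m, i)), ← map_smul,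
      ← MemL2.toSpace_const_mul]
    congr 1
    exact MemL2.toSpace_congr _ _ fun t ω => E.two_lam_mul_source t ω m i
  -- The rate is the adjoint applied to `δ ψ' - μ^ψ`, and `sum_marginal` identifies this with minus
  -- the summed marginal benefits, up to `2 λ_i`.
  have hψ : (2 * E.lam i) • (E.ψrate_mem.apply i).toSpace = -(integrationOp P F E.δ).adjoint
      (∑ n, ((hm n).apply i).toSpace) := by
    have hg := ((E.ψrate_mem.apply i).const_mul E.δ).sub (E.μψ_mem.apply i)
    rw [(E.isBackward_ψrate hM hterm i).toSpace_eq (E.ψrate_mem.apply i) hg, ← map_smul, ← map_neg,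
      ← MemL2.toSpace_const_mul, ← MemL2.toSpace_sum, ← MemL2.toSpace_neg]
    congr 1
    refine MemL2.toSpace_congr _ _ fun t ω => ?_
    rw [E.sum_marginal t ω i]
    ring
  induction n using Fin.lastCases with
  | last =>
    have h1 : ((hr (Fin.last K)).apply i).toSpace = -∑ m : Fin K, (h.rate_mem.apply (m, i)).toSpace
        - (E.ψrate_mem.apply i).toSpace := by
      rw [← MemL2.toSpace_sum _ fun m => h.rate_mem.apply (m, i), ← MemL2.toSpace_neg,
        ← MemL2.toSpace_sub]
      refine MemL2.toSpace_congr _ _ fun t ω => ?_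
      rw [agentRate_last, Pi.sub_apply, Pi.neg_apply, Finset.sum_apply]
    rw [h1, smul_sub, smul_neg, Finset.smul_sum, hψ, Finset.sum_congr rfl fun m _ => hcast m,
      ← map_sum, Fin.sum_univ_castSucc, map_add]
    abel
  | cast m =>
    rw [← hcast m]
    congr 1
    exact MemL2.toSpace_congr _ _ fun t ω => by rw [agentRate_castSucc]

theorem IsFBSDESolution.isEquilibrium (h : E.IsFBSDESolution φ φrate M)
    (hM : Martingale E.Mψ F P)
    (hterm : ∀ t : Time T, ENNReal.ofReal t = T → E.ψrate t =ᵐ[P] 0) :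
    E.IsEquilibrium (E.equilibriumReturn φ) (E.agentRate φrate) := by
  refine ⟨E.memL2_equilibriumReturn h.mem, h.isOptimal hM hterm, ?_⟩
  filter_upwards [ae_all_iff.2 fun n => E.ae_position_agentRate h.rate_mem h.forward n] with ω hω t
  simp only [hω]
  exact E.sum_agentPosition t ω

/-- The positions of the Agents `1, …, N - 1`. -/
def stack (x : Fin (K + 1) → Time T → Ω → Fin d → ℝ) (t : Time T) (ω : Ω) : Fin K × Fin d → ℝ :=
  fun p => x p.1.castSucc t ω p.2

theorem agentPosition_stack {x : Fin (K + 1) → Time T → Ω → Fin d → ℝ} {t : Time T} {ω : Ω}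
    (h : ∑ n, x n t ω + E.ψ t ω = 0) (n : Fin (K + 1)) :
    E.agentPosition (stack x) n t ω = x n t ω := by
  induction n using Fin.lastCases with
  | last =>
    rw [agentPosition_last]
    rw [Fin.sum_univ_castSucc] at h
    have h1 : (∑ m : Fin K, fun i => stack x t ω (m, i)) = ∑ m : Fin K, x m.castSucc t ω := rfl
    rw [h1, eq_neg_of_add_eq_zero_right h]
    abel
  | cast m => rw [agentPosition_castSucc]; rfl

/-- Clearing is a statement about positions at all times; since an integral that vanishes
identically has a vanishing integrand, the rates clear as well. -/
theorem IsEquilibrium.sum_rate {u : Fin (K + 1) → Time T → Ω → Fin d → ℝ}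
    (h : E.IsEquilibrium ν u) (i : Fin d) :
    (E.ψrate_mem.apply i).toSpace = -∑ n, ((h.2.1 n).1.1.apply i).toSpace := by
  have hu := fun n => (h.2.1 n).1.1.apply i
  have hs := MemL2.sum (P := P) (F := F) (δ := E.δ) Finset.univ fun n _ => hu n
  have hR := hs.add (E.ψrate_mem.apply i)
  have h0 : ∀ᵐ ω ∂P, ∀ t, position (fun t ω => ∑ n, u n t ω i + E.ψrate t ω i) t ω = 0 := by
    filter_upwards [hs.position_add (E.ψrate_mem.apply i),
      MemL2.ae_position_sum (P := P) (F := F) (δ := E.δ) Finset.univ fun n _ => hu n, h.2.2,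
      ae_position_apply E.ψrate_mem, ae_all_iff.2 fun n => ae_position_apply (h.2.1 n).1.1, E.ψ_eq]
      with ω h1 h2 h3 h4 h5 h6 t
    rw [h1, h2]
    have h7 := congrFun (h3 t) i
    simp only [Pi.add_apply, Finset.sum_apply, Pi.zero_apply, h5, h6, h4] at h7
    exact h7
  have h1 := hR.ae_eq_zero_of_position h0
  rw [← MemL2.toSpace_sum _ hu, ← MemL2.toSpace_neg, MemL2.toSpace_eq_iff]
  filter_upwards [h1] with z hz
  linarith

/-- The summed first-order conditions pin down the return in terms of the agents' own positions;
inserted back, the individual conditions become the forward-backward system, whose uniqueness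
identifies the positions. -/
theorem IsFBSDESolution.eq_of_isEquilibrium (h : E.IsFBSDESolution φ φrate M)
    {u : Fin (K + 1) → Time T → Ω → Fin d → ℝ} (hE : E.IsEquilibrium ν u) :
    (∀ᵐ ω ∂P, ∀ᵐ t ∂(timeMeasure T), ν t ω = E.equilibriumReturn φ t ω) ∧
      ∀ n, ∀ᵐ ω ∂P, ∀ t, position (u n) t ω = E.agentPosition φ n t ω := by
  have hν := hE.1
  have hu := fun n => (hE.2.1 n).1.1
  have hpu := fun n => (hu n).integral_pi
  have hm := fun n => E.memL2_marginal n hν (hpu n)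
  have hfoc := fun n => (E.isOptimal_iff_adjoint hν (hu n)).1 (hE.2.1 n)
  set φ' := stack (K := K) fun n => position (u n) with hφ'
  have hφ'm : MemL2 P F E.δ φ' := memL2_pi_iff.2 fun p => (hpu p.1.castSucc).apply p.2
  have hum : MemL2 P F E.δ (stack (K := K) u) := memL2_pi_iff.2 fun p => (hu p.1.castSucc).apply p.2
  have hpos : ∀ᵐ ω ∂P, ∀ n t, position (u n) t ω = E.agentPosition φ' n t ω := by
    filter_upwards [hE.2.2] with ω hω n t
    exact (agentPosition_stack (x := fun n => position (u n)) (hω t) n).symm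
  have hposz : ∀ᵐ z ∂((timeMeasure T).prod P), ∀ n,
      E.marginal n ν (position (u n)) z.1 z.2 = E.marginal n ν (E.agentPosition φ' n) z.1 z.2 :=
    ae_all_iff.2 fun n => E.ae_marginal_eq n (hpu n) (E.memL2_agentPosition hφ'm n)
      (hpos.mono fun ω hω => hω n)
  have hdrift : ∀ᵐ z ∂((timeMeasure T).prod P), ∀ i,
      ∑ n, E.marginal n ν (position (u n)) z.1 z.2 i
        = 2 * E.lam i * (E.μψ z.1 z.2 i - E.δ * E.ψrate z.1 z.2 i) := by
    refine ae_all_iff.2 fun i => ?_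
    have hlam := (E.lam_pos i).ne'
    have hsum := MemL2.sum (P := P) (F := F) (δ := E.δ) Finset.univ fun n _ => (hm n).apply i
    -- Summing the first-order conditions and clearing gives `ψ' = V* g` with `g = -(2 λ_i)⁻¹` times
    -- the summed marginal benefits. Hence `g = δ ψ' - μ^ψ`, although `M^ψ` is only a local
    -- martingale.
    have h1 := drift_eq_of_toSpace_eq (E.ψrate_mem.apply i) (E.μψ_mem.apply i)
      (hsum.const_mul (-(2 * E.lam i)⁻¹)) (E.Mψ_localMartingale.apply i) (fun t => by
        filter_upwards [E.ψrate_eq t, ae_position_apply E.μψ_mem] with ω h1 h2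
        rw [h1, Pi.add_apply, Pi.add_apply, Pi.sub_apply, h2]) (by
        rw [hsum.toSpace_const_mul, MemL2.toSpace_sum _ fun n => (hm n).apply i, map_smul,
          map_sum, ← Finset.sum_congr rfl fun n _ => hfoc n i, ← Finset.smul_sum, smul_smul,
          hE.sum_rate i, neg_mul, inv_mul_cancel₀ (by positivity), neg_one_smul])
    filter_upwards [h1] with z hz
    field_simp at hz
    linarith
  have hνeq : ∀ᵐ z ∂((timeMeasure T).prod P), ν z.1 z.2 = E.equilibriumReturn φ' z.1 z.2 := by
    filter_upwards [hdrift, hposz] with z h1 h2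
    refine E.eq_equilibriumReturn fun i => ?_
    rw [← h1 i]
    exact Finset.sum_congr rfl fun n _ => by rw [h2]
  have hstack : ∀ᵐ ω ∂P, ∀ t, position (stack (K := K) u) t ω = φ' t ω := by
    filter_upwards [ae_position_apply hum, ae_all_iff.2 fun n => ae_position_apply (hu n)]
      with ω h1 h2 t
    funext p
    rw [h1, hφ', stack, h2]
    rfl
  -- For the Agents `1, …, N - 1` the marginal benefit is `2 λ_i` times the source, and the factor
  -- cancels from the first-order condition.
  have hsol : E.IsAdjointSolution hum := by
    rintro ⟨m, i⟩
    have hlam := (E.lam_pos i).ne'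
    have h1 := hfoc m.castSucc i
    have h2 : ((hm m.castSucc).apply i).toSpace = (2 * E.lam i) •
        ((E.memL2_source hum.integral_pi).apply (m, i)).toSpace := by
      rw [← MemL2.toSpace_const_mul, MemL2.toSpace_eq_iff]
      filter_upwards [hνeq, hposz, E.ae_source_eq hum.integral_pi hφ'm hstack] with z e1 e2 e3
      rw [e2, e3, E.two_lam_mul_source]
      simp only [marginal, e1]
    rw [h2, map_smul] at h1
    exact smul_right_injective _ (mul_ne_zero two_ne_zero hlam) h1
  have hφ : ∀ᵐ ω ∂P, ∀ t, φ' t ω = φ t ω := by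
    filter_upwards [position_congr (hsol.ae_eq E h.isAdjointSolution), hstack, h.forward]
      with ω h1 h2 h3 t
    rw [← h2, h1, h3]
  refine ⟨?_, fun n => ?_⟩
  · filter_upwards [ae_ae_of_ae_time_prod (p := fun t ω => ν t ω = E.equilibriumReturn φ' t ω) hνeq,
      hφ] with ω h1 h2
    filter_upwards [h1] with t ht
    rw [ht]
    simp only [equilibriumReturn, h2]
  · filter_upwards [hpos, hφ] with ω h1 h2 t
    rw [h1]
    simp only [agentPosition, h2]

end Market

theorem theorem5p2 {Ω : Type*} {mΩ : MeasurableSpace Ω} (P : Measure Ω) [IsProbabilityMeasure P]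
    (T : ℝ≥0∞) (F : Filtration (Time T) mΩ) (K d : ℕ) (E : Market P F K d) :
    -- the linear system has a solution
    (∃ φ φrate M, E.IsFBSDESolution φ φrate M) ∧
    ∀ φ φrate M, E.IsFBSDESolution φ φrate M →
      -- its solution is unique
      (∀ φ₂ φrate₂ M₂, E.IsFBSDESolution φ₂ φrate₂ M₂ →
        (∀ᵐ ω ∂P, ∀ t, φ₂ t ω = φ t ω) ∧ ∀ t, φrate₂ t =ᵐ[P] φrate t) ∧
      -- any equilibrium return and the corresponding optimal strategies are of the stated form
      (∀ ν u, E.IsEquilibrium ν u →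
        (∀ᵐ ω ∂P, ∀ᵐ t ∂(timeMeasure T), ν t ω = E.equilibriumReturn φ t ω) ∧
        ∀ n, ∀ᵐ ω ∂P, ∀ t, position (u n) t ω = E.agentPosition φ n t ω) ∧
      -- the stated return is an equilibrium return, and the stated strategies are the unique
      -- individually optimal ones for it
      (Martingale E.Mψ F P → (∀ t : Time T, ENNReal.ofReal t = T → E.ψrate t =ᵐ[P] 0) →
        E.IsEquilibrium (E.equilibriumReturn φ) (E.agentRate φrate) ∧
        ∀ n, (∀ᵐ ω ∂P, ∀ t, position (E.agentRate φrate n) t ω = E.agentPosition φ n t ω) ∧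
          ∀ v, E.IsOptimal n (E.equilibriumReturn φ) v →
            ∀ᵐ ω ∂P, ∀ t, position v t ω = E.agentPosition φ n t ω) := by
  refine ⟨E.exists_isFBSDESolution, fun φ φrate M h => ⟨fun _ _ _ h₂ => h.unique h₂,
    fun ν u hE => h.eq_of_isEquilibrium hE, fun hM hterm => ⟨h.isEquilibrium hM hterm, fun n => ?_⟩⟩⟩
  have hpos := E.ae_position_agentRate h.rate_mem h.forward n
  refine ⟨hpos, fun v hv => ?_⟩
  filter_upwards [hpos, E.ae_position_eq_of_isOptimal (E.memL2_equilibriumReturn h.mem)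
    (h.isOptimal hM hterm n) hv] with ω h1 h2 t
  rw [h2, h1]
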